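/- Let $m=(m_k)_{k\ge 0}$ be a bounded sequence of integers $m_k\ge 2$, let $G_m=\prod_k \mathbb Z/m_k$ carry its normalised Haar measure $\mu$ (the product of the uniform measures), and let $M_0=1$, $M_{k+1}=m_kM_k$. Let $\psi_n=\prod_k r_k^{n_k}$ be the Vilenkin functions, where $r_k(x)=\exp(2\pi i x_k/m_k)$ and $n=\sum_k n_kM_k$ with $0\le n_k<m_k$. Let $\mathcal F_n$ be the $\sigma$-algebra of the sets determined by the first $n$ coordinates. For $0<p<\infty$ the martingale Hardy space $H_p$ consists of the (complex-valued) martingales $f=(f^{(n)})_{n\ge0}$ with respect to $(\mathcal F_n)$ such that $\|f\|_{H_p}:=\|\sup_n|f^{(n)}|\|_p<\infty$. Put $$\widehat f(i)=\lim_{k\to\infty}\int f^{(k)}\overline{\psi_i}\,d\mu,\qquad S_nf=\sum_{k=0}^{n-1}\widehat f(k)\psi_k .$$ For a sequence $(q_k)_{k\ge 0}$ of non-negative numbers with $q_0>0$ put $Q_n=\sum_{k=0}^{n-1}q_k$ and $T_nf=\frac1{Q_n}\sum_{k=0}^{n-1}q_kS_kf$ for $n\ge1$. The Fejér means $\sigma_nf=\frac1n\sum_{k=0}^{n-1}S_kf$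 are the case $q_k\equiv1$. Let $\|g\|_{weak\text{-}L_p}=\sup_{t>0}t\,\mu(|g|>t)^{1/p}$. Let $0<p\le 1/2$ and $w_n=(n+1)^{1/p-2}\log^{2[1/2+p]}(n+1)$, where $[\cdot]$ denotes the integer part. (a) If $(q_k)$ is non-increasing, then the maximal operator $\widetilde T_p^*f=\sup_{n\ge1}|T_nf|/w_n$ is bounded from $H_p$ to $L_p$, that is, there is a finite constant $C$ with $\|\widetilde T_p^*f\|_p\le C\|f\|_{H_p}$ for all $f\in H_p$. (b) If $(q_k)$ is non-decreasing and $q_{n-1}/Q_n=O(1/n)$ as $n\to\infty$, then $\widetilde T_p^*$ is bounded from $H_p$ to $L_p$. (c) The weights are sharp in (a) and in (b), in the following sense; the sequence $q_k\equiv1$ satisfies the assumptions of both. Let $(\Phi_n)$ be a non-decreasing sequence of positive numbers with $\limsup_{n\to\infty}w_n/\Phi_n=+\infty$. Then the maximal operator $\sup_{n\ge1}|\sigma_nf|/\Phi_n$ is not bounded from $H_p$ to $L_p$. Moreover, if $p<1/2$, then $$\sup_{n\ge1}\ \sup_{f\in H_p,\ \|f\|_{H_p}\ne0}\frac{\|\sigma_nf/\Phi_n\|_{weak\text{-}L_p}}{\|f\|_{H_p}}=\infty,$$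 and if $p=1/2$, then $$\sup_{n\ge1}\ \sup_{f\in H_{1/2},\ \|f\|_{H_{1/2}}\ne0}\frac{\|\sigma_nf/\Phi_n\|_{1/2}}{\|f\|_{H_{1/2}}}=\infty .$$ -/

import Mathlib

open MeasureTheory Filter Topology Asymptotics
open scoped ENNReal NNReal

namespace Vilenkin

/-- The Vilenkin group `G_m`, the complete direct product of the cyclic groups `ℤ/m_k`. -/
abbrev Group (m : ℕ → ℕ) : Type := (k : ℕ) → ZMod (m k)

/-- The measure on `ℤ/m_k` giving mass `1 / m_k` to every point. -/
noncomputable def factorMeasure (m : ℕ → ℕ) (k : ℕ) : Measure (ZMod (m k)) :=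
  (m k : ℝ≥0∞)⁻¹ • Measure.count

/-- The normalised Haar measure of `G_m`: the direct product of the uniform measures. -/
noncomputable def haar (m : ℕ → ℕ) : Measure (Group m) :=
  Measure.infinitePi (factorMeasure m)

theorem isProbabilityMeasure_factorMeasure (m : ℕ → ℕ) (hm : ∀ k, 2 ≤ m k) (k : ℕ) :
    IsProbabilityMeasure (factorMeasure m k) := by
  have : NeZero (m k) := ⟨by have := hm k; omega⟩
  refine ⟨?_⟩
  have h0 : (m k : ℝ≥0∞) ≠ 0 := by exact_mod_cast NeZero.ne (m k)
  simp [factorMeasure, Measure.count_univ, ENat.card_eq_coe_fintype_card, ZMod.card,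
    ENNReal.inv_mul_cancel h0 (ENNReal.natCast_ne_top _)]

theorem isProbabilityMeasure_haar (m : ℕ → ℕ) (hm : ∀ k, 2 ≤ m k) :
    IsProbabilityMeasure (haar m) := by
  have := isProbabilityMeasure_factorMeasure m hm
  unfold haar
  infer_instance

/-- The interval `I_n(x)`: all points having the same first `n` coordinates as `x`. -/
def interval (m : ℕ → ℕ) (n : ℕ) (x : Group m) : Set (Group m) :=
  {y | ∀ i, i < n → y i = x i}

/-- The first `n` coordinates of a point. -/
def trunc (m : ℕ → ℕ) (n : ℕ) (x : Group m) : (i : Fin n) → ZMod (m i) := fun i => x i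

theorem measurable_trunc (m : ℕ → ℕ) (n : ℕ) : Measurable (trunc m n) :=
  measurable_pi_iff.mpr fun i => measurable_pi_apply (i : ℕ)

/-- The filtration `F_n`: sets that are determined by the first `n` coordinates. It is the
`σ`-algebra generated by the intervals `I_n(x)`, see `filtration_eq_generateFrom`. -/
def filtration (m : ℕ → ℕ) : Filtration ℕ (inferInstance : MeasurableSpace (Group m)) where
  seq n := MeasurableSpace.comap (trunc m n) inferInstance
  mono' := by
    intro a b hab
    have hg : Measurable (fun (y : (i : Fin b) → ZMod (m i)) (i : Fin a) =>
        y (Fin.castLE hab i)) :=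
      measurable_pi_iff.mpr fun i => measurable_pi_apply (Fin.castLE hab i)
    rintro s ⟨t, ht, rfl⟩
    exact ⟨_, hg ht, rfl⟩
  le' n := (measurable_trunc m n).comap_le

theorem filtration_eq_generateFrom (m : ℕ → ℕ) (n : ℕ) :
    filtration m n = MeasurableSpace.generateFrom (Set.range (interval m n)) := by
  have hpre : ∀ x : Group m, interval m n x = trunc m n ⁻¹' {trunc m n x} := by
    intro x
    ext y
    simp only [interval, Set.mem_ofPred_eq, Set.mem_preimage, Set.mem_singleton_iff, funext_iff,
      trunc]
    exact ⟨fun h i => h i i.2, fun h i hi => h ⟨i, hi⟩⟩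
  have hcount : ∀ k : ℕ, Countable (ZMod k) := by
    intro k
    cases k
    · exact inferInstanceAs (Countable ℤ)
    · exact inferInstanceAs (Countable (Fin _))
  have hcount' : Countable ((i : Fin n) → ZMod (m i)) := by
    have := fun i : Fin n => hcount (m i)
    infer_instance
  apply le_antisymm
  · rintro s ⟨t, -, rfl⟩
    have hs : trunc m n ⁻¹' t = ⋃ y ∈ t, trunc m n ⁻¹' {y} := by
      rw [← Set.preimage_iUnion₂, Set.biUnion_of_singleton]
    rw [hs]
    refine @MeasurableSet.biUnion _ _ (MeasurableSpace.generateFrom _) _ _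
      (Set.to_countable t) fun y _ => ?_
    by_cases hy : ∃ x, trunc m n x = y
    · obtain ⟨x, rfl⟩ := hy
      rw [← hpre]
      exact MeasurableSpace.measurableSet_generateFrom ⟨x, rfl⟩
    · have : trunc m n ⁻¹' {y} = ∅ := by
        ext x
        simpa using fun h => hy ⟨x, h⟩
      rw [this]
      exact @MeasurableSet.empty _ (MeasurableSpace.generateFrom _)
  · refine MeasurableSpace.generateFrom_le ?_
    rintro _ ⟨x, rfl⟩
    rw [hpre]
    exact ⟨_, measurableSet_singleton _, rfl⟩

/-- The generalised powers `M_0 = 1`, `M_{k+1} = m_k M_k`. -/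
def M (m : ℕ → ℕ) (k : ℕ) : ℕ := ∏ i ∈ Finset.range k, m i

/-- The digits `n_j` of `n = ∑_j n_j M_j`, `0 ≤ n_j < m_j`. -/
def digit (m : ℕ → ℕ) (n j : ℕ) : ℕ := n / M m j % m j

theorem lt_M (m : ℕ → ℕ) (hm : ∀ k, 2 ≤ m k) (k : ℕ) : k < M m k :=
  k.lt_two_pow_self.trans_le <| by
    simpa [M] using Finset.prod_le_prod' (s := Finset.range k) fun i _ => hm i

/-- Only the digits `n_j` with `j < n` can differ from zero. -/
theorem digit_eq_zero (m : ℕ → ℕ) (hm : ∀ k, 2 ≤ m k) {n j : ℕ} (h : n ≤ j) :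
    digit m n j = 0 := by
  rw [digit, Nat.div_eq_of_lt (h.trans_lt (lt_M m hm j)), Nat.zero_mod]

/-- The generalised Rademacher functions `r_k(x) = exp(2πi x_k / m_k)`. -/
noncomputable def rademacher (m : ℕ → ℕ) (k : ℕ) (x : Group m) : ℂ :=
  Complex.exp (2 * Real.pi * Complex.I * ((x k).val : ℂ) / (m k : ℂ))

/-- The Vilenkin functions `ψ_n = ∏_k r_k ^ {n_k}`. By `digit_eq_zero` all factors with `k ≥ n`
are equal to `1`, so that this finite product is the full product. -/
noncomputable def psi (m : ℕ → ℕ) (n : ℕ) (x : Group m) : ℂ :=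
  ∏ k ∈ Finset.range n, rademacher m k x ^ digit m n k

/-- The Vilenkin-Fourier coefficients `lim_k ∫ f^{(k)} conj(ψ_i) dμ` of a martingale. -/
noncomputable def coeff (m : ℕ → ℕ) (f : ℕ → Group m → ℂ) (i : ℕ) : ℂ :=
  limUnder atTop fun k : ℕ => ∫ x, f k x * (starRingEnd ℂ) (psi m i x) ∂(haar m)

/-- The partial sums `S_n f = ∑_{k<n} f^(k) ψ_k`. -/
noncomputable def partialSum (m : ℕ → ℕ) (n : ℕ) (f : ℕ → Group m → ℂ) (x : Group m) : ℂ :=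
  ∑ k ∈ Finset.range n, coeff m f k * psi m k x

/-- `Q_n = ∑_{k<n} q_k`. -/
noncomputable def Q (q : ℕ → ℝ) (n : ℕ) : ℝ := ∑ k ∈ Finset.range n, q k

/-- The `T` means `T_n f = Q_n⁻¹ ∑_{k<n} q_k S_k f`. -/
noncomputable def tMean (m : ℕ → ℕ) (q : ℕ → ℝ) (n : ℕ) (f : ℕ → Group m → ℂ)
    (x : Group m) : ℂ :=
  ((Q q n : ℝ) : ℂ)⁻¹ * ∑ k ∈ Finset.range n, (q k : ℂ) * partialSum m k f x

/-- The Fejér means `σ_n f = n⁻¹ ∑_{k<n} S_k f`, which are the `T` means with `q_k = 1`. -/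
noncomputable def fejerMean (m : ℕ → ℕ) (n : ℕ) (f : ℕ → Group m → ℂ) (x : Group m) : ℂ :=
  tMean m (fun _ => 1) n f x

theorem fejerMean_eq (m : ℕ → ℕ) (n : ℕ) (f : ℕ → Group m → ℂ) (x : Group m) :
    fejerMean m n f x = (n : ℂ)⁻¹ * ∑ k ∈ Finset.range n, partialSum m k f x := by
  simp [fejerMean, tMean, Q]

/-- The maximal function `f* = sup_n |f^{(n)}|` of a martingale. -/
noncomputable def maximalFunction (m : ℕ → ℕ) (f : ℕ → Group m → ℂ) (x : Group m) : ℝ≥0∞ :=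
  ⨆ n : ℕ, ‖f n x‖ₑ

/-- The Hardy quasi-norm `‖f‖_{H_p} = ‖f*‖_p`. -/
noncomputable def hardyNorm (m : ℕ → ℕ) (p : ℝ) (f : ℕ → Group m → ℂ) : ℝ≥0∞ :=
  eLpNorm (maximalFunction m f) (ENNReal.ofReal p) (haar m)

/-- Membership in the martingale Hardy space `H_p`. -/
def MemHardy (m : ℕ → ℕ) (p : ℝ) (f : ℕ → Group m → ℂ) : Prop :=
  Martingale f (filtration m) (haar m) ∧ hardyNorm m p f < ∞

/-- The `weak-L_p` quasi-norm `sup_{t>0} t μ(|g| > t)^{1/p}`. -/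
noncomputable def weakNorm (m : ℕ → ℕ) (p : ℝ) (g : Group m → ℂ) : ℝ≥0∞ :=
  ⨆ t : ℝ≥0, (t : ℝ≥0∞) * (haar m {x | (t : ℝ≥0∞) < ‖g x‖ₑ}) ^ (1 / p)

/-- The maximal operator of the `T` means with weights `w`: `sup_{n ≥ 1} |T_n f| / w_n`. -/
noncomputable def weightedMaximal (m : ℕ → ℕ) (q w : ℕ → ℝ) (f : ℕ → Group m → ℂ)
    (x : Group m) : ℝ≥0∞ :=
  ⨆ n : ℕ, ⨆ _ : 1 ≤ n, ‖tMean m q n f x‖ₑ / ENNReal.ofReal (w n)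

theorem measurable_psi (m : ℕ → ℕ) (n : ℕ) : Measurable (psi m n) := by
  refine Finset.measurable_fun_prod _ fun k _ => Measurable.pow_const ?_ _
  exact (measurable_from_top (f := fun z : ZMod (m k) =>
    Complex.exp (2 * Real.pi * Complex.I * (z.val : ℂ) / (m k : ℂ)))).comp (measurable_pi_apply k)

theorem measurable_weightedMaximal (m : ℕ → ℕ) (q w : ℕ → ℝ) (f : ℕ → Group m → ℂ) :
    Measurable (weightedMaximal m q w f) := by
  refine Measurable.iSup fun n => Measurable.iSup fun _ => Measurable.div_const ?_ _
  refine Measurable.enorm (Measurable.const_mul ?_ _)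
  refine Finset.measurable_fun_sum _ fun k _ => Measurable.const_mul ?_ _
  exact Finset.measurable_fun_sum _ fun i _ => (measurable_psi m i).const_mul _

/-- Boundedness of an operator from the martingale Hardy space `H_p` to `L_p`. -/
def BoundedHardyLp (m : ℕ → ℕ) (p : ℝ) (A : (ℕ → Group m → ℂ) → Group m → ℝ≥0∞) : Prop :=
  ∃ C : ℝ≥0, ∀ f : ℕ → Group m → ℂ, MemHardy m p f →
    eLpNorm (A f) (ENNReal.ofReal p) (haar m) ≤ C * hardyNorm m p f

/-- The weights `(n+1)^{1/p-2} log^{2[1/2+p]}(n+1)`, with `[·]` the integer part. -/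
noncomputable def weight (p : ℝ) (n : ℕ) : ℝ :=
  ((n : ℝ) + 1) ^ (1 / p - 2) * Real.log ((n : ℝ) + 1) ^ (2 * ⌊1 / 2 + p⌋₊)

end Vilenkin

namespace Vilenkin

/-! Boundedness. Let `D_j` be the Dirichlet kernels and `K_n = ∑_{j<n} D_j`. If `u` has nonzero
coordinates `s < l`, then `|K_n(u)| ≤ M_{s+1} M_{l+1}` for every `n` (`norm_fejer_le`): coordinate
`s` makes complete Dirichlet blocks cancel, coordinate `l` makes complete Fejér blocks cancel. Let
`a` be bounded by `A`, of mean zero and supported on `I_N(z)`. Its partial sums of order at most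
`M_N` vanish, so only `n > M_N` matters, and summation by parts transfers the bound for `K_n` to
`T_n a` with the factor `Q_n / M_N`; both hypotheses on `q` give this (`AdmissibleCoefficients`).
Where `x` first differs from `z` at `s` and next at `l < N`, the weighted maximal function is `O(A
M_{s+1} M_{l+1} / (M_N² w(M_N)))`. If only coordinate `s < N` differs, the Dirichlet bound gives
`O(A M_{s+1} / M_N)`; on `I_N(z)` itself the logarithmic Lebesgue constant is absorbed by `w`.
Integrating `p`-th powers leaves `∑_{l<N} M_{l+1}^{2p-1} = O((M_N² w(M_N))^p / M_N)` to be checked.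
The sum is bounded for `p < 1/2` and equals `N` for `p = 1/2`, which explains the power and the
squared logarithm in the weight.

To pass from atoms to martingales, `f` is stopped at the levels `r 2^k` just before they are
exceeded. Consecutive stopped martingales differ by atoms of height `3 r 2^k`, supported on
intervals of total measure at most `B μ(f* > r 2^k)`. Since `t ↦ t^p` is subadditive for `p ≤ 1`,
the estimates add up to `O(∫ (f*)^p + r^p)`.

Sharpness. The martingale generated by `r_N` on `I_N(0)` has Hardy norm `M_N^{-1/p}`, and its Fejér
mean of order `M_N + b`, `b ≤ M_N`, has modulus `|K_b| / ((M_N + b) M_N)`. For `p < 1/2` take `b =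
2`, where `K_2 = 1`. For `p = 1/2` take `b = ∑ M_{2i}`: each even level contributes at least `1/8`
to `∫ |K_b|^{1/2}`, so that its square has order `N²`. Monotonicity of `Φ` carries the hypothesis
from an arbitrary index to one of this form. -/

variable {m : ℕ → ℕ}

/-! ### Generalised powers, digits and Vilenkin functions. -/

theorem M_succ (k : ℕ) : M m (k + 1) = M m k * m k := by simp [M, Finset.prod_range_succ]

theorem M_pos (hm : ∀ k, 2 ≤ m k) (k : ℕ) : 0 < M m k :=
  Finset.prod_pos fun i _ => by have := hm i; omega

theorem M_dvd {j k : ℕ} (h : j ≤ k) : M m j ∣ M m k :=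
  Finset.prod_dvd_prod_of_subset _ _ _ (by simpa using h)

theorem M_mono (hm : ∀ k, 2 ≤ m k) : Monotone (M m) := fun _ k h =>
  Nat.le_of_dvd (M_pos hm k) (M_dvd h)

theorem two_mul_M_le (hm : ∀ k, 2 ≤ m k) (k : ℕ) : 2 * M m k ≤ M m (k + 1) := by
  rw [M_succ, mul_comm]; exact Nat.mul_le_mul_left _ (hm k)

theorem two_pow_le_M (hm : ∀ k, 2 ≤ m k) (k : ℕ) : 2 ^ k ≤ M m k := by
  simpa [M] using Finset.prod_le_prod' (s := Finset.range k) fun i _ => hm i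

theorem M_le_pow {B : ℕ} (hB : ∀ k, m k ≤ B) (k : ℕ) : M m k ≤ B ^ k := by
  simpa [M] using Finset.prod_le_prod' (s := Finset.range k) fun i _ => hB i

theorem M_succ_le {B : ℕ} (hB : ∀ k, m k ≤ B) (k : ℕ) : M m (k + 1) ≤ B * M m k := by
  rw [M_succ, mul_comm]; exact Nat.mul_le_mul_right _ (hB k)

theorem digit_eq_zero_of_lt (hm : ∀ k, 2 ≤ m k) {n k j : ℕ} (hn : n < M m k) (hj : k ≤ j) :
    digit m n j = 0 := by
  rw [digit, Nat.div_eq_of_lt (hn.trans_le (M_mono hm hj)), Nat.zero_mod]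

theorem psi_eq_prod (hm : ∀ k, 2 ≤ m k) {n K : ℕ} (hn : n < M m K) (x : Group m) :
    psi m n x = ∏ k ∈ Finset.range K, rademacher m k x ^ digit m n k := by
  have key : ∀ L L', n < M m L → L ≤ L' →
      ∏ k ∈ Finset.range L, rademacher m k x ^ digit m n k =
      ∏ k ∈ Finset.range L', rademacher m k x ^ digit m n k := by
    intro L L' hL hLL
    refine Finset.prod_subset (by simpa using hLL) fun k _ hk => ?_
    rw [digit_eq_zero_of_lt hm hL (by simpa using hk), pow_zero]
  rcases le_total K n with h | h
  · exact (key K n hn h).symm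
  · exact key n K (lt_M m hm n) h

/-- No carry occurs: a multiple of `M_k` and a number below `M_k` occupy disjoint digit positions.
This makes `psi` multiplicative on such sums. -/
theorem digit_mul_add (hm : ∀ k, 2 ≤ m k) (c : ℕ) {b k : ℕ} (hb : b < M m k) (j : ℕ) :
    digit m (c * M m k + b) j = digit m (c * M m k) j + digit m b j := by
  rcases lt_or_ge j k with h | h
  · obtain ⟨t, ht⟩ := M_dvd (m := m) (show j + 1 ≤ k from h)
    rw [M_succ] at ht
    have e1 : c * M m k = M m j * (m j * (t * c)) := by rw [ht]; ring
    have h0 := M_pos hm j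
    simp only [digit]
    rw [e1, Nat.mul_add_div h0, Nat.mul_div_cancel_left _ h0, Nat.mul_add_mod, Nat.mul_mod_right,
      zero_add]
  · rw [digit_eq_zero_of_lt hm hb h, add_zero]
    obtain ⟨t, ht⟩ := M_dvd (m := m) h
    have h0 := M_pos hm k
    simp only [digit]
    rw [ht, ← Nat.div_div_eq_div_mul, ← Nat.div_div_eq_div_mul, mul_comm c, Nat.mul_add_div h0,
      Nat.mul_div_cancel_left _ h0, Nat.div_eq_of_lt hb, add_zero]

theorem digit_mul_M (hm : ∀ k, 2 ≤ m k) {k r : ℕ} (hr : r < m k) (j : ℕ) :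
    digit m (r * M m k) j = if j = k then r else 0 := by
  split_ifs with h
  · subst h
    rw [digit, Nat.mul_div_cancel _ (M_pos hm j), Nat.mod_eq_of_lt hr]
  · rcases lt_or_gt_of_ne h with h | h
    · obtain ⟨t, ht⟩ := M_dvd (m := m) (show j + 1 ≤ k from h)
      rw [M_succ] at ht
      have e1 : r * M m k = M m j * (m j * (t * r)) := by rw [ht]; ring
      rw [digit, e1, Nat.mul_div_cancel_left _ (M_pos hm j), Nat.mul_mod_right]
    · refine digit_eq_zero_of_lt hm (k := k + 1) ?_ h
      rw [M_succ, mul_comm]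
      exact Nat.mul_lt_mul_of_pos_left hr (M_pos hm k)

theorem psi_zero (x : Group m) : psi m 0 x = 1 := by simp [psi]

theorem psi_mul_add (hm : ∀ k, 2 ≤ m k) (c : ℕ) {b k : ℕ} (hb : b < M m k) (x : Group m) :
    psi m (c * M m k + b) x = psi m (c * M m k) x * psi m b x := by
  have h0 := lt_M m hm (c * M m k + b)
  rw [psi_eq_prod hm h0, psi_eq_prod hm (lt_of_le_of_lt (Nat.le_add_right _ _) h0),
    psi_eq_prod hm (lt_of_le_of_lt (Nat.le_add_left _ _) h0), ← Finset.prod_mul_distrib]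
  exact Finset.prod_congr rfl fun j _ => by rw [digit_mul_add hm c hb, pow_add]

theorem psi_mul_M (hm : ∀ k, 2 ≤ m k) {k r : ℕ} (hr : r < m k) (x : Group m) :
    psi m (r * M m k) x = rademacher m k x ^ r := by
  have h0 : r * M m k < M m (k + 1) := by
    rw [M_succ, mul_comm]; exact Nat.mul_lt_mul_of_pos_left hr (M_pos hm k)
  rw [psi_eq_prod hm h0, Finset.prod_eq_single k]
  · rw [digit_mul_M hm hr, if_pos rfl]
  · intro j _ hj
    rw [digit_mul_M hm hr, if_neg hj, pow_zero]
  · simp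

theorem rademacher_eq (hm : ∀ k, 2 ≤ m k) (k : ℕ) (x : Group m) :
    haveI : NeZero (m k) := ⟨by have := hm k; omega⟩
    rademacher m k x = (ZMod.toCircle (x k) : ℂ) := by
  have : NeZero (m k) := ⟨by have := hm k; omega⟩
  rw [ZMod.toCircle_apply, rademacher]

theorem norm_rademacher (hm : ∀ k, 2 ≤ m k) (k : ℕ) (x : Group m) : ‖rademacher m k x‖ = 1 := by
  rw [rademacher_eq hm]; exact Circle.norm_coe _

theorem rademacher_sub (hm : ∀ k, 2 ≤ m k) (k : ℕ) (x t : Group m) :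
    rademacher m k (x - t) = rademacher m k x * (starRingEnd ℂ) (rademacher m k t) := by
  have : NeZero (m k) := ⟨by have := hm k; omega⟩
  rw [rademacher_eq hm, rademacher_eq hm, rademacher_eq hm, Pi.sub_apply, AddChar.map_sub_eq_div,
    Circle.coe_div, div_eq_mul_inv, ← Circle.coe_inv, Circle.coe_inv_eq_conj]

theorem rademacher_eq_one (k : ℕ) {x : Group m} (h : x k = 0) : rademacher m k x = 1 := by
  simp [rademacher, h]

theorem rademacher_ne_one (hm : ∀ k, 2 ≤ m k) (k : ℕ) {x : Group m} (h : x k ≠ 0) :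
    rademacher m k x ≠ 1 := by
  have : NeZero (m k) := ⟨by have := hm k; omega⟩
  rw [rademacher_eq hm]
  intro h1
  refine h (ZMod.injective_toCircle ?_)
  rw [AddChar.map_zero_eq_one]
  exact Circle.ext (by simpa using h1)

theorem rademacher_pow (hm : ∀ k, 2 ≤ m k) (k : ℕ) (x : Group m) :
    rademacher m k x ^ m k = 1 := by
  have : NeZero (m k) := ⟨by have := hm k; omega⟩
  rw [rademacher_eq hm, ← Circle.coe_pow, ← AddChar.map_nsmul_eq_pow]
  simp

theorem sum_rademacher_pow (hm : ∀ k, 2 ≤ m k) (k : ℕ) {x : Group m} (h : x k ≠ 0) :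
    ∑ r ∈ Finset.range (m k), rademacher m k x ^ r = 0 := by
  rw [geom_sum_eq (rademacher_ne_one hm k h), rademacher_pow hm, sub_self, zero_div]

theorem norm_psi (hm : ∀ k, 2 ≤ m k) (n : ℕ) (x : Group m) : ‖psi m n x‖ = 1 := by
  rw [psi, norm_prod]
  exact Finset.prod_eq_one fun k _ => by rw [norm_pow, norm_rademacher hm, one_pow]

theorem psi_sub (hm : ∀ k, 2 ≤ m k) (n : ℕ) (x t : Group m) :
    psi m n (x - t) = psi m n x * (starRingEnd ℂ) (psi m n t) := by
  simp only [psi, map_prod, map_pow, rademacher_sub hm, ← Finset.prod_mul_distrib, mul_pow]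

theorem psi_congr (hm : ∀ k, 2 ≤ m k) {n K : ℕ} (hn : n < M m K) {x y : Group m}
    (h : ∀ i < K, x i = y i) : psi m n x = psi m n y := by
  rw [psi_eq_prod hm hn, psi_eq_prod hm hn]
  refine Finset.prod_congr rfl fun k hk => ?_
  simp only [rademacher, h k (Finset.mem_range.mp hk)]

theorem psi_eq_one (hm : ∀ k, 2 ≤ m k) {n K : ℕ} (hn : n < M m K) {x : Group m}
    (h : ∀ i < K, x i = 0) : psi m n x = 1 := by
  rw [psi_eq_prod hm hn]
  exact Finset.prod_eq_one fun k hk => by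
    rw [rademacher_eq_one k (h k (Finset.mem_range.mp hk)), one_pow]

/-! ### Dirichlet and Fejér kernels. -/

/-- The Dirichlet kernel `D_n = ∑_{k<n} ψ_k`. -/
noncomputable def dirichlet (m : ℕ → ℕ) (n : ℕ) (u : Group m) : ℂ :=
  ∑ k ∈ Finset.range n, psi m k u

/-- The unnormalised Fejér kernel `∑_{j<n} D_j`. -/
noncomputable def fejer (m : ℕ → ℕ) (n : ℕ) (u : Group m) : ℂ :=
  ∑ j ∈ Finset.range n, dirichlet m j u

theorem measurable_dirichlet (n : ℕ) : Measurable (dirichlet m n) :=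
  Finset.measurable_fun_sum _ fun k _ => measurable_psi m k

theorem measurable_fejer (n : ℕ) : Measurable (fejer m n) :=
  Finset.measurable_fun_sum _ fun k _ => measurable_dirichlet k

theorem dirichlet_mul_add (hm : ∀ k, 2 ≤ m k) (c : ℕ) {b k : ℕ} (hb : b ≤ M m k) (u : Group m) :
    dirichlet m (c * M m k + b) u =
      dirichlet m (c * M m k) u + psi m (c * M m k) u * dirichlet m b u := by
  rw [dirichlet, Finset.sum_range_add, ← dirichlet, dirichlet, dirichlet, Finset.mul_sum]
  congr 1
  exact Finset.sum_congr rfl fun i hi =>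
    psi_mul_add hm c ((Finset.mem_range.mp hi).trans_le hb) u

theorem dirichlet_mul_M (hm : ∀ k, 2 ≤ m k) (c k : ℕ) (u : Group m) :
    dirichlet m (c * M m k) u =
      (∑ a ∈ Finset.range c, psi m (a * M m k) u) * dirichlet m (M m k) u := by
  induction c with
  | zero => simp [dirichlet]
  | succ c ih =>
    rw [Nat.succ_mul, dirichlet_mul_add hm c le_rfl, ih, Finset.sum_range_succ, add_mul]

/-- For `k = s + 1` the kernel contains the full sum of powers of the nontrivial root of unity
`r_s(u)`, which is zero. For larger `k` it consists of blocks of this length. -/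
theorem dirichlet_M_eq_zero (hm : ∀ k, 2 ≤ m k) {s k : ℕ} (h : s < k) {u : Group m}
    (hu : u s ≠ 0) : dirichlet m (M m k) u = 0 := by
  obtain ⟨t, ht⟩ := M_dvd (m := m) (show s + 1 ≤ k from h)
  have h1 : dirichlet m (M m (s + 1)) u = 0 := by
    rw [M_succ, mul_comm, dirichlet_mul_M hm, Finset.sum_congr rfl fun a ha =>
      psi_mul_M hm (Finset.mem_range.mp ha) u, sum_rademacher_pow hm s hu, zero_mul]
  rw [ht, mul_comm, dirichlet_mul_M hm, h1, mul_zero]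

theorem dirichlet_eq_natCast (hm : ∀ k, 2 ≤ m k) {j K : ℕ} (hj : j ≤ M m K) {u : Group m}
    (h : ∀ i < K, u i = 0) : dirichlet m j u = j := by
  rw [dirichlet, Finset.sum_congr rfl fun k hk =>
    psi_eq_one hm ((Finset.mem_range.mp hk).trans_le hj) h]
  simp

theorem norm_dirichlet_le (hm : ∀ k, 2 ≤ m k) (j : ℕ) (u : Group m) : ‖dirichlet m j u‖ ≤ j := by
  refine (norm_sum_le _ _).trans ?_
  simp [norm_psi hm]

theorem dirichlet_mul_M_add (hm : ∀ k, 2 ≤ m k) {k : ℕ} {u : Group m}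
    (hu : dirichlet m (M m k) u = 0) (c : ℕ) {b : ℕ} (hb : b ≤ M m k) :
    dirichlet m (c * M m k + b) u = psi m (c * M m k) u * dirichlet m b u := by
  rw [dirichlet_mul_add hm c hb, dirichlet_mul_M hm, hu, mul_zero, zero_add]

/-- Complete blocks of length `M_{s+1}` cancel, so up to a unimodular factor only the kernel of
order `j mod M_{s+1}` remains. -/
theorem norm_dirichlet_le_M (hm : ∀ k, 2 ≤ m k) {s : ℕ} {u : Group m} (hu : u s ≠ 0) (j : ℕ) :
    ‖dirichlet m j u‖ ≤ M m (s + 1) := by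
  have hb := Nat.mod_lt j (M_pos hm (s + 1))
  rw [← Nat.div_add_mod' j (M m (s + 1)), dirichlet_mul_M_add hm
    (dirichlet_M_eq_zero hm (Nat.lt_succ_self s) hu) _ hb.le, norm_mul, norm_psi hm, one_mul]
  exact (norm_dirichlet_le hm _ u).trans (by exact_mod_cast hb.le)

theorem fejer_mul_M_add (hm : ∀ k, 2 ≤ m k) {k : ℕ} {u : Group m}
    (hD : dirichlet m (M m k) u = 0) (c : ℕ) {b : ℕ} (hb : b ≤ M m k) :
    fejer m (c * M m k + b) u =
      fejer m (c * M m k) u + psi m (c * M m k) u * fejer m b u := by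
  rw [fejer, Finset.sum_range_add, ← fejer, fejer, fejer, Finset.mul_sum]
  congr 1
  exact Finset.sum_congr rfl fun i hi =>
    dirichlet_mul_M_add hm hD c ((Finset.mem_range.mp hi).le.trans hb)

theorem fejer_mul_M (hm : ∀ k, 2 ≤ m k) {k : ℕ} {u : Group m}
    (hD : dirichlet m (M m k) u = 0) (c : ℕ) :
    fejer m (c * M m k) u =
      (∑ a ∈ Finset.range c, psi m (a * M m k) u) * fejer m (M m k) u := by
  induction c with
  | zero => simp [fejer]
  | succ c ih =>
    rw [Nat.succ_mul, fejer_mul_M_add hm hD c le_rfl, ih, Finset.sum_range_succ, add_mul]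

/-- Because of coordinate `s`, blocks of length `M_l` contribute unimodular multiples of the same
value; because of coordinate `l`, these multipliers run through all powers of a nontrivial root of
unity and cancel. -/
theorem fejer_M_eq_zero (hm : ∀ k, 2 ≤ m k) {s l : ℕ} (h : s < l) {u : Group m}
    (hs : u s ≠ 0) (hl : u l ≠ 0) : fejer m (M m (l + 1)) u = 0 := by
  rw [M_succ, mul_comm, fejer_mul_M hm (dirichlet_M_eq_zero hm h hs), Finset.sum_congr rfl
    fun a ha => psi_mul_M hm (Finset.mem_range.mp ha) u, sum_rademacher_pow hm l hl, zero_mul]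

theorem fejer_reduce (hm : ∀ k, 2 ≤ m k) {s l : ℕ} (h : s < l) {u : Group m}
    (hs : u s ≠ 0) (hl : u l ≠ 0) (c : ℕ) {b : ℕ} (hb : b ≤ M m (l + 1)) :
    fejer m (c * M m (l + 1) + b) u = psi m (c * M m (l + 1)) u * fejer m b u := by
  have hD := dirichlet_M_eq_zero hm (h.trans (Nat.lt_succ_self l)) hs
  rw [fejer_mul_M_add hm hD c hb, fejer_mul_M hm hD, fejer_M_eq_zero hm h hs hl, mul_zero,
    zero_add]

/-- After reduction modulo `M_{l+1}` fewer than `M_{l+1}` Dirichlet kernels remain, each at most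
`M_{s+1}`. Uniformity in `n` is the point: no logarithm is lost off the support of an atom. -/
theorem norm_fejer_le (hm : ∀ k, 2 ≤ m k) {s l : ℕ} (h : s < l) {u : Group m}
    (hs : u s ≠ 0) (hl : u l ≠ 0) (n : ℕ) :
    ‖fejer m n u‖ ≤ M m (s + 1) * M m (l + 1) := by
  have hb := Nat.mod_lt n (M_pos hm (l + 1))
  rw [← Nat.div_add_mod' n (M m (l + 1)), fejer_reduce hm h hs hl _ hb.le, norm_mul, norm_psi hm,
    one_mul]
  refine (norm_sum_le_of_le _ fun j _ => norm_dirichlet_le_M hm hs j).trans ?_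
  rw [Finset.sum_const, Finset.card_range, nsmul_eq_mul, mul_comm]
  gcongr

/-! ### Haar measure of intervals and of related sets. -/

theorem haar_pi (hm : ∀ k, 2 ≤ m k) (s : Finset ℕ) (A : ∀ i, Set (ZMod (m i))) :
    haar m {x | ∀ i ∈ s, x i ∈ A i} = ∏ i ∈ s, factorMeasure m i (A i) := by
  have := isProbabilityMeasure_factorMeasure m hm
  exact Measure.infinitePi_pi (factorMeasure m) (s := s) (t := A) fun i _ =>
    MeasurableSet.of_discrete

theorem factorMeasure_singleton (k : ℕ) (a : ZMod (m k)) :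
    factorMeasure m k {a} = (m k : ℝ≥0∞)⁻¹ := by
  simp [factorMeasure]

theorem factorMeasure_compl_singleton (hm : ∀ k, 2 ≤ m k) (k : ℕ) (a : ZMod (m k)) :
    2⁻¹ ≤ factorMeasure m k {a}ᶜ := by
  have := isProbabilityMeasure_factorMeasure m hm k
  rw [prob_compl_eq_one_sub (measurableSet_singleton a), factorMeasure_singleton]
  calc (2⁻¹ : ℝ≥0∞) = 1 - 2⁻¹ := by
        rw [ENNReal.one_sub_inv_two]
    _ ≤ 1 - (m k : ℝ≥0∞)⁻¹ := by
        gcongr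
        exact_mod_cast hm k

theorem measurableSet_interval (n : ℕ) (z : Group m) : MeasurableSet (interval m n z) := by
  have : interval m n z = ⋂ i ∈ Finset.range n, (fun y : Group m => y i) ⁻¹' {z i} := by
    ext y; simp [interval]
  rw [this]
  exact Finset.measurableSet_biInter _ fun i _ =>
    measurable_pi_apply i (measurableSet_singleton _)

theorem prod_inv_natCast (s : Finset ℕ) (g : ℕ → ℕ) :
    ∏ i ∈ s, (g i : ℝ≥0∞)⁻¹ = ((∏ i ∈ s, g i : ℕ) : ℝ≥0∞)⁻¹ := by
  rw [Nat.cast_prod, ENNReal.prod_inv_distrib]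
  intro i _ j _ _
  exact Or.inr (by simp)

theorem haar_interval (hm : ∀ k, 2 ≤ m k) (n : ℕ) (z : Group m) :
    haar m (interval m n z) = (M m n : ℝ≥0∞)⁻¹ := by
  have h := haar_pi hm (Finset.range n) fun i => {z i}
  simp only [factorMeasure_singleton, prod_inv_natCast, Finset.mem_range,
    Set.mem_singleton_iff] at h
  exact h

/-- The points agreeing with `z` in the first `l` coordinates, except possibly the `s`-th. -/
def punctured (m : ℕ → ℕ) (s l : ℕ) (z : Group m) : Set (Group m) :=
  {x | ∀ i < l, i ≠ s → x i = z i}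

theorem measurableSet_punctured (s l : ℕ) (z : Group m) : MeasurableSet (punctured m s l z) := by
  have : punctured m s l z =
      ⋂ i ∈ (Finset.range l).erase s, (fun y : Group m => y i) ⁻¹' {z i} := by
    ext y; simp [punctured]; tauto
  rw [this]
  exact Finset.measurableSet_biInter _ fun i _ =>
    measurable_pi_apply i (measurableSet_singleton _)

/-- Compared with an interval, coordinate `s` is free, which multiplies the measure by `m s ≤ B`. -/
theorem haar_punctured_le (hm : ∀ k, 2 ≤ m k) {B : ℕ} (hB : ∀ k, m k ≤ B) {s l : ℕ} (h : s < l)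
    (z : Group m) : haar m (punctured m s l z) ≤ B * (M m l : ℝ≥0∞)⁻¹ := by
  have h1 := haar_pi hm ((Finset.range l).erase s) fun i => {z i}
  simp only [factorMeasure_singleton, prod_inv_natCast, Finset.mem_erase, Finset.mem_range,
    Set.mem_singleton_iff] at h1
  have h2 : punctured m s l z = {x | ∀ i, i ≠ s ∧ i < l → x i = z i} := by
    ext y; simp [punctured]; tauto
  rw [h2, h1, M, ← Finset.mul_prod_erase _ _ (Finset.mem_range.mpr h), Nat.cast_mul,
    ENNReal.mul_inv (Or.inr (ENNReal.natCast_ne_top _)) (Or.inl (by simp)), ← mul_assoc]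
  refine le_mul_of_one_le_left (by positivity) ?_
  rw [← div_eq_mul_inv]
  have h3 : (m s : ℝ≥0∞) ≠ 0 := by have := hm s; simp; omega
  rw [ENNReal.le_div_iff_mul_le (Or.inl h3) (Or.inl (by simp)), one_mul]
  exact_mod_cast hB s

theorem le_haar_two_ne_zero (hm : ∀ k, 2 ≤ m k) (s : ℕ) :
    (4 * M m s : ℝ≥0∞)⁻¹ ≤
      haar m {u | (∀ i < s, u i = 0) ∧ u s ≠ 0 ∧ u (s + 1) ≠ 0} := by
  have h1 := haar_pi hm (Finset.range (s + 2)) fun i => if i < s then {0} else {0}ᶜ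
  have h2 : {u : Group m | (∀ i < s, u i = 0) ∧ u s ≠ 0 ∧ u (s + 1) ≠ 0} =
      {x | ∀ i ∈ Finset.range (s + 2), x i ∈ if i < s then ({0} : Set (ZMod (m i))) else {0}ᶜ} := by
    ext u
    simp only [Set.mem_ofPred_eq, Finset.mem_range]
    constructor
    · rintro ⟨h, hs, hs1⟩ i hi
      split_ifs with his
      · exact h i his
      · obtain rfl | rfl : i = s ∨ i = s + 1 := by omega
        · exact hs
        · exact hs1
    · intro h
      refine ⟨fun i hi => ?_, ?_, ?_⟩
      · simpa [hi] using h i (by omega)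
      · simpa using h s (by omega)
      · simpa using h (s + 1) (by omega)
  rw [h2, h1, Finset.prod_range_succ, Finset.prod_range_succ, Finset.prod_congr rfl fun i hi => by
    rw [if_pos (Finset.mem_range.mp hi), factorMeasure_singleton], prod_inv_natCast, ← M,
    if_neg (lt_irrefl _), if_neg (by omega), mul_comm (4 : ℝ≥0∞),
    ENNReal.mul_inv (Or.inr (by simp)) (Or.inl (by simp)), mul_assoc]
  gcongr
  calc (4 : ℝ≥0∞)⁻¹ = 2⁻¹ * 2⁻¹ := by
        rw [← ENNReal.mul_inv (by simp) (by simp)]; norm_num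
    _ ≤ _ := by gcongr <;> exact factorMeasure_compl_singleton hm _ _

/-! ### Intervals, the filtration and Fourier coefficients. -/

theorem mem_interval_self (n : ℕ) (x : Group m) : x ∈ interval m n x := fun _ _ => rfl

theorem mem_interval_comm {n : ℕ} {x y : Group m} : x ∈ interval m n y ↔ y ∈ interval m n x :=
  ⟨fun h i hi => (h i hi).symm, fun h i hi => (h i hi).symm⟩

theorem interval_eq {n : ℕ} {x y : Group m} (h : x ∈ interval m n y) :
    interval m n x = interval m n y := by
  ext w
  exact ⟨fun hw i hi => (hw i hi).trans (h i hi), fun hw i hi => (hw i hi).trans (h i hi).symm⟩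

theorem interval_anti {a b : ℕ} (h : a ≤ b) (x : Group m) : interval m b x ⊆ interval m a x :=
  fun _ hy i hi => hy i (hi.trans_le h)

theorem measurableSet_filtration (hm : ∀ k, 2 ≤ m k) {n : ℕ} {S : Set (Group m)}
    (hS : ∀ x ∈ S, interval m n x ⊆ S) : MeasurableSet[filtration m n] S := by
  have : ∀ k, NeZero (m k) := fun k => ⟨by have := hm k; omega⟩
  refine ⟨trunc m n '' S, (Set.toFinite _).measurableSet, ?_⟩
  ext x
  constructor
  · rintro ⟨y, hy, hxy⟩
    exact hS y hy fun i hi => (congrFun hxy ⟨i, hi⟩).symm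
  · exact fun hx => ⟨x, hx, rfl⟩

theorem measurableSet_of_interval_subset (hm : ∀ k, 2 ≤ m k) {n : ℕ} {S : Set (Group m)}
    (hS : ∀ x ∈ S, interval m n x ⊆ S) : MeasurableSet S :=
  (filtration m).le n _ (measurableSet_filtration hm hS)

theorem eq_of_stronglyMeasurable {n : ℕ} {g : Group m → ℂ}
    (hg : StronglyMeasurable[filtration m n] g) {x y : Group m} (h : x ∈ interval m n y) :
    g x = g y := by
  obtain ⟨t, -, ht⟩ := hg.measurable (measurableSet_singleton (g y))
  have hxy : trunc m n x = trunc m n y := funext fun i => h i i.2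
  have : x ∈ g ⁻¹' {g y} := by
    rw [← ht, Set.mem_preimage, hxy, ← Set.mem_preimage, ht]; rfl
  exact this

theorem stronglyMeasurable_of_interval (hm : ∀ k, 2 ≤ m k) {n : ℕ} {g : Group m → ℂ}
    (hg : ∀ x, ∀ y ∈ interval m n x, g y = g x) : StronglyMeasurable[filtration m n] g := by
  refine Measurable.stronglyMeasurable fun t _ => ?_
  refine measurableSet_filtration hm fun x hx y hy => ?_
  rw [Set.mem_preimage, hg x y hy]; exact hx

theorem exists_representatives (hm : ∀ k, 2 ≤ m k) (n : ℕ) :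
    ∃ R : Finset (Group m), ∀ x, ∃! z, z ∈ R ∧ x ∈ interval m n z := by
  classical
  have : ∀ k, NeZero (m k) := fun k => ⟨by have := hm k; omega⟩
  let e : ((i : Fin n) → ZMod (m i)) → Group m := fun c i => if h : i < n then c ⟨i, h⟩ else 0
  refine ⟨Finset.univ.image e, fun x => ⟨e (trunc m n x), ⟨by simp, fun i hi => ?_⟩, ?_⟩⟩
  · simp [e, hi, trunc]
  · rintro z ⟨hz, hx⟩
    obtain ⟨c, -, rfl⟩ := Finset.mem_image.mp hz
    congr 1
    funext i
    have := hx i i.2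
    simp only [e, i.2, dif_pos] at this
    exact this.symm

theorem sum_indicator_interval {E : Type*} [AddCommMonoid E] {n : ℕ} {R : Finset (Group m)}
    (hR : ∀ x, ∃! z, z ∈ R ∧ x ∈ interval m n z) (g : Group m → E) (x : Group m) :
    ∑ z ∈ R, (interval m n z).indicator g x = g x := by
  obtain ⟨z, ⟨hz, hx⟩, hu⟩ := hR x
  rw [Finset.sum_eq_single z, Set.indicator_of_mem hx]
  · intro w hw hwz
    exact Set.indicator_of_notMem (fun h => hwz (hu w ⟨hw, h⟩)) _
  · exact fun h => absurd hz h

/-- The intervals of level `n` form a finite partition and `φ` is constant on each. This serves both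
the stabilisation of the coefficients and the martingale property of the test functions. -/
theorem integral_mul_eq (hm : ∀ k, 2 ≤ m k) {n : ℕ} {g h φ : Group m → ℂ}
    (hg : Integrable g (haar m)) (hh : Integrable h (haar m))
    (hφ : ∀ x, ∀ y ∈ interval m n x, φ y = φ x)
    (heq : ∀ z, ∫ x in interval m n z, g x ∂haar m = ∫ x in interval m n z, h x ∂haar m) :
    ∫ x, g x * φ x ∂haar m = ∫ x, h x * φ x ∂haar m := by
  obtain ⟨R, hR⟩ := exists_representatives hm n
  have key : ∀ g : Group m → ℂ, Integrable g (haar m) → ∫ x, g x * φ x ∂haar m =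
      ∑ z ∈ R, (∫ x in interval m n z, g x ∂haar m) * φ z := by
    intro g hg
    have h1 : (fun x => g x * φ x) =
        fun x => ∑ z ∈ R, (interval m n z).indicator (fun x => g x) x * φ z := by
      funext x
      rw [← sum_indicator_interval hR (fun x => g x * φ x) x]
      refine Finset.sum_congr rfl fun z _ => ?_
      by_cases hx : x ∈ interval m n z
      · rw [Set.indicator_of_mem hx, Set.indicator_of_mem hx, hφ z x hx]
      · rw [Set.indicator_of_notMem hx, Set.indicator_of_notMem hx, zero_mul]
    rw [h1, integral_finsetSum _ fun z _ =>
      (hg.indicator (measurableSet_interval n z)).mul_const _]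
    refine Finset.sum_congr rfl fun z _ => ?_
    rw [integral_mul_const, integral_indicator (measurableSet_interval n z)]
  rw [key g hg, key h hh, Finset.sum_congr rfl fun z _ => by rw [heq z]]

theorem setIntegral_interval_eq (hm : ∀ k, 2 ≤ m k) {f : ℕ → Group m → ℂ}
    (hf : Martingale f (filtration m) (haar m)) {n j k : ℕ} (hnj : n ≤ j) (hjk : j ≤ k)
    {S : Set (Group m)} (hS : ∀ x ∈ S, interval m n x ⊆ S) :
    ∫ x in S, f j x ∂haar m = ∫ x in S, f k x ∂haar m := by
  have := isProbabilityMeasure_haar m hm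
  exact hf.setIntegral_eq hjk (measurableSet_filtration hm fun x hx =>
    (interval_anti hnj x).trans (hS x hx))

/-- For `i < M_N` the function `psi m i` is constant on intervals of level `N`, so the integrals in
the defining limit no longer change from time `N` on. -/
theorem coeff_eq (hm : ∀ k, 2 ≤ m k) {f : ℕ → Group m → ℂ}
    (hf : Martingale f (filtration m) (haar m)) {i N : ℕ} (hi : i < M m N) :
    coeff m f i = ∫ x, f N x * (starRingEnd ℂ) (psi m i x) ∂haar m := by
  have := isProbabilityMeasure_haar m hm
  refine Tendsto.limUnder_eq (tendsto_const_nhds.congr' ?_)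
  filter_upwards [eventually_ge_atTop N] with k hk
  refine integral_mul_eq hm (n := N) (hf.integrable N) (hf.integrable k) ?_ fun z =>
    setIntegral_interval_eq hm hf le_rfl hk fun x hx => by rw [interval_eq hx]
  intro x y hy
  rw [psi_congr hm hi hy]

/-! ### Partial sums and means as convolution operators. -/

theorem measurable_const_sub (x : Group m) : Measurable fun t : Group m => x - t :=
  measurable_pi_iff.mpr fun i =>
    (measurable_from_top (f := fun z : ZMod (m i) => x i - z)).comp (measurable_pi_apply i)

/-- The partial sum operator acting on functions, as a convolution with the Dirichlet kernel. -/
noncomputable def partialOp (m : ℕ → ℕ) (j : ℕ) (h : Group m → ℂ) (x : Group m) : ℂ :=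
  ∫ t, h t * dirichlet m j (x - t) ∂haar m

/-- The `T` means acting on functions. -/
noncomputable def meanOp (m : ℕ → ℕ) (q : ℕ → ℝ) (n : ℕ) (h : Group m → ℂ) (x : Group m) : ℂ :=
  ((Q q n : ℝ) : ℂ)⁻¹ * ∑ k ∈ Finset.range n, (q k : ℂ) * partialOp m k h x

theorem integrable_mul_dirichlet (hm : ∀ k, 2 ≤ m k) {h : Group m → ℂ}
    (hh : Integrable h (haar m)) (j : ℕ) (x : Group m) :
    Integrable (fun t => h t * dirichlet m j (x - t)) (haar m) :=
  hh.mul_bdd (c := j)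
    ((measurable_dirichlet j).comp (measurable_const_sub x)).aestronglyMeasurable
    (Eventually.of_forall fun t => norm_dirichlet_le hm j (x - t))

theorem integrable_mul_conj_psi (hm : ∀ k, 2 ≤ m k) {h : Group m → ℂ}
    (hh : Integrable h (haar m)) (i : ℕ) :
    Integrable (fun t => h t * (starRingEnd ℂ) (psi m i t)) (haar m) :=
  hh.mul_bdd (c := 1)
    (Complex.continuous_conj.measurable.comp (measurable_psi m i)).aestronglyMeasurable
    (Eventually.of_forall fun t => by simp [norm_psi hm])

theorem partialOp_eq_sum (hm : ∀ k, 2 ≤ m k) {h : Group m → ℂ}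
    (hh : Integrable h (haar m)) (j : ℕ) (x : Group m) :
    partialOp m j h x =
      ∑ i ∈ Finset.range j, (∫ t, h t * (starRingEnd ℂ) (psi m i t) ∂haar m) * psi m i x := by
  simp only [partialOp, dirichlet, psi_sub hm, Finset.mul_sum]
  rw [← Finset.sum_congr rfl fun i _ => integral_mul_const (psi m i x) _,
    ← integral_finsetSum _ fun i _ => (integrable_mul_conj_psi hm hh i).mul_const _]
  refine integral_congr_ae (Eventually.of_forall fun t => Finset.sum_congr rfl fun i _ => ?_)
  ring

theorem partialSum_eq_partialOp (hm : ∀ k, 2 ≤ m k) {f : ℕ → Group m → ℂ}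
    (hf : Martingale f (filtration m) (haar m)) {j N : ℕ} (hj : j ≤ M m N) (x : Group m) :
    partialSum m j f x = partialOp m j (f N) x := by
  rw [partialOp_eq_sum hm (hf.integrable N), partialSum]
  exact Finset.sum_congr rfl fun i hi => by
    rw [coeff_eq hm hf ((Finset.mem_range.mp hi).trans_le hj)]

theorem tMean_eq_meanOp (hm : ∀ k, 2 ≤ m k) (q : ℕ → ℝ) {f : ℕ → Group m → ℂ}
    (hf : Martingale f (filtration m) (haar m)) {n N : ℕ} (hn : n ≤ M m N) (x : Group m) :
    tMean m q n f x = meanOp m q n (f N) x := by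
  rw [tMean, meanOp, Finset.sum_congr rfl fun k hk => by
    rw [partialSum_eq_partialOp hm hf ((Finset.mem_range.mp hk).le.trans hn)]]

theorem partialOp_finsetSum (hm : ∀ k, 2 ≤ m k) {ι : Type*} (s : Finset ι) {h : ι → Group m → ℂ}
    (hh : ∀ i ∈ s, Integrable (h i) (haar m)) (j : ℕ) (x : Group m) :
    partialOp m j (fun t => ∑ i ∈ s, h i t) x = ∑ i ∈ s, partialOp m j (h i) x := by
  simp only [partialOp, Finset.sum_mul]
  exact integral_finsetSum _ fun i hi => integrable_mul_dirichlet hm (hh i hi) j x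

theorem meanOp_finsetSum (hm : ∀ k, 2 ≤ m k) (q : ℕ → ℝ) {ι : Type*} (s : Finset ι)
    {h : ι → Group m → ℂ} (hh : ∀ i ∈ s, Integrable (h i) (haar m)) (n : ℕ) (x : Group m) :
    meanOp m q n (fun t => ∑ i ∈ s, h i t) x = ∑ i ∈ s, meanOp m q n (h i) x := by
  simp only [meanOp, partialOp_finsetSum hm s hh, Finset.mul_sum]
  rw [Finset.sum_comm]

theorem sum_partialOp (hm : ∀ k, 2 ≤ m k) {h : Group m → ℂ} (hh : Integrable h (haar m)) (n : ℕ)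
    (x : Group m) :
    ∑ j ∈ Finset.range n, partialOp m j h x = ∫ t, h t * fejer m n (x - t) ∂haar m := by
  simp only [partialOp, fejer, Finset.mul_sum]
  exact (integral_finsetSum _ fun j _ => integrable_mul_dirichlet hm hh j x).symm

theorem Q_pos {q : ℕ → ℝ} (hq : ∀ k, 0 ≤ q k) (hq0 : 0 < q 0) {n : ℕ} (hn : 1 ≤ n) : 0 < Q q n :=
  hq0.trans_le (Finset.single_le_sum (f := q) (fun i _ => hq i) (Finset.mem_range.mpr hn))

theorem norm_meanOp_le_of_partialOp {q : ℕ → ℝ} (hq : ∀ k, 0 ≤ q k) (hq0 : 0 < q 0) {n : ℕ}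
    (hn : 1 ≤ n) {h : Group m → ℂ} {x : Group m} {E : ℝ}
    (hE : ∀ k < n, ‖partialOp m k h x‖ ≤ E) : ‖meanOp m q n h x‖ ≤ E := by
  have hQ := Q_pos hq hq0 hn
  rw [meanOp, norm_mul, norm_inv, Complex.norm_of_nonneg hQ.le, inv_mul_le_iff₀ hQ, Q,
    Finset.sum_mul]
  refine norm_sum_le_of_le _ fun k hk => ?_
  rw [norm_mul, Complex.norm_of_nonneg (hq k)]
  exact mul_le_mul_of_nonneg_left (hE k (Finset.mem_range.mp hk)) (hq k)

theorem haar_real_interval (hm : ∀ k, 2 ≤ m k) (n : ℕ) (z : Group m) :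
    (haar m).real (interval m n z) = (M m n : ℝ)⁻¹ := by
  rw [measureReal_def, haar_interval hm]; simp

theorem haar_real_punctured_le (hm : ∀ k, 2 ≤ m k) {B : ℕ} (hB : ∀ k, m k ≤ B) {s l : ℕ}
    (h : s < l) (z : Group m) : (haar m).real (punctured m s l z) ≤ B * (M m l : ℝ)⁻¹ := by
  rw [measureReal_def]
  have h0 : (M m l : ℝ≥0∞) ≠ 0 := by simpa using (M_pos hm l).ne'
  refine (ENNReal.toReal_mono ?_ (haar_punctured_le hm hB h z)).trans (by simp)
  exact ENNReal.mul_ne_top (by simp) (by simpa using h0)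

theorem norm_integral_mul_le (hm : ∀ k, 2 ≤ m k) {N : ℕ} {z : Group m} {a K : Group m → ℂ}
    {A c : ℝ} (ha : ∀ t, ‖a t‖ ≤ A) (hsupp : ∀ t, t ∉ interval m N z → a t = 0)
    (hK : ∀ t ∈ interval m N z, ‖K t‖ ≤ c) :
    ‖∫ t, a t * K t ∂haar m‖ ≤ A * c / M m N := by
  have := isProbabilityMeasure_haar m hm
  have hA : 0 ≤ A := (norm_nonneg _).trans (ha z)
  rw [← setIntegral_eq_integral_of_forall_compl_eq_zero (s := interval m N z)
    fun t ht => by rw [hsupp t ht, zero_mul], div_eq_mul_inv, ← haar_real_interval hm N z]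
  refine norm_setIntegral_le_of_norm_le_const (measure_lt_top _ _) fun t ht => ?_
  rw [norm_mul]
  exact mul_le_mul (ha t) (hK t ht) (norm_nonneg _) hA

theorem exists_first_ne {x y : Group m} {K : ℕ} (h : y ∉ interval m K x) :
    ∃ s < K, x s ≠ y s ∧ y ∈ interval m s x := by
  classical
  have h' : ∃ s, s < K ∧ x s ≠ y s := by
    by_contra hcon
    push Not at hcon
    exact h fun i hi => (hcon i hi).symm
  refine ⟨Nat.find h', (Nat.find_spec h').1, (Nat.find_spec h').2, fun i hi => ?_⟩
  by_contra hne
  exact Nat.find_min h' hi ⟨hi.trans (Nat.find_spec h').1, fun e => hne e.symm⟩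

theorem norm_dirichlet_sub_le (hm : ∀ k, 2 ≤ m k) {j K : ℕ} (hj : j ≤ M m K) (x t : Group m) :
    ‖dirichlet m j (x - t)‖ ≤ (interval m K x).indicator (fun _ => (M m K : ℝ)) t +
      ∑ s ∈ Finset.range K, (interval m s x).indicator (fun _ => (M m (s + 1) : ℝ)) t := by
  have hnn : ∀ s, 0 ≤ (interval m s x).indicator (fun _ => (M m (s + 1) : ℝ)) t := fun s =>
    Set.indicator_nonneg (fun _ _ => by positivity) _
  by_cases h : t ∈ interval m K x
  · rw [Set.indicator_of_mem h]
    refine le_add_of_le_of_nonneg ?_ (Finset.sum_nonneg fun s _ => hnn s)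
    exact (norm_dirichlet_le hm j _).trans (by exact_mod_cast hj)
  · obtain ⟨s, hs, hne, hmem⟩ := exists_first_ne h
    rw [Set.indicator_of_notMem h, zero_add]
    refine le_trans ?_ (Finset.single_le_sum (fun s _ => hnn s) (Finset.mem_range.mpr hs))
    rw [Set.indicator_of_mem hmem]
    exact norm_dirichlet_le_M hm (s := s) (by simpa [sub_eq_zero] using hne) j

/-- The logarithmic bound for the Lebesgue constants. Where `t` first differs from `x` at `s` the
kernel is at most `M_{s+1}`, and this happens inside an interval of measure `1 / M_s`; each `s < K`
thus costs at most `B`. -/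
theorem norm_partialOp_le (hm : ∀ k, 2 ≤ m k) {B : ℕ} (hB : ∀ k, m k ≤ B) {j K : ℕ}
    (hj : j ≤ M m K) {h : Group m → ℂ} {A : ℝ} (hh : ∀ t, ‖h t‖ ≤ A) (x : Group m) :
    ‖partialOp m j h x‖ ≤ A * (1 + B * K) := by
  have := isProbabilityMeasure_haar m hm
  have hA : 0 ≤ A := (norm_nonneg _).trans (hh x)
  have hint : ∀ (s : ℕ) (c : ℝ), Integrable ((interval m s x).indicator fun _ => c) (haar m) :=
    fun s c => (integrable_const c).indicator (measurableSet_interval s x)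
  have hval : ∀ (s : ℕ) (c : ℝ), ∫ t, (interval m s x).indicator (fun _ => c) t ∂haar m =
      (M m s : ℝ)⁻¹ * c := fun s c => by
    rw [integral_indicator_const _ (measurableSet_interval s x), haar_real_interval hm,
      smul_eq_mul]
  have hM : ∀ s, (0 : ℝ) < M m s := fun s => by exact_mod_cast M_pos hm s
  refine (norm_integral_le_of_norm_le (g := fun t => A *
    ((interval m K x).indicator (fun _ => (M m K : ℝ)) t +
      ∑ s ∈ Finset.range K, (interval m s x).indicator (fun _ => (M m (s + 1) : ℝ)) t)) ?_
      (Eventually.of_forall fun t => ?_)).trans ?_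
  · exact ((hint _ _).add (integrable_finsetSum _ fun s _ => hint _ _)).const_mul A
  · rw [norm_mul]
    exact mul_le_mul (hh t) (norm_dirichlet_sub_le hm hj x t) (norm_nonneg _) hA
  · rw [integral_const_mul, integral_add (hint _ _) (integrable_finsetSum _ fun s _ => hint _ _),
      integral_finsetSum _ fun s _ => hint _ _, hval, inv_mul_cancel₀ (hM K).ne']
    refine mul_le_mul_of_nonneg_left (add_le_add le_rfl ?_) hA
    refine (Finset.sum_le_card_nsmul _ _ (B : ℝ) fun s _ => ?_).trans ?_
    · rw [hval, inv_mul_le_iff₀ (hM s), mul_comm]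
      exact_mod_cast M_succ_le hB s
    · simp [mul_comm]

/-! ### The weighted maximal operator and admissible data. -/

/-- The weighted maximal operator of the `T` means acting on functions. -/
noncomputable def meanMax (m : ℕ → ℕ) (q w : ℕ → ℝ) (h : Group m → ℂ) (x : Group m) : ℝ≥0∞ :=
  ⨆ n : ℕ, ⨆ _ : 1 ≤ n, ‖meanOp m q n h x‖ₑ / ENNReal.ofReal (w n)

theorem meanMax_le {q w : ℕ → ℝ} (hw : ∀ n, 1 ≤ n → 0 < w n) {h : Group m → ℂ} {x : Group m}
    {E : ℝ} (hE : ∀ n, 1 ≤ n → ‖meanOp m q n h x‖ ≤ E * w n) :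
    meanMax m q w h x ≤ ENNReal.ofReal E := by
  refine iSup₂_le fun n hn => ?_
  rw [← ofReal_norm, ← ENNReal.ofReal_div_of_pos (hw n hn)]
  exact ENNReal.ofReal_le_ofReal (by rw [div_le_iff₀ (hw n hn)]; exact hE n hn)

theorem meanMax_finsetSum_le (hm : ∀ k, 2 ≤ m k) (q w : ℕ → ℝ) {ι : Type*} (s : Finset ι)
    {h : ι → Group m → ℂ} (hh : ∀ i ∈ s, Integrable (h i) (haar m)) (x : Group m) :
    meanMax m q w (fun t => ∑ i ∈ s, h i t) x ≤ ∑ i ∈ s, meanMax m q w (h i) x := by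
  refine iSup₂_le fun n hn => ?_
  rw [meanOp_finsetSum hm q s hh, div_eq_mul_inv]
  refine (mul_le_mul_left (enorm_sum_le _ _) _).trans ?_
  rw [Finset.sum_mul]
  refine Finset.sum_le_sum fun i _ => ?_
  rw [← div_eq_mul_inv]
  exact le_iSup₂ (f := fun n (_ : 1 ≤ n) => ‖meanOp m q n (h i) x‖ₑ / ENNReal.ofReal (w n)) n hn

/-- The properties of weights used in the maximal inequality. -/
structure AdmissibleWeight (m : ℕ → ℕ) (p : ℝ) (w : ℕ → ℝ) (C : ℝ) : Prop where
  one_le : 1 ≤ C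
  log_le : ∀ n, 1 ≤ n → 1 + (Nat.log 2 n : ℝ) ≤ C * w n
  mono : ∀ a b, 1 ≤ a → a ≤ b → w a ≤ w b
  sum_le : ∀ N, ∑ l ∈ Finset.range N, (M m (l + 1) : ℝ) ^ (2 * p - 1) ≤
    C * ((M m N : ℝ) ^ 2 * w (M m N)) ^ p / M m N

/-- The summation property of the coefficients used in the maximal inequality. -/
structure AdmissibleCoefficients (q : ℕ → ℝ) (C : ℝ) : Prop where
  nonneg : ∀ k, 0 ≤ q k
  pos : 0 < q 0
  one_le : 1 ≤ C
  norm_sum_le : ∀ (n L : ℕ) (s : ℕ → ℂ) (E : ℝ), 1 ≤ L → L ≤ n → (∀ k ≤ L, s k = 0) →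
    (∀ k, ‖∑ j ∈ Finset.range k, s j‖ ≤ E) →
    ‖∑ k ∈ Finset.range n, (q k : ℂ) * s k‖ ≤ C * (Q q n / L) * E

theorem AdmissibleWeight.pos {p C : ℝ} {w : ℕ → ℝ} (hw : AdmissibleWeight m p w C) {n : ℕ}
    (hn : 1 ≤ n) : 0 < w n := by
  have h1 := hw.log_le n hn
  have h2 := hw.one_le
  have h3 : (0 : ℝ) ≤ Nat.log 2 n := by positivity
  by_contra h
  nlinarith

theorem AdmissibleWeight.one_le_mul {p C : ℝ} {w : ℕ → ℝ} (hw : AdmissibleWeight m p w C) {n : ℕ}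
    (hn : 1 ≤ n) : 1 ≤ C * w n := by
  have h1 := hw.log_le n hn
  have h3 : (0 : ℝ) ≤ Nat.log 2 n := by positivity
  linarith

theorem norm_meanOp_le (hm : ∀ k, 2 ≤ m k) {B : ℕ} (hB : ∀ k, m k ≤ B) {p C D : ℝ}
    {q w : ℕ → ℝ} (hw : AdmissibleWeight m p w C) (hq : AdmissibleCoefficients q D)
    {h : Group m → ℂ} {A : ℝ} (hh : ∀ t, ‖h t‖ ≤ A) (x : Group m) {n : ℕ} (hn : 1 ≤ n) :
    ‖meanOp m q n h x‖ ≤ A * (1 + B) * C * w n := by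
  have hA : 0 ≤ A := (norm_nonneg _).trans (hh x)
  refine norm_meanOp_le_of_partialOp hq.nonneg hq.pos hn fun k hk => ?_
  -- Since `n < 2 ^ (log₂ n + 1)`, only about `log₂ n` coordinates matter, and `log_le` absorbs them
  -- into the weight.
  have hk2 : k ≤ M m (Nat.log 2 n + 1) :=
    (hk.trans (Nat.lt_pow_succ_log_self one_lt_two n)).le.trans (two_pow_le_M hm _)
  refine (norm_partialOp_le hm hB hk2 hh x).trans ?_
  have h1 := hw.log_le n hn
  calc A * (1 + B * ((Nat.log 2 n + 1 : ℕ) : ℝ)) ≤ A * ((1 + B) * (1 + Nat.log 2 n)) := by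
        gcongr
        push_cast
        have : (0 : ℝ) ≤ Nat.log 2 n := by positivity
        nlinarith
    _ ≤ A * ((1 + B) * (C * w n)) := by gcongr
    _ = _ := by ring

/-! ### Means of atoms. -/

/-- A multiple of an atom: a bounded function with mean zero supported on an interval. -/
structure IsAtom (m : ℕ → ℕ) (N : ℕ) (z : Group m) (A : ℝ) (a : Group m → ℂ) : Prop where
  integrable : Integrable a (haar m)
  norm_le : ∀ t, ‖a t‖ ≤ A
  eq_zero : ∀ t, t ∉ interval m N z → a t = 0
  integral_eq_zero : ∫ t, a t ∂haar m = 0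

namespace IsAtom

variable {N : ℕ} {z : Group m} {A : ℝ} {a : Group m → ℂ}

theorem nonneg (ha : IsAtom m N z A a) : 0 ≤ A := (norm_nonneg _).trans (ha.norm_le z)

/-- Vilenkin functions of index below `M_N` are constant on the support, so the mean value zero
annihilates these coefficients. -/
theorem partialOp_eq_zero (hm : ∀ k, 2 ≤ m k) (ha : IsAtom m N z A a) {j : ℕ} (hj : j ≤ M m N)
    (x : Group m) : partialOp m j a x = 0 := by
  rw [partialOp_eq_sum hm ha.integrable]
  refine Finset.sum_eq_zero fun i hi => ?_
  have hi' := (Finset.mem_range.mp hi).trans_le hj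
  have : (fun t => a t * (starRingEnd ℂ) (psi m i t)) =
      fun t => a t * (starRingEnd ℂ) (psi m i z) := by
    funext t
    by_cases ht : t ∈ interval m N z
    · rw [psi_congr hm hi' ht]
    · rw [ha.eq_zero t ht, zero_mul, zero_mul]
  rw [this, integral_mul_const, ha.integral_eq_zero, zero_mul, zero_mul]

theorem norm_partialOp_le (hm : ∀ k, 2 ≤ m k) (ha : IsAtom m N z A a) {x : Group m} {s : ℕ}
    (hs : s < N) (hx : x s ≠ z s) (j : ℕ) :
    ‖partialOp m j a x‖ ≤ A * (M m (s + 1) / M m N) := by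
  refine (norm_integral_mul_le hm ha.norm_le ha.eq_zero (c := M m (s + 1)) fun t ht => ?_).trans
    (mul_div_assoc _ _ _).le
  exact norm_dirichlet_le_M hm (s := s) (by simpa [sub_eq_zero, ht s hs] using hx) j

theorem norm_sum_partialOp_le (hm : ∀ k, 2 ≤ m k) (ha : IsAtom m N z A a) {x : Group m} {s l : ℕ}
    (hsl : s < l) (hl : l < N) (hxs : x s ≠ z s) (hxl : x l ≠ z l) (n : ℕ) :
    ‖∑ j ∈ Finset.range n, partialOp m j a x‖ ≤ A * (M m (s + 1) * M m (l + 1)) / M m N := by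
  rw [sum_partialOp hm ha.integrable]
  refine norm_integral_mul_le hm ha.norm_le ha.eq_zero fun t ht => ?_
  exact norm_fejer_le hm hsl (by simpa [sub_eq_zero, ht s (hsl.trans hl)] using hxs)
    (by simpa [sub_eq_zero, ht l hl] using hxl) n

theorem meanOp_eq_zero (hm : ∀ k, 2 ≤ m k) (ha : IsAtom m N z A a) (q : ℕ → ℝ) {n : ℕ}
    (hn : n ≤ M m N) (x : Group m) : meanOp m q n a x = 0 := by
  rw [meanOp, Finset.sum_eq_zero, mul_zero]
  intro k hk
  rw [ha.partialOp_eq_zero hm ((Finset.mem_range.mp hk).le.trans hn), mul_zero]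

/-- The means vanish for `n ≤ M_N`. Beyond that, `norm_sum_le` with `L = M_N` brings in the Fejér
bound and a second factor `1 / M_N`, while `w (M_N) ≤ w n` makes the quotient by `w n` bounded
independently of `n`. -/
theorem norm_meanOp_le_pair (hm : ∀ k, 2 ≤ m k) (ha : IsAtom m N z A a) {p C D : ℝ}
    {q w : ℕ → ℝ} (hw : AdmissibleWeight m p w C) (hq : AdmissibleCoefficients q D)
    {x : Group m} {s l : ℕ}
    (hsl : s < l) (hl : l < N) (hxs : x s ≠ z s) (hxl : x l ≠ z l) {n : ℕ} (hn : 1 ≤ n) :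
    ‖meanOp m q n a x‖ ≤
      A * D * (M m (s + 1) * M m (l + 1) / (M m N ^ 2 * w (M m N))) * w n := by
  have hMN : (0 : ℝ) < M m N := by exact_mod_cast M_pos hm N
  have hwM := hw.pos (M_pos hm N)
  have hA := ha.nonneg
  have hD := hq.one_le
  have hwn := hw.pos hn
  rcases le_total n (M m N) with h | h
  · rw [ha.meanOp_eq_zero hm q h, norm_zero]
    positivity
  have hQ := Q_pos hq.nonneg hq.pos hn
  have h1 := hq.norm_sum_le n (M m N) (fun j => partialOp m j a x) _ (M_pos hm N) h
    (fun k hk => ha.partialOp_eq_zero hm hk x) (ha.norm_sum_partialOp_le hm hsl hl hxs hxl)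
  rw [meanOp, norm_mul, norm_inv, Complex.norm_of_nonneg hQ.le, inv_mul_le_iff₀ hQ]
  refine h1.trans ?_
  have h2 : w (M m N) ≤ w n := hw.mono _ _ (M_pos hm N) h
  calc D * (Q q n / M m N) * (A * (M m (s + 1) * M m (l + 1)) / M m N)
      = Q q n * (A * D * (M m (s + 1) * M m (l + 1) / (M m N ^ 2 * w (M m N))) * w (M m N)) := by
        field_simp
    _ ≤ _ := by gcongr

end IsAtom

/-! ### The integral estimate for one atom. -/

theorem sum_M_rpow_le (hm : ∀ k, 2 ≤ m k) {p : ℝ} (hp : 0 < p) (l : ℕ) :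
    ∑ s ∈ Finset.range l, (M m (s + 1) : ℝ) ^ p ≤ (1 - (2 : ℝ) ^ (-p))⁻¹ * (M m l : ℝ) ^ p := by
  have h2 : (2 : ℝ) ^ (-p) < 1 := Real.rpow_lt_one_of_one_lt_of_neg one_lt_two (by linarith)
  have h1 : 0 < 1 - (2 : ℝ) ^ (-p) := by linarith
  induction l with
  | zero => simp only [Finset.range_zero, Finset.sum_empty]; positivity
  | succ l ih =>
    have h3 : (M m l : ℝ) ^ p ≤ (2 : ℝ) ^ (-p) * (M m (l + 1) : ℝ) ^ p := by
      rw [Real.rpow_neg zero_le_two, le_inv_mul_iff₀ (by positivity),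
        ← Real.mul_rpow zero_le_two (by positivity)]
      exact Real.rpow_le_rpow (by positivity) (by exact_mod_cast two_mul_M_le hm l) hp.le
    rw [Finset.sum_range_succ]
    calc _ ≤ (1 - (2 : ℝ) ^ (-p))⁻¹ * ((2 : ℝ) ^ (-p) * (M m (l + 1) : ℝ) ^ p) +
        (M m (l + 1) : ℝ) ^ p := by
          gcongr
          exact ih.trans (mul_le_mul_of_nonneg_left h3 (inv_nonneg.mpr h1.le))
      _ = _ := by field_simp; ring

/-- The function dominating the `p`-th power of the maximal operator applied to an atom. -/
noncomputable def atomBound (m : ℕ → ℕ) (p : ℝ) (w : ℕ → ℝ) (N : ℕ) (z x : Group m) : ℝ :=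
  (interval m N z).indicator (fun _ => 1) x +
  ∑ s ∈ Finset.range N,
    (punctured m s N z).indicator (fun _ => ((M m (s + 1) : ℝ) / M m N) ^ p) x +
  ∑ l ∈ Finset.range N, ∑ s ∈ Finset.range l, (punctured m s l z).indicator
    (fun _ => ((M m (s + 1) : ℝ) * M m (l + 1) / (M m N ^ 2 * w (M m N))) ^ p) x

theorem integrable_indicator_punctured (hm : ∀ k, 2 ≤ m k) (s l : ℕ) (z : Group m) (c : ℝ) :
    Integrable ((punctured m s l z).indicator fun _ => c) (haar m) := by
  have := isProbabilityMeasure_haar m hm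
  exact (integrable_const c).indicator (measurableSet_punctured s l z)

theorem integral_indicator_punctured_le (hm : ∀ k, 2 ≤ m k) {B : ℕ} (hB : ∀ k, m k ≤ B) {s l : ℕ}
    (h : s < l) (z : Group m) {c : ℝ} (hc : 0 ≤ c) :
    ∫ x, (punctured m s l z).indicator (fun _ => c) x ∂haar m ≤ B * (M m l : ℝ)⁻¹ * c := by
  rw [integral_indicator_const _ (measurableSet_punctured s l z), smul_eq_mul]
  exact mul_le_mul_of_nonneg_right (haar_real_punctured_le hm hB h z) hc

section

variable {p C D : ℝ} {q w : ℕ → ℝ} {N : ℕ} {z : Group m} {A : ℝ} {a : Group m → ℂ}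

theorem atomBound_nonneg (hm : ∀ k, 2 ≤ m k) (hw : AdmissibleWeight m p w C) (x : Group m) :
    0 ≤ atomBound m p w N z x := by
  have hwM := hw.pos (M_pos hm N)
  unfold atomBound
  refine add_nonneg (add_nonneg ?_ (Finset.sum_nonneg fun s _ => ?_))
    (Finset.sum_nonneg fun l _ => Finset.sum_nonneg fun s _ => ?_) <;>
  exact Set.indicator_nonneg (fun _ _ => by positivity) _

theorem integrable_atomBound (hm : ∀ k, 2 ≤ m k) :
    Integrable (atomBound m p w N z) (haar m) := by
  have := isProbabilityMeasure_haar m hm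
  exact (((integrable_const (1 : ℝ)).indicator (measurableSet_interval N z)).add
    (integrable_finsetSum _ fun s _ => integrable_indicator_punctured hm _ _ _ _)).add
    (integrable_finsetSum _ fun l _ => integrable_finsetSum _ fun s _ =>
      integrable_indicator_punctured hm _ _ _ _)

/-- The sums over `s` are geometric, hence dominated by their last terms. As the punctured set at
`l` has measure `O(1 / M_l)`, the `l`-th part of the double sum is `O(M_{l+1}^{2p-1} / (M_N²
w(M_N))^p)`, and `sum_le` turns the total into a multiple of the measure of the support. -/
theorem integral_atomBound_le (hm : ∀ k, 2 ≤ m k) {B : ℕ} (hB : ∀ k, m k ≤ B) (hp : 0 < p)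
    (hw : AdmissibleWeight m p w C) :
    ∫ x, atomBound m p w N z x ∂haar m ≤
      (1 + (1 - (2 : ℝ) ^ (-p))⁻¹ * B + (1 - (2 : ℝ) ^ (-p))⁻¹ * B ^ 2 * C) *
        (haar m).real (interval m N z) := by
  have := isProbabilityMeasure_haar m hm
  have hwM := hw.pos (M_pos hm N)
  have hM : ∀ s, (0 : ℝ) < M m s := fun s => by exact_mod_cast M_pos hm s
  set G := (1 - (2 : ℝ) ^ (-p))⁻¹ with hG
  have hG0 : 0 ≤ G := by
    have h2 : (2 : ℝ) ^ (-p) < 1 := Real.rpow_lt_one_of_one_lt_of_neg one_lt_two (by linarith)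
    exact inv_nonneg.mpr (by linarith)
  have hi := fun s l c => integrable_indicator_punctured hm s l z c
  have hM1 := (hM N)
  unfold atomBound
  rw [integral_add, integral_add,
    integral_finsetSum _ fun s _ => hi _ _ _,
    integral_finsetSum _ fun l _ => integrable_finsetSum _ fun s _ => hi _ _ _,
    integral_indicator_const _ (measurableSet_interval N z), smul_eq_mul, mul_one, add_mul, add_mul,
    one_mul, haar_real_interval hm]
  refine add_le_add (add_le_add le_rfl ?_) ?_
  · calc _ ≤ ∑ s ∈ Finset.range N, B * (M m N : ℝ)⁻¹ * ((M m (s + 1) : ℝ) / M m N) ^ p :=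
          Finset.sum_le_sum fun s hs => integral_indicator_punctured_le hm hB
            (Finset.mem_range.mp hs) z (by positivity)
      _ = B * (M m N : ℝ)⁻¹ * ((∑ s ∈ Finset.range N, (M m (s + 1) : ℝ) ^ p) / (M m N : ℝ) ^ p) := by
          rw [Finset.sum_div, Finset.mul_sum]
          exact Finset.sum_congr rfl fun s _ => by rw [Real.div_rpow (hM _).le (hM _).le]
      _ ≤ B * (M m N : ℝ)⁻¹ * G := by
          gcongr
          rw [div_le_iff₀ (by positivity)]
          exact sum_M_rpow_le hm hp N
      _ = _ := by ring
  · set W := (M m N : ℝ) ^ 2 * w (M m N) with hW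
    have hW0 : 0 < W := by positivity
    calc _ ≤ ∑ l ∈ Finset.range N, G * B ^ 2 / W ^ p * (M m (l + 1) : ℝ) ^ (2 * p - 1) := by
          refine Finset.sum_le_sum fun l _ => ?_
          rw [integral_finsetSum _ fun s _ => hi _ _ _]
          calc _ ≤ ∑ s ∈ Finset.range l,
                B * (M m l : ℝ)⁻¹ * ((M m (s + 1) : ℝ) * M m (l + 1) / W) ^ p :=
                Finset.sum_le_sum fun s hs => integral_indicator_punctured_le hm hB
                  (Finset.mem_range.mp hs) z (by positivity)
            _ = B * (M m l : ℝ)⁻¹ * ((M m (l + 1) : ℝ) ^ p / W ^ p *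
                ∑ s ∈ Finset.range l, (M m (s + 1) : ℝ) ^ p) := by
                rw [Finset.mul_sum, Finset.mul_sum]
                refine Finset.sum_congr rfl fun s _ => ?_
                rw [Real.div_rpow (by positivity) hW0.le, Real.mul_rpow (hM _).le (hM _).le]
                ring
            -- The index `l` is raised to `l + 1` in both places; replacing `1 / M_l` by `B /
            -- M_{l+1}` costs the second factor `B`.
            _ ≤ B * (B * (M m (l + 1) : ℝ)⁻¹) * ((M m (l + 1) : ℝ) ^ p / W ^ p *
                (G * (M m (l + 1) : ℝ) ^ p)) := by
                gcongr
                · rw [← div_eq_mul_inv, inv_eq_one_div, div_le_div_iff₀ (hM _) (hM _), one_mul]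
                  exact_mod_cast M_succ_le hB l
                · refine (sum_M_rpow_le hm hp l).trans ?_
                  gcongr
                  exact M_mono hm (Nat.le_succ l)
            _ = _ := by
                rw [Real.rpow_sub (hM _), Real.rpow_one, two_mul, Real.rpow_add (hM _)]
                ring
      _ = G * B ^ 2 / W ^ p * ∑ l ∈ Finset.range N, (M m (l + 1) : ℝ) ^ (2 * p - 1) := by
          rw [Finset.mul_sum]
      _ ≤ G * B ^ 2 / W ^ p * (C * W ^ p / M m N) := by
          gcongr
          exact hw.sum_le N
      _ = _ := by field_simp
  · exact (integrable_const (1 : ℝ)).indicator (measurableSet_interval N z)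
  · exact integrable_finsetSum _ fun s _ => hi _ _ _
  · exact ((integrable_const (1 : ℝ)).indicator (measurableSet_interval N z)).add
      (integrable_finsetSum _ fun s _ => hi _ _ _)
  · exact integrable_finsetSum _ fun l _ => integrable_finsetSum _ fun s _ => hi _ _ _

theorem ofReal_rpow_le {X : ℝ≥0∞} {E c φ : ℝ} (hp : 0 < p) (hc : 0 ≤ c) (hE : 0 ≤ E)
    (hX : X ≤ ENNReal.ofReal (c * E)) (h : E ^ p ≤ φ) : X ^ p ≤ ENNReal.ofReal (c ^ p * φ) := by
  refine (ENNReal.rpow_le_rpow hX hp.le).trans ?_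
  rw [ENNReal.ofReal_rpow_of_nonneg (by positivity) hp.le, Real.mul_rpow hc hE]
  gcongr

/-- The three parts of `atomBound` correspond to the number of coordinates below `N` at which `x`
differs from `z`: none (Lebesgue constants), one (Dirichlet bound), at least two (Fejér bound and
summation by parts). -/
theorem meanMax_atom_le (hm : ∀ k, 2 ≤ m k) {B : ℕ} (hB : ∀ k, m k ≤ B) (hp : 0 < p)
    (hw : AdmissibleWeight m p w C) (hq : AdmissibleCoefficients q D)
    (ha : IsAtom m N z A a) (x : Group m) :
    meanMax m q w a x ^ p ≤
      ENNReal.ofReal ((A * ((1 + B) * C * D)) ^ p * atomBound m p w N z x) := by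
  have hA := ha.nonneg
  have hC := hw.one_le
  have hD := hq.one_le
  have hwM := hw.pos (M_pos hm N)
  have hMN : (0 : ℝ) < M m N := by exact_mod_cast M_pos hm N
  have hCD : 1 ≤ C * D := one_le_mul_of_one_le_of_one_le hC hD
  have hBr : (0 : ℝ) ≤ B := by positivity
  have hnn1 : ∀ s, 0 ≤ (punctured m s N z).indicator
      (fun _ => ((M m (s + 1) : ℝ) / M m N) ^ p) x := fun s =>
    Set.indicator_nonneg (fun _ _ => by positivity) _
  have hnn2 : ∀ l s, 0 ≤ (punctured m s l z).indicator
      (fun _ => ((M m (s + 1) : ℝ) * M m (l + 1) / (M m N ^ 2 * w (M m N))) ^ p) x := fun l s =>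
    Set.indicator_nonneg (fun _ _ => by positivity) _
  have hnn3 : 0 ≤ (interval m N z).indicator (fun _ => (1 : ℝ)) x :=
    Set.indicator_nonneg (fun _ _ => zero_le_one) _
  have hs1 := Finset.sum_nonneg fun s (_ : s ∈ Finset.range N) => hnn1 s
  have hs2 := Finset.sum_nonneg fun l (_ : l ∈ Finset.range N) =>
    Finset.sum_nonneg fun s (_ : s ∈ Finset.range l) => hnn2 l s
  by_cases hx : x ∈ interval m N z
  · refine ofReal_rpow_le (E := 1) hp (by positivity) zero_le_one ?_ ?_
    · refine meanMax_le (fun n => hw.pos) fun n hn =>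
        (norm_meanOp_le hm hB hw hq ha.norm_le x hn).trans ?_
      have := hw.pos hn
      calc A * (1 + B) * C * w n = A * ((1 + B) * C * 1) * 1 * w n := by ring
        _ ≤ _ := by gcongr
    · rw [Real.one_rpow, atomBound]
      have : (interval m N z).indicator (fun _ => (1 : ℝ)) x = 1 := Set.indicator_of_mem hx _
      linarith
  obtain ⟨s, hs, hne, hmem⟩ := exists_first_ne hx
  by_cases hx' : x ∈ punctured m s N z
  · refine ofReal_rpow_le (E := (M m (s + 1) : ℝ) / M m N) hp (by positivity) (by positivity) ?_ ?_
    · refine meanMax_le (fun n => hw.pos) fun n hn =>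
        (norm_meanOp_le_of_partialOp hq.nonneg hq.pos hn fun k _ =>
          ha.norm_partialOp_le hm hs hne.symm k).trans ?_
      have h1 := hw.one_le_mul hn
      have h2 := hw.pos hn
      calc A * ((M m (s + 1) : ℝ) / M m N) ≤ A * ((M m (s + 1) : ℝ) / M m N) * (C * w n) :=
            le_mul_of_one_le_right (by positivity) h1
        _ ≤ A * ((M m (s + 1) : ℝ) / M m N) * (((1 + B) * C * D) * w n) := by
            gcongr
            nlinarith
        _ = _ := by ring
    · have h1 := Finset.single_le_sum (fun s _ => hnn1 s) (Finset.mem_range.mpr hs)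
      rw [Set.indicator_of_mem hx'] at h1
      rw [atomBound]
      linarith
  · classical
    have hex : ∃ l, l < N ∧ l ≠ s ∧ x l ≠ z l := by
      simpa [punctured] using hx'
    -- The second coordinate at which `x` differs from `z`; its minimality places `x` in the
    -- punctured set with parameters `s` and `l`.
    set l := Nat.find hex with hldef
    obtain ⟨hl, hls, hxl⟩ := Nat.find_spec hex
    have hsl : s < l := by
      rcases lt_or_gt_of_ne hls with h | h
      · exact absurd (hmem _ h) hxl
      · exact h
    have hxp : x ∈ punctured m s l z := by
      intro i hi his
      by_contra hcon
      exact Nat.find_min hex hi ⟨hi.trans hl, his, hcon⟩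
    refine ofReal_rpow_le
      (E := (M m (s + 1) : ℝ) * M m (l + 1) / (M m N ^ 2 * w (M m N))) hp
      (by positivity) (by positivity) ?_ ?_
    · refine meanMax_le (fun n => hw.pos) fun n hn =>
        (ha.norm_meanOp_le_pair hm hw hq hsl hl hne.symm hxl hn).trans ?_
      have h2 := hw.pos hn
      gcongr
      nlinarith
    · have h1 := Finset.single_le_sum (fun s _ => hnn2 l s) (Finset.mem_range.mpr hsl)
      have h2 := Finset.single_le_sum (fun l (_ : l ∈ Finset.range N) =>
        Finset.sum_nonneg fun s (_ : s ∈ Finset.range l) => hnn2 l s) (Finset.mem_range.mpr hl)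
      rw [Set.indicator_of_mem hxp] at h1
      rw [atomBound]
      linarith

theorem lintegral_meanMax_atom_le (hm : ∀ k, 2 ≤ m k) {B : ℕ} (hB : ∀ k, m k ≤ B) (hp : 0 < p)
    (hw : AdmissibleWeight m p w C) (hq : AdmissibleCoefficients q D) :
    ∃ K : ℝ, 0 ≤ K ∧ ∀ (N : ℕ) (z : Group m) (A : ℝ) (a : Group m → ℂ), IsAtom m N z A a →
      ∫⁻ x, meanMax m q w a x ^ p ∂haar m ≤
        ENNReal.ofReal (K * A ^ p) * haar m (interval m N z) := by
  have := isProbabilityMeasure_haar m hm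
  have hC := hw.one_le
  have hD := hq.one_le
  have h2 : (2 : ℝ) ^ (-p) < 1 := Real.rpow_lt_one_of_one_lt_of_neg one_lt_two (by linarith)
  have hG0 : 0 ≤ (1 - (2 : ℝ) ^ (-p))⁻¹ := inv_nonneg.mpr (by linarith)
  refine ⟨((1 + B) * C * D) ^ p *
    (1 + (1 - (2 : ℝ) ^ (-p))⁻¹ * B + (1 - (2 : ℝ) ^ (-p))⁻¹ * B ^ 2 * C), by positivity,
    fun N z A a ha => ?_⟩
  have hA := ha.nonneg
  calc _ ≤ ∫⁻ x, ENNReal.ofReal ((A * ((1 + B) * C * D)) ^ p * atomBound m p w N z x) ∂haar m :=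
        lintegral_mono fun x => meanMax_atom_le hm hB hp hw hq ha x
    _ = ENNReal.ofReal (∫ x, (A * ((1 + B) * C * D)) ^ p * atomBound m p w N z x ∂haar m) := by
        rw [ofReal_integral_eq_lintegral_ofReal ((integrable_atomBound hm).const_mul _)]
        exact Eventually.of_forall fun x =>
          mul_nonneg (by positivity) (atomBound_nonneg hm hw x)
    _ ≤ ENNReal.ofReal (((1 + B) * C * D) ^ p *
          (1 + (1 - (2 : ℝ) ^ (-p))⁻¹ * B + (1 - (2 : ℝ) ^ (-p))⁻¹ * B ^ 2 * C) * A ^ p *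
          (haar m).real (interval m N z)) := by
        refine ENNReal.ofReal_le_ofReal ?_
        rw [integral_const_mul, Real.mul_rpow hA (by positivity)]
        refine (mul_le_mul_of_nonneg_left (integral_atomBound_le hm hB hp hw)
          (by positivity)).trans (le_of_eq ?_)
        ring
    _ = _ := by
        rw [ENNReal.ofReal_mul (by positivity), ofReal_measureReal]

end

/-! ### Subadditivity of the `p`-th power for `p ≤ 1`. -/

theorem rpow_finsetSum_le {ι : Type*} (s : Finset ι) (a : ι → ℝ≥0∞) {p : ℝ} (hp : 0 < p)
    (hp1 : p ≤ 1) : (∑ i ∈ s, a i) ^ p ≤ ∑ i ∈ s, a i ^ p := by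
  classical
  induction s using Finset.induction_on with
  | empty => simp [hp]
  | insert i s hi ih =>
    rw [Finset.sum_insert hi, Finset.sum_insert hi]
    exact (ENNReal.rpow_add_le_add_rpow _ _ hp.le hp1).trans (add_le_add le_rfl ih)

theorem measurable_meanMax (hm : ∀ k, 2 ≤ m k) (q w : ℕ → ℝ) {h : Group m → ℂ}
    (hh : Integrable h (haar m)) : Measurable (meanMax m q w h) := by
  refine Measurable.iSup fun n => Measurable.iSup fun _ => Measurable.div_const ?_ _
  refine Measurable.enorm (Measurable.const_mul ?_ _)
  refine Finset.measurable_fun_sum _ fun k _ => Measurable.const_mul ?_ _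
  rw [show partialOp m k h = _ from funext (partialOp_eq_sum hm hh k)]
  exact Finset.measurable_fun_sum _ fun i _ => (measurable_psi m i).const_mul _

theorem lintegral_meanMax_finsetSum_le (hm : ∀ k, 2 ≤ m k) (q w : ℕ → ℝ) {p : ℝ} (hp : 0 < p)
    (hp1 : p ≤ 1) {ι : Type*} (s : Finset ι) {h : ι → Group m → ℂ}
    (hh : ∀ i ∈ s, Integrable (h i) (haar m)) :
    ∫⁻ x, meanMax m q w (fun t => ∑ i ∈ s, h i t) x ^ p ∂haar m ≤
      ∑ i ∈ s, ∫⁻ x, meanMax m q w (h i) x ^ p ∂haar m := by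
  rw [← lintegral_finsetSum' _ fun i hi =>
    ((measurable_meanMax hm q w (hh i hi)).pow_const p).aemeasurable]
  refine lintegral_mono fun x => ?_
  exact (ENNReal.rpow_le_rpow (meanMax_finsetSum_le hm q w s hh x) hp.le).trans
    (rpow_finsetSum_le s _ hp hp1)

/-! ### Predictable stopping and the atomic decomposition. -/

/-- The event that a martingale exceeds `Λ` one step after time at most `n`, on some child of the
interval containing the point. -/
def Stopped (m : ℕ → ℕ) (f : ℕ → Group m → ℂ) (Λ : ℝ) (n : ℕ) (x : Group m) : Prop :=
  ∃ j ≤ n, ∃ y ∈ interval m j x, Λ < ‖f (j + 1) y‖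

/-- The event that the stopping occurs exactly at time `n`. -/
def FirstStopped (m : ℕ → ℕ) (f : ℕ → Group m → ℂ) (Λ : ℝ) (n : ℕ) (x : Group m) : Prop :=
  Stopped m f Λ n x ∧ ∀ j < n, ¬ Stopped m f Λ j x

section

variable {f : ℕ → Group m → ℂ} {Λ Λ' : ℝ}

theorem Stopped.mono {n k : ℕ} {x : Group m} (h : Stopped m f Λ n x) (hnk : n ≤ k) :
    Stopped m f Λ k x :=
  let ⟨j, hj, hy⟩ := h
  ⟨j, hj.trans hnk, hy⟩

theorem Stopped.anti {n : ℕ} {x : Group m} (h : Stopped m f Λ' n x) (hΛ : Λ ≤ Λ') :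
    Stopped m f Λ n x :=
  let ⟨j, hj, y, hy, hlt⟩ := h
  ⟨j, hj, y, hy, hΛ.trans_lt hlt⟩

theorem Stopped.congr {n k : ℕ} (hnk : n ≤ k) {x y : Group m} (hxy : y ∈ interval m k x) :
    Stopped m f Λ n y ↔ Stopped m f Λ n x := by
  have : ∀ j ≤ n, interval m j y = interval m j x := fun j hj =>
    interval_eq (interval_anti (hj.trans hnk) x hxy)
  constructor
  · rintro ⟨j, hj, w, hw, hlt⟩
    exact ⟨j, hj, w, this j hj ▸ hw, hlt⟩
  · rintro ⟨j, hj, w, hw, hlt⟩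
    exact ⟨j, hj, w, (this j hj).symm ▸ hw, hlt⟩

theorem FirstStopped.congr {n k : ℕ} (hnk : n ≤ k) {x y : Group m} (hxy : y ∈ interval m k x) :
    FirstStopped m f Λ n y ↔ FirstStopped m f Λ n x := by
  refine and_congr (Stopped.congr hnk hxy) (forall₂_congr fun j hj => ?_)
  rw [Stopped.congr (hj.le.trans hnk) hxy]

theorem FirstStopped.eq {n k : ℕ} {x : Group m} (hn : FirstStopped m f Λ n x)
    (hk : FirstStopped m f Λ k x) : n = k := by
  rcases lt_trichotomy n k with h | h | h
  · exact absurd hn.1 (hk.2 n h)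
  · exact h
  · exact absurd hk.1 (hn.2 k h)

theorem exists_firstStopped {N n : ℕ} {x : Group m} (hn : n < N) (h : Stopped m f Λ n x) :
    ∃ k < N, FirstStopped m f Λ k x := by
  classical
  have hex : ∃ n, Stopped m f Λ n x := ⟨n, h⟩
  exact ⟨Nat.find hex, (Nat.find_min' hex h).trans_lt hn, Nat.find_spec hex, fun j hj =>
    Nat.find_min hex hj⟩

open Classical in
/-- The martingale at time `N`, stopped as soon as it is about to exceed `Λ`. -/
noncomputable def stoppedPart (m : ℕ → ℕ) (f : ℕ → Group m → ℂ) (Λ : ℝ) (N : ℕ)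
    (x : Group m) : ℂ :=
  f 0 x + ∑ n ∈ Finset.range N, if Stopped m f Λ n x then 0 else f (n + 1) x - f n x

theorem stoppedPart_of_not_stopped {N : ℕ} {x : Group m} (h : ∀ j < N, ¬ Stopped m f Λ j x) :
    stoppedPart m f Λ N x = f N x := by
  rw [stoppedPart, Finset.sum_congr rfl fun n hn => if_neg (h n (Finset.mem_range.mp hn)),
    Finset.sum_range_sub fun n => f n x, add_sub_cancel]

/-- Stopping looks one step ahead over the whole current interval, so it happens before the level
can be exceeded. The jump is never added, and no bound on martingale increments is needed. -/
theorem norm_stoppedPart_le {x : Group m} (h0 : ‖f 0 x‖ ≤ Λ) (N : ℕ) :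
    ‖stoppedPart m f Λ N x‖ ≤ Λ := by
  induction N with
  | zero => simpa [stoppedPart] using h0
  | succ N ih =>
    by_cases h : Stopped m f Λ N x
    · have : stoppedPart m f Λ (N + 1) x = stoppedPart m f Λ N x := by
        rw [stoppedPart, Finset.sum_range_succ, if_pos h, add_zero, stoppedPart]
      rwa [this]
    · rw [stoppedPart_of_not_stopped fun j hj hs => h (hs.mono (Nat.lt_succ_iff.mp hj))]
      by_contra hlt
      exact h ⟨N, le_rfl, x, mem_interval_self N x, not_le.mp hlt⟩

theorem Martingale.eq_of_mem (hf : Martingale f (filtration m) (haar m)) {n k : ℕ} (hnk : n ≤ k)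
    {x y : Group m} (h : y ∈ interval m k x) : f n y = f n x :=
  eq_of_stronglyMeasurable (hf.stronglyAdapted n) (interval_anti hnk x h)

theorem stoppedPart_congr (hf : Martingale f (filtration m) (haar m)) {N : ℕ} {x y : Group m}
    (h : y ∈ interval m N x) : stoppedPart m f Λ N y = stoppedPart m f Λ N x := by
  classical
  rw [stoppedPart, stoppedPart, Martingale.eq_of_mem hf (Nat.zero_le N) h]
  congr 1
  refine Finset.sum_congr rfl fun n hn => ?_
  have hn' := Finset.mem_range.mp hn
  rw [Martingale.eq_of_mem hf hn'.le h, Martingale.eq_of_mem hf (Nat.succ_le_of_lt hn') h]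
  simp only [Stopped.congr hn'.le h]

theorem integrable_of_interval (hm : ∀ k, 2 ≤ m k) {n : ℕ} {g : Group m → ℂ}
    (hg : ∀ x, ∀ y ∈ interval m n x, g y = g x) {A : ℝ} (hA : ∀ x, ‖g x‖ ≤ A) :
    Integrable g (haar m) := by
  have := isProbabilityMeasure_haar m hm
  exact Integrable.of_bound (((stronglyMeasurable_of_interval hm hg).mono
    ((filtration m).le n)).aestronglyMeasurable) A (Eventually.of_forall hA)

open Classical in
/-- The part of the difference of two stopped martingales living on the interval of `z`, if the
first stopping occurs there at time `n`. -/
noncomputable def atomPart (m : ℕ → ℕ) (f : ℕ → Group m → ℂ) (Λ Λ' : ℝ) (N n : ℕ)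
    (z : Group m) : Group m → ℂ :=
  (interval m n z).indicator fun x =>
    if FirstStopped m f Λ n x then stoppedPart m f Λ' N x - stoppedPart m f Λ N x else 0

open Classical in
-- A point is first stopped at level `Λ` at no more than one time. If this does not happen before
-- `N`, neither level stops the point and both stopped values equal `f N`.
theorem sum_atomPart {R : ℕ → Finset (Group m)}
    (hR : ∀ n, ∀ x, ∃! z, z ∈ R n ∧ x ∈ interval m n z) (hΛ : Λ ≤ Λ') (N : ℕ) (x : Group m) :
    ∑ n ∈ Finset.range N, ∑ z ∈ R n, atomPart m f Λ Λ' N n z x =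
      stoppedPart m f Λ' N x - stoppedPart m f Λ N x := by
  simp only [atomPart, sum_indicator_interval (hR _)]
  by_cases h : ∃ k < N, FirstStopped m f Λ k x
  · obtain ⟨k, hk, hfs⟩ := h
    rw [Finset.sum_eq_single_of_mem k (Finset.mem_range.mpr hk), if_pos hfs]
    exact fun n _ hne => if_neg fun hn => hne (hn.eq hfs)
  · have h1 : ∀ j < N, ¬ Stopped m f Λ j x := fun j hj hs => h (exists_firstStopped hj hs)
    rw [stoppedPart_of_not_stopped h1, stoppedPart_of_not_stopped fun j hj hs =>
      h1 j hj (hs.anti hΛ), sub_self]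
    exact Finset.sum_eq_zero fun n hn => if_neg fun hs => h1 n (Finset.mem_range.mp hn) hs.1

open Classical in
-- Up to the first stopping time `n` at level `Λ` both stopped martingales use the same increments.
-- What remains on the interval of `z` are increments from time `n` on, restricted to events known
-- at their starting times, so the martingale property gives mean zero.
theorem isAtom_atomPart (hm : ∀ k, 2 ≤ m k) (hf : Martingale f (filtration m) (haar m))
    (hΛ : Λ ≤ Λ') (h0 : ∀ x, ‖f 0 x‖ ≤ Λ) {N n : ℕ} (hn : n < N) (z : Group m) :
    IsAtom m n z (if FirstStopped m f Λ n z then Λ' + Λ else 0) (atomPart m f Λ Λ' N n z) := by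
  have hP := isProbabilityMeasure_haar m hm
  have hLnn : 0 ≤ Λ := (norm_nonneg _).trans (h0 z)
  have hbd : ∀ t, ‖atomPart m f Λ Λ' N n z t‖ ≤
      if FirstStopped m f Λ n z then Λ' + Λ else 0 := by
    intro t
    by_cases ht : t ∈ interval m n z
    · rw [atomPart, Set.indicator_of_mem ht]
      simp only [FirstStopped.congr le_rfl ht]
      split_ifs
      · exact (norm_sub_le _ _).trans (add_le_add
          (norm_stoppedPart_le ((h0 t).trans hΛ) N) (norm_stoppedPart_le (h0 t) N))
      · simp
    · rw [atomPart, Set.indicator_of_notMem ht, norm_zero]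
      split_ifs <;> linarith
  refine ⟨integrable_of_interval hm (n := N) ?_ hbd, hbd,
    fun t ht => Set.indicator_of_notMem ht _, ?_⟩
  · intro x y hy
    have hmem : y ∈ interval m n z ↔ x ∈ interval m n z := by
      have := interval_anti hn.le x hy
      rw [mem_interval_comm, interval_eq this, mem_interval_comm]
    simp only [atomPart, Set.indicator_apply, hmem, FirstStopped.congr hn.le hy,
      stoppedPart_congr hf hy]
  · by_cases hz : FirstStopped m f Λ n z
    -- `S j` is where the `j`-th increment survives in the difference: level `Λ` has already
    -- stopped, level `Λ'` has not. It is a union of intervals of level `j`.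
    · let S : ℕ → Set (Group m) := fun j =>
        {x | n ≤ j ∧ x ∈ interval m n z ∧ ¬ Stopped m f Λ' j x}
      have hS : ∀ j, n ≤ j → ∀ x ∈ S j, interval m j x ⊆ S j := by
        rintro j hnj x ⟨_, hx, hxs⟩ y hy
        refine ⟨hnj, ?_, by rwa [Stopped.congr le_rfl hy]⟩
        have h1 := interval_anti hnj x hy
        rwa [interval_eq hx] at h1
      have hSm : ∀ j, MeasurableSet (S j) := by
        intro j
        by_cases hnj : n ≤ j
        · exact measurableSet_of_interval_subset hm (hS j hnj)
        · have : S j = ∅ := by ext x; simp [S, hnj]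
          rw [this]; exact MeasurableSet.empty
      have heq : atomPart m f Λ Λ' N n z = fun x => ∑ j ∈ Finset.range N,
          (S j).indicator (f (j + 1) - f j) x := by
        funext x
        by_cases hx : x ∈ interval m n z
        · rw [atomPart, Set.indicator_of_mem hx, if_pos ((FirstStopped.congr le_rfl hx).mpr hz),
            stoppedPart, stoppedPart, add_sub_add_left_eq_sub, ← Finset.sum_sub_distrib]
          have hxz := (FirstStopped.congr le_rfl hx).mpr hz
          refine Finset.sum_congr rfl fun j _ => ?_
          by_cases hnj : n ≤ j
          · rw [if_pos (hxz.1.mono hnj), sub_zero]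
            by_cases hs : Stopped m f Λ' j x
            · rw [if_pos hs, Set.indicator_of_notMem fun h => h.2.2 hs]
            · rw [if_neg hs, Set.indicator_of_mem (show x ∈ S j from ⟨hnj, hx, hs⟩),
                Pi.sub_apply]
          · have h1 := hxz.2 j (not_le.mp hnj)
            rw [if_neg h1, if_neg fun hs => h1 (hs.anti hΛ), sub_self,
              Set.indicator_of_notMem fun h => hnj h.1]
        · rw [atomPart, Set.indicator_of_notMem hx, Finset.sum_eq_zero]
          exact fun j _ => Set.indicator_of_notMem (fun h => hx h.2.1) _
      rw [heq]
      beta_reduce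
      rw [integral_finsetSum _ fun j _ =>
        ((hf.integrable (j + 1)).sub (hf.integrable j)).indicator (hSm j)]
      refine Finset.sum_eq_zero fun j _ => ?_
      rw [integral_indicator (hSm j), integral_sub' (hf.integrable (j + 1)).integrableOn
        (hf.integrable j).integrableOn, sub_eq_zero]
      by_cases hnj : n ≤ j
      · exact (setIntegral_interval_eq hm hf le_rfl (Nat.le_succ j) (hS j hnj)).symm
      · have : S j = ∅ := by ext x; simp [S, hnj]
        rw [this]; simp
    · have : atomPart m f Λ Λ' N n z = 0 := by
        funext t
        have := hbd t
        rw [if_neg hz] at this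
        exact norm_le_zero_iff.mp this
      rw [this]; simp

theorem measurable_maximalFunction (hf : Martingale f (filtration m) (haar m)) :
    Measurable (maximalFunction m f) :=
  Measurable.iSup fun n => ((hf.stronglyAdapted n).mono ((filtration m).le n)).measurable.enorm

open Classical in
-- Each stopping interval has a child on which `|f| > Λ` at the next time, and a child carries at
-- least the fraction `1 / B` of the measure. The events for different `n` are disjoint.
theorem sum_haar_interval_le (hm : ∀ k, 2 ≤ m k) {B : ℕ} (hB : ∀ k, m k ≤ B)
    (hf : Martingale f (filtration m) (haar m)) {R : ℕ → Finset (Group m)}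
    (hR : ∀ n, ∀ x, ∃! z, z ∈ R n ∧ x ∈ interval m n z) (hΛ0 : 0 ≤ Λ) (N : ℕ) :
    ∑ n ∈ Finset.range N, ∑ z ∈ R n,
      (if FirstStopped m f Λ n z then haar m (interval m n z) else 0) ≤
      B * haar m {x | ENNReal.ofReal Λ < maximalFunction m f x} := by
  have hP := isProbabilityMeasure_haar m hm
  set E := {x | ENNReal.ofReal Λ < maximalFunction m f x} with hE
  have hEm : MeasurableSet E := measurableSet_lt measurable_const (measurable_maximalFunction hf)
  let T : ℕ → Set (Group m) := fun n => {x | FirstStopped m f Λ n x} ∩ E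
  have hTm : ∀ n, MeasurableSet (T n) := fun n =>
    (measurableSet_of_interval_subset hm (n := n) fun x hx y hy =>
      (FirstStopped.congr le_rfl hy).mpr hx).inter hEm
  have h1 : ∀ n, ∀ z, (if FirstStopped m f Λ n z then haar m (interval m n z) else 0) ≤
      B * ∫⁻ x, (interval m n z).indicator ((T n).indicator 1) x ∂haar m := by
    intro n z
    split_ifs with h
    · obtain ⟨⟨j, hj, y, hy, hlt⟩, hmin⟩ := h
      -- An earlier excess would have caused an earlier stop, so the witness belongs to the last
      -- possible time.
      have hjn : j = n := by
        by_contra hne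
        exact hmin j (lt_of_le_of_ne hj hne) ⟨j, le_rfl, y, hy, hlt⟩
      subst hjn
      have hsub : interval m (j + 1) y ⊆ interval m j z ∩ T j := by
        intro x hx
        have hxz : x ∈ interval m j z := by
          have := interval_anti (Nat.le_succ j) y hx
          rwa [interval_eq hy] at this
        refine ⟨hxz, (FirstStopped.congr le_rfl hxz).mpr ⟨⟨j, le_rfl, y, hy, hlt⟩, hmin⟩, ?_⟩
        refine lt_of_lt_of_le ?_ (le_iSup (fun n => ‖f n x‖ₑ) (j + 1))
        rw [Martingale.eq_of_mem hf le_rfl hx, ← ofReal_norm]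
        exact (ENNReal.ofReal_lt_ofReal_iff_of_nonneg hΛ0).mpr hlt
      rw [Set.indicator_indicator, lintegral_indicator_one
        ((measurableSet_interval j z).inter (hTm j))]
      calc haar m (interval m j z) ≤ B * haar m (interval m (j + 1) y) := by
            rw [haar_interval hm, haar_interval hm, ← div_eq_mul_inv,
              ENNReal.le_div_iff_mul_le (Or.inl (by simpa using (M_pos hm _).ne'))
                (Or.inl (by simp)), mul_comm, ← div_eq_mul_inv]
            refine ENNReal.div_le_of_le_mul ?_
            exact_mod_cast M_succ_le hB j
        _ ≤ _ := by gcongr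
    · positivity
  calc _ ≤ ∑ n ∈ Finset.range N, ∑ z ∈ R n,
        B * ∫⁻ x, (interval m n z).indicator ((T n).indicator 1) x ∂haar m :=
        Finset.sum_le_sum fun n _ => Finset.sum_le_sum fun z _ => h1 n z
    _ = B * ∫⁻ x, ∑ n ∈ Finset.range N, (T n).indicator 1 x ∂haar m := by
        rw [lintegral_finsetSum _ fun n _ => measurable_one.indicator (hTm n), Finset.mul_sum]
        refine Finset.sum_congr rfl fun n _ => ?_
        rw [← Finset.mul_sum, ← lintegral_finsetSum _ fun z _ =>
          (measurable_one.indicator (hTm n)).indicator (measurableSet_interval n z)]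
        simp only [sum_indicator_interval (hR n)]
    _ ≤ B * ∫⁻ x, E.indicator 1 x ∂haar m := by
        gcongr with x
        by_cases hx : ∃ k < N, x ∈ T k
        · obtain ⟨k, hk, hxk⟩ := hx
          rw [Finset.sum_eq_single_of_mem k (Finset.mem_range.mpr hk), Set.indicator_of_mem hxk,
            Set.indicator_of_mem hxk.2]
          exact fun n _ hne => Set.indicator_of_notMem (fun hn => hne (hn.1.eq hxk.1)) _
        · rw [Finset.sum_eq_zero fun n hn => Set.indicator_of_notMem (fun h =>
            hx ⟨n, Finset.mem_range.mp hn, h⟩) _]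
          positivity
    _ = _ := by rw [lintegral_indicator_one hEm]

end

/-! ### Summation over dyadic levels and the maximal inequality. -/

theorem sum_dyadic_le {p r : ℝ} (hp : 0 < p) (hr : 0 ≤ r) (K : ℕ) :
    ∑ k ∈ Finset.range (K + 1), (r * 2 ^ k) ^ p ≤ (1 - (2 : ℝ) ^ (-p))⁻¹ * (r * 2 ^ K) ^ p := by
  have h2 : (2 : ℝ) ^ (-p) < 1 := Real.rpow_lt_one_of_one_lt_of_neg one_lt_two (by linarith)
  have h1 : 0 < 1 - (2 : ℝ) ^ (-p) := by linarith
  have h0 : (0 : ℝ) < 2 ^ (-p) := by positivity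
  induction K with
  | zero =>
    simp only [zero_add, Finset.range_one, Finset.sum_singleton]
    refine le_mul_of_one_le_left (by positivity) ?_
    rw [one_le_inv₀ h1]; linarith
  | succ K ih =>
    have h3 : (r * 2 ^ K) ^ p = (2 : ℝ) ^ (-p) * (r * 2 ^ (K + 1)) ^ p := by
      rw [pow_succ, ← mul_assoc, Real.mul_rpow (x := r * 2 ^ K) (by positivity) zero_le_two,
        mul_comm ((r * 2 ^ K) ^ p), ← mul_assoc, ← Real.rpow_add two_pos, neg_add_cancel,
        Real.rpow_zero, one_mul]
    rw [Finset.sum_range_succ]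
    rw [h3] at ih
    refine (add_le_add ih le_rfl).trans (le_of_eq ?_)
    field_simp
    ring

/-- A discrete layer-cake estimate: if the top level lies below `y`, the geometric sum is controlled
by that level alone; otherwise it can be dropped. -/
theorem sum_dyadic_indicator_le {p r : ℝ} (hp : 0 < p) (hr : 0 ≤ r) (y : ℝ≥0∞) (K : ℕ) :
    ∑ k ∈ Finset.range K, ENNReal.ofReal ((r * 2 ^ k) ^ p) *
      {t : ℝ≥0∞ | ENNReal.ofReal (r * 2 ^ k) < t}.indicator 1 y ≤
      ENNReal.ofReal (1 - (2 : ℝ) ^ (-p))⁻¹ * y ^ p := by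
  induction K with
  | zero => simp
  | succ K ih =>
    by_cases h : ENNReal.ofReal (r * 2 ^ K) < y
    · calc _ ≤ ∑ k ∈ Finset.range (K + 1), ENNReal.ofReal ((r * 2 ^ k) ^ p) := by
            refine Finset.sum_le_sum fun k _ => mul_le_of_le_one_right (by positivity) ?_
            exact Set.indicator_apply_le fun _ => le_rfl
        _ = ENNReal.ofReal (∑ k ∈ Finset.range (K + 1), (r * 2 ^ k) ^ p) :=
            (ENNReal.ofReal_sum_of_nonneg fun k _ => by positivity).symm
        _ ≤ ENNReal.ofReal ((1 - (2 : ℝ) ^ (-p))⁻¹ * (r * 2 ^ K) ^ p) :=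
            ENNReal.ofReal_le_ofReal (sum_dyadic_le hp hr K)
        _ = ENNReal.ofReal (1 - (2 : ℝ) ^ (-p))⁻¹ * ENNReal.ofReal (r * 2 ^ K) ^ p := by
            rw [ENNReal.ofReal_mul' (by positivity),
              ENNReal.ofReal_rpow_of_nonneg (by positivity) hp.le]
        _ ≤ _ := by gcongr
    · rw [Finset.sum_range_succ, Set.indicator_of_notMem
        (show y ∉ {t : ℝ≥0∞ | ENNReal.ofReal (r * 2 ^ K) < t} from h), mul_zero, add_zero]
      exact ih

theorem exists_norm_le (hm : ∀ k, 2 ≤ m k) {f : ℕ → Group m → ℂ}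
    (hf : Martingale f (filtration m) (haar m)) (N : ℕ) :
    ∃ A : ℝ, ∀ n ≤ N, ∀ x, ‖f n x‖ ≤ A := by
  obtain ⟨R, hR⟩ := exists_representatives hm N
  refine ⟨∑ n ∈ Finset.range (N + 1), ∑ z ∈ R, ‖f n z‖, fun n hn x => ?_⟩
  obtain ⟨z, ⟨hz, hx⟩, -⟩ := hR x
  rw [Martingale.eq_of_mem hf hn hx]
  exact (Finset.single_le_sum (f := fun z => ‖f n z‖) (fun _ _ => norm_nonneg _) hz).trans
    (Finset.single_le_sum (f := fun n => ∑ z ∈ R, ‖f n z‖)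
      (fun _ _ => Finset.sum_nonneg fun _ _ => norm_nonneg _)
      (Finset.mem_range.mpr (Nat.lt_succ_of_le hn)))

/-- At level `0` the only interval is the whole group, so `f 0` is constant. This makes `r` an
admissible lowest stopping level. -/
theorem norm_zero_le_of_lintegral_le (hm : ∀ k, 2 ≤ m k) {f : ℕ → Group m → ℂ}
    (hf : Martingale f (filtration m) (haar m)) {p r : ℝ} (hp : 0 < p) (hr : 0 ≤ r)
    (hfr : ∫⁻ x, maximalFunction m f x ^ p ∂haar m ≤ ENNReal.ofReal (r ^ p)) (x : Group m) :
    ‖f 0 x‖ ≤ r := by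
  have hP := isProbabilityMeasure_haar m hm
  have h1 : ‖f 0 x‖ₑ ^ p ≤ ∫⁻ x, maximalFunction m f x ^ p ∂haar m := by
    calc ‖f 0 x‖ₑ ^ p = ∫⁻ _, ‖f 0 x‖ₑ ^ p ∂haar m := by simp
      _ ≤ _ := lintegral_mono fun y => ENNReal.rpow_le_rpow (by
          rw [← Martingale.eq_of_mem hf le_rfl (x := x) (y := y) fun i hi => absurd hi (by omega)]
          exact le_iSup (fun n => ‖f n y‖ₑ) 0) hp.le
  have h2 := h1.trans hfr
  rw [← ofReal_norm, ENNReal.ofReal_rpow_of_nonneg (norm_nonneg _) hp.le,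
    ENNReal.ofReal_le_ofReal_iff (by positivity)] at h2
  exact (Real.rpow_le_rpow_iff (norm_nonneg _) hr hp).mp h2

section

variable {p C D : ℝ} {q w : ℕ → ℝ}

/-- The difference is a sum of atoms of height `2Λ + Λ = 3Λ` on the stopping intervals, whose total
measure is controlled by `μ(f* > Λ)`; the atom estimates add up because `p ≤ 1`. -/
theorem exists_lintegral_meanMax_diff_le (hm : ∀ k, 2 ≤ m k) {B : ℕ} (hB : ∀ k, m k ≤ B)
    (hp : 0 < p) (hp1 : p ≤ 1) (hw : AdmissibleWeight m p w C) (hq : AdmissibleCoefficients q D) :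
    ∃ K : ℝ, 0 ≤ K ∧ ∀ f : ℕ → Group m → ℂ, Martingale f (filtration m) (haar m) →
      ∀ Λ : ℝ, (∀ x, ‖f 0 x‖ ≤ Λ) → ∀ N : ℕ,
      ∫⁻ x, meanMax m q w
        (fun t => stoppedPart m f (2 * Λ) N t - stoppedPart m f Λ N t) x ^ p ∂haar m ≤
      ENNReal.ofReal (K * Λ ^ p) * haar m {x | ENNReal.ofReal Λ < maximalFunction m f x} := by
  classical
  obtain ⟨K, hK, hatom⟩ := lintegral_meanMax_atom_le hm hB hp hw hq
  refine ⟨K * 3 ^ p * B, by positivity, fun f hf Λ h0 N => ?_⟩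
  have hΛ0 : 0 ≤ Λ := (norm_nonneg _).trans (h0 0)
  have hΛ : Λ ≤ 2 * Λ := by linarith
  choose R hR using exists_representatives (m := m) hm
  have hA := fun n (hn : n ∈ Finset.range N) =>
    isAtom_atomPart hm hf hΛ h0 (Finset.mem_range.mp hn)
  rw [show (fun t => stoppedPart m f (2 * Λ) N t - stoppedPart m f Λ N t) =
    fun t => ∑ n ∈ Finset.range N, (fun t => ∑ z ∈ R n, atomPart m f Λ (2 * Λ) N n z t) t from
    funext fun t => (sum_atomPart hR hΛ N t).symm]
  refine (lintegral_meanMax_finsetSum_le hm q w hp hp1 _ fun n hn =>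
    integrable_finsetSum _ fun z _ => (hA n hn z).integrable).trans ?_
  calc _ ≤ ∑ n ∈ Finset.range N, ∑ z ∈ R n, ENNReal.ofReal (K * (3 * Λ) ^ p) *
        (if FirstStopped m f Λ n z then haar m (interval m n z) else 0) := by
        refine Finset.sum_le_sum fun n hn => ?_
        refine (lintegral_meanMax_finsetSum_le hm q w hp hp1 _ fun z _ =>
          (hA n hn z).integrable).trans (Finset.sum_le_sum fun z _ => ?_)
        refine (hatom n z _ _ (hA n hn z)).trans ?_
        split_ifs
        · rw [show 2 * Λ + Λ = 3 * Λ by ring]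
        · rw [Real.zero_rpow hp.ne']; simp
    _ = ENNReal.ofReal (K * (3 * Λ) ^ p) * ∑ n ∈ Finset.range N, ∑ z ∈ R n,
        (if FirstStopped m f Λ n z then haar m (interval m n z) else 0) := by
        simp only [Finset.mul_sum]
    _ ≤ ENNReal.ofReal (K * (3 * Λ) ^ p) *
        (B * haar m {x | ENNReal.ofReal Λ < maximalFunction m f x}) := by
        gcongr
        exact sum_haar_interval_le hm hB hf hR hΛ0 N
    _ = _ := by
        rw [← mul_assoc, ← ENNReal.ofReal_natCast B, ← ENNReal.ofReal_mul (by positivity),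
          Real.mul_rpow (by norm_num) hΛ0]
        congr 2
        ring

/-- `f N` telescopes through the stopped martingales at levels `r 2^k`. The lowest one is bounded by
`r`; each difference costs a multiple of `(r 2^k)^p μ(f* > r 2^k)`, and these sum to a multiple of
`∫ (f*)^p`. -/
theorem exists_lintegral_meanMax_le (hm : ∀ k, 2 ≤ m k) {B : ℕ} (hB : ∀ k, m k ≤ B)
    (hp : 0 < p) (hp1 : p ≤ 1) (hw : AdmissibleWeight m p w C) (hq : AdmissibleCoefficients q D) :
    ∃ K : ℝ, 0 ≤ K ∧ ∀ f : ℕ → Group m → ℂ, Martingale f (filtration m) (haar m) →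
      ∀ r : ℝ, 0 < r → ∫⁻ x, maximalFunction m f x ^ p ∂haar m ≤ ENNReal.ofReal (r ^ p) →
      ∀ N : ℕ, ∫⁻ x, meanMax m q w (f N) x ^ p ∂haar m ≤ ENNReal.ofReal (K * r ^ p) := by
  have hP := isProbabilityMeasure_haar m hm
  obtain ⟨K, hK, hdiff⟩ := exists_lintegral_meanMax_diff_le hm hB hp hp1 hw hq
  set G := (1 - (2 : ℝ) ^ (-p))⁻¹ with hG
  have hG0 : 0 ≤ G := by
    have h2 : (2 : ℝ) ^ (-p) < 1 := Real.rpow_lt_one_of_one_lt_of_neg one_lt_two (by linarith)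
    exact inv_nonneg.mpr (by linarith)
  have hC := hw.one_le
  refine ⟨((1 + B) * C) ^ p + K * G, by positivity, fun f hf r hr hfr N => ?_⟩
  have h0 : ∀ k : ℕ, ∀ x, ‖f 0 x‖ ≤ r * 2 ^ k := fun k x =>
    (norm_zero_le_of_lintegral_le hm hf hp hr.le hfr x).trans
      (le_mul_of_one_le_right hr.le (one_le_pow₀ one_le_two))
  have hint : ∀ k : ℕ, Integrable (stoppedPart m f (r * 2 ^ k) N) (haar m) := fun k =>
    integrable_of_interval hm (n := N) (fun x y hy => stoppedPart_congr hf hy)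
      fun x => norm_stoppedPart_le (h0 k x) N
  obtain ⟨A, hA⟩ := exists_norm_le hm hf N
  -- Up to time `N` the martingale takes finitely many values, so level `r 2^L` is never exceeded
  -- and the telescoping sum is finite.
  obtain ⟨L, hL⟩ := pow_unbounded_of_one_lt (A / r) one_lt_two
  have hL' : A ≤ r * 2 ^ L := by rw [mul_comm]; exact ((div_lt_iff₀ hr).mp hL).le
  let h : ℕ → Group m → ℂ := fun k => Nat.casesOn k (stoppedPart m f (r * 2 ^ 0) N)
    fun k t => stoppedPart m f (2 * (r * 2 ^ k)) N t - stoppedPart m f (r * 2 ^ k) N t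
  have h2 : ∀ k : ℕ, 2 * (r * 2 ^ k) = r * 2 ^ (k + 1) := fun k => by ring
  have hsum : f N = fun t => ∑ k ∈ Finset.range (L + 1), h k t := by
    funext t
    rw [Finset.sum_range_succ']
    change f N t = (∑ k ∈ Finset.range L, (stoppedPart m f (2 * (r * 2 ^ k)) N t -
      stoppedPart m f (r * 2 ^ k) N t)) + stoppedPart m f (r * 2 ^ 0) N t
    simp only [h2]
    rw [Finset.sum_range_sub fun k => stoppedPart m f (r * 2 ^ k) N t, sub_add_cancel,
      stoppedPart_of_not_stopped]
    rintro j hj ⟨i, hi, y, _, hlt⟩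
    exact absurd ((hA (i + 1) (by omega) y).trans hL') (not_le.mpr hlt)
  have hhint : ∀ k ∈ Finset.range (L + 1), Integrable (h k) (haar m) := by
    intro k _
    cases k with
    | zero => exact hint 0
    | succ k =>
      simp only [h, h2]
      exact (hint (k + 1)).sub (hint k)
  rw [hsum]
  refine (lintegral_meanMax_finsetSum_le hm q w hp hp1 _ hhint).trans ?_
  rw [Finset.sum_range_succ', add_comm, add_mul, ENNReal.ofReal_add (by positivity)
    (by positivity)]
  refine add_le_add ?_ ?_
  · calc ∫⁻ x, meanMax m q w (h 0) x ^ p ∂haar m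
        ≤ ∫⁻ _, ENNReal.ofReal (((1 + B) * C) ^ p * r ^ p) ∂haar m := by
          refine lintegral_mono fun x => ofReal_rpow_le (E := r) hp (by positivity) hr.le
            (meanMax_le (fun n => hw.pos) fun n hn => ?_) le_rfl
          refine (norm_meanOp_le hm hB hw hq (A := r) (fun t => ?_) x hn).trans (le_of_eq (by ring))
          exact (norm_stoppedPart_le (h0 0 t) N).trans (by simp)
      _ = _ := by simp
  · calc _ ≤ ∑ k ∈ Finset.range L, ENNReal.ofReal (K * (r * 2 ^ k) ^ p) *
          haar m {x | ENNReal.ofReal (r * 2 ^ k) < maximalFunction m f x} :=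
          Finset.sum_le_sum fun k _ => hdiff f hf _ (h0 k) N
      _ = ENNReal.ofReal K * ∫⁻ x, ∑ k ∈ Finset.range L, ENNReal.ofReal ((r * 2 ^ k) ^ p) *
          {t : ℝ≥0∞ | ENNReal.ofReal (r * 2 ^ k) < t}.indicator 1 (maximalFunction m f x)
            ∂haar m := by
          have hmeas : ∀ k, Measurable fun x =>
              {t : ℝ≥0∞ | ENNReal.ofReal (r * 2 ^ k) < t}.indicator
                (1 : ℝ≥0∞ → ℝ≥0∞) (maximalFunction m f x) := fun k =>
            (measurable_one.indicator (measurableSet_lt measurable_const measurable_id)).comp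
              (measurable_maximalFunction hf)
          rw [lintegral_finsetSum _ fun k _ => (hmeas k).const_mul _, Finset.mul_sum]
          refine Finset.sum_congr rfl fun k _ => ?_
          rw [lintegral_const_mul _ (hmeas k), ENNReal.ofReal_mul hK, mul_assoc]
          congr 2
          rw [← lintegral_indicator_one (measurableSet_lt measurable_const
            (measurable_maximalFunction hf))]
          rfl
      _ ≤ ENNReal.ofReal K * ∫⁻ x, ENNReal.ofReal G * maximalFunction m f x ^ p ∂haar m := by
          gcongr with x
          exact sum_dyadic_indicator_le hp hr.le _ L
      _ ≤ ENNReal.ofReal K * (ENNReal.ofReal G * ENNReal.ofReal (r ^ p)) := by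
          rw [lintegral_const_mul _ ((measurable_maximalFunction hf).pow_const p)]
          gcongr
      _ = _ := by
          rw [← mul_assoc, ← ENNReal.ofReal_mul hK, ← ENNReal.ofReal_mul (by positivity)]

theorem eLpNorm_eq_lintegral (hp : 0 < p) (g : Group m → ℝ≥0∞) :
    eLpNorm g (ENNReal.ofReal p) (haar m) = (∫⁻ x, g x ^ p ∂haar m) ^ (1 / p) := by
  rw [eLpNorm_eq_lintegral_rpow_enorm_toReal (by simpa using hp) ENNReal.ofReal_ne_top,
    ENNReal.toReal_ofReal hp.le]
  rfl

theorem weightedMaximal_eq_iSup (hm : ∀ k, 2 ≤ m k) (f : ℕ → Group m → ℂ) (x : Group m) :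
    weightedMaximal m q w f x = ⨆ N : ℕ, ⨆ n : ℕ, ⨆ _ : 1 ≤ n ∧ n ≤ M m N,
      ‖tMean m q n f x‖ₑ / ENNReal.ofReal (w n) := by
  refine le_antisymm (iSup₂_le fun n hn => ?_) (iSup_le fun N => iSup₂_le fun n hn => ?_)
  · exact le_iSup_of_le n (le_iSup₂_of_le n ⟨hn, (lt_M m hm n).le⟩ le_rfl)
  · exact le_iSup₂_of_le n hn.1 le_rfl

/-- For `n ≤ M_N` the mean `T_n f` depends only on `f N`. The suprema over `n ≤ M_N` increase with
`N`, so monotone convergence removes the truncation. -/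
theorem lintegral_weightedMaximal_le (hm : ∀ k, 2 ≤ m k) (hp : 0 < p) {f : ℕ → Group m → ℂ}
    (hf : Martingale f (filtration m) (haar m)) {b : ℝ≥0∞}
    (hb : ∀ N, ∫⁻ x, meanMax m q w (f N) x ^ p ∂haar m ≤ b) :
    ∫⁻ x, weightedMaximal m q w f x ^ p ∂haar m ≤ b := by
  let g : ℕ → Group m → ℝ≥0∞ := fun N x => ⨆ n : ℕ, ⨆ _ : 1 ≤ n ∧ n ≤ M m N,
      ‖tMean m q n f x‖ₑ / ENNReal.ofReal (w n)
  have hmono : Monotone g := fun a b hab x => iSup₂_le fun n hn =>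
    le_iSup₂_of_le (f := fun n (_ : 1 ≤ n ∧ n ≤ M m b) =>
      ‖tMean m q n f x‖ₑ / ENNReal.ofReal (w n)) n ⟨hn.1, hn.2.trans (M_mono hm hab)⟩ le_rfl
  have hgm : ∀ N, Measurable (g N) := fun N => by
    refine Measurable.iSup fun n => Measurable.iSup fun _ => Measurable.div_const ?_ _
    refine Measurable.enorm (Measurable.const_mul ?_ _)
    refine Finset.measurable_fun_sum _ fun k _ => Measurable.const_mul ?_ _
    exact Finset.measurable_fun_sum _ fun i _ => (measurable_psi m i).const_mul _
  have hle : ∀ N x, g N x ≤ meanMax m q w (f N) x := fun N x => iSup₂_le fun n hn => by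
    rw [tMean_eq_meanOp hm q hf hn.2]
    exact le_iSup₂_of_le (f := fun n (_ : 1 ≤ n) =>
      ‖meanOp m q n (f N) x‖ₑ / ENNReal.ofReal (w n)) n hn.1 le_rfl
  have hsup : ∀ x, weightedMaximal m q w f x ^ p = ⨆ N, g N x ^ p := fun x => by
    rw [weightedMaximal_eq_iSup hm]
    exact (ENNReal.orderIsoRpow p hp).map_iSup _
  simp only [hsup]
  rw [lintegral_iSup (fun N => (hgm N).pow_const p) fun a b hab x =>
    ENNReal.rpow_le_rpow (hmono hab x) hp.le]
  exact iSup_le fun N => (lintegral_mono fun x =>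
    ENNReal.rpow_le_rpow (hle N x) hp.le).trans (hb N)

/-- The maximal inequality for `T` means. -/
theorem boundedHardyLp_of_admissible (hm : ∀ k, 2 ≤ m k) {B : ℕ} (hB : ∀ k, m k ≤ B)
    (hp : 0 < p) (hp1 : p ≤ 1) (hw : AdmissibleWeight m p w C) (hq : AdmissibleCoefficients q D) :
    BoundedHardyLp m p (weightedMaximal m q w) := by
  obtain ⟨K, hK, hmain⟩ := exists_lintegral_meanMax_le hm hB hp hp1 hw hq
  refine ⟨(K ^ (1 / p)).toNNReal, fun f hf => ?_⟩
  have hfin := hf.2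
  change _ ≤ ENNReal.ofReal _ * _
  -- The estimate is proved for `r` strictly above the Hardy norm and `r` then decreases to it; this
  -- keeps `r` positive when the norm is zero.
  have key : ∀ r : ℝ, hardyNorm m p f < ENNReal.ofReal r →
      eLpNorm (weightedMaximal m q w f) (ENNReal.ofReal p) (haar m) ≤
        ENNReal.ofReal (K ^ (1 / p)) * ENNReal.ofReal r := by
    intro r hr
    have hr0 : 0 < r := ENNReal.ofReal_pos.mp (bot_le.trans_lt hr)
    have h1 : ∫⁻ x, maximalFunction m f x ^ p ∂haar m ≤ ENNReal.ofReal (r ^ p) := by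
      rw [hardyNorm, eLpNorm_eq_lintegral hp] at hr
      rw [← ENNReal.ofReal_rpow_of_nonneg hr0.le hp.le]
      have := ENNReal.rpow_le_rpow hr.le hp.le
      rwa [← ENNReal.rpow_mul, one_div_mul_cancel hp.ne', ENNReal.rpow_one] at this
    have h2 := lintegral_weightedMaximal_le hm hp hf.1 (hmain f hf.1 r hr0 h1)
    rw [eLpNorm_eq_lintegral hp]
    refine (ENNReal.rpow_le_rpow h2 (by positivity)).trans (le_of_eq ?_)
    rw [ENNReal.ofReal_rpow_of_nonneg (by positivity) (by positivity),
      Real.mul_rpow hK (by positivity), ← Real.rpow_mul hr0.le, mul_one_div_cancel hp.ne',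
      Real.rpow_one, ENNReal.ofReal_mul (by positivity)]
  rw [← ENNReal.ofReal_toReal hfin.ne]
  have hlim : Tendsto (fun r : ℝ => ENNReal.ofReal (K ^ (1 / p)) * ENNReal.ofReal r)
      (𝓝[>] (hardyNorm m p f).toReal)
      (𝓝 (ENNReal.ofReal (K ^ (1 / p)) * ENNReal.ofReal (hardyNorm m p f).toReal)) :=
    (ENNReal.Tendsto.const_mul (ENNReal.tendsto_ofReal tendsto_id)
      (Or.inr ENNReal.ofReal_ne_top)).mono_left nhdsWithin_le_nhds
  refine ge_of_tendsto hlim ?_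
  filter_upwards [self_mem_nhdsWithin] with r hr
  exact key r ((ENNReal.lt_ofReal_iff_toReal_lt hfin.ne).mpr hr)

end

/-! ### Summation by parts and the two classes of coefficients. -/

theorem norm_sum_mul_le {q : ℕ → ℝ} {s : ℕ → ℂ} {E : ℝ}
    (hE : ∀ k, ‖∑ j ∈ Finset.range k, s j‖ ≤ E) (n : ℕ) :
    ‖∑ k ∈ Finset.range n, (q k : ℂ) * s k‖ ≤
      (|q (n - 1)| + ∑ i ∈ Finset.range (n - 1), |q (i + 1) - q i|) * E := by
  have h := Finset.sum_range_by_parts (fun i => (q i : ℂ)) s n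
  simp only [smul_eq_mul] at h
  rw [h, add_mul, Finset.sum_mul]
  refine (norm_sub_le _ _).trans (add_le_add ?_ (norm_sum_le_of_le _ fun i _ => ?_))
  · rw [norm_mul, Complex.norm_real, Real.norm_eq_abs]
    exact mul_le_mul_of_nonneg_left (hE n) (abs_nonneg _)
  · rw [norm_mul, ← Complex.ofReal_sub, Complex.norm_real, Real.norm_eq_abs]
    exact mul_le_mul_of_nonneg_left (hE _) (abs_nonneg _)

theorem norm_sum_mul_le_of_antitone {q : ℕ → ℝ} (hq0 : ∀ k, 0 ≤ q k) (hq : Antitone q) {s : ℕ → ℂ}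
    {E : ℝ} (hE : ∀ k, ‖∑ j ∈ Finset.range k, s j‖ ≤ E) (n : ℕ) :
    ‖∑ k ∈ Finset.range n, (q k : ℂ) * s k‖ ≤ q 0 * E := by
  refine (norm_sum_mul_le hE n).trans (le_of_eq ?_)
  rw [abs_of_nonneg (hq0 _), Finset.sum_congr rfl fun i _ => by
    rw [abs_sub_comm, abs_of_nonneg (sub_nonneg.mpr (hq (Nat.le_succ i)))],
    Finset.sum_range_sub' q, add_sub_cancel]

theorem norm_sum_mul_le_of_monotone {q : ℕ → ℝ} (hq0 : ∀ k, 0 ≤ q k) (hq : Monotone q) {s : ℕ → ℂ}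
    {E : ℝ} (hE : ∀ k, ‖∑ j ∈ Finset.range k, s j‖ ≤ E) (n : ℕ) :
    ‖∑ k ∈ Finset.range n, (q k : ℂ) * s k‖ ≤ 2 * q (n - 1) * E := by
  refine (norm_sum_mul_le hE n).trans (mul_le_mul_of_nonneg_right ?_ ((norm_nonneg _).trans (hE 0)))
  rw [abs_of_nonneg (hq0 _), Finset.sum_congr rfl fun i _ =>
    abs_of_nonneg (sub_nonneg.mpr (hq (Nat.le_succ i))), Finset.sum_range_sub q]
  have := hq0 0
  linarith

theorem Q_mono {q : ℕ → ℝ} (hq : ∀ k, 0 ≤ q k) : Monotone (Q q) := fun a b h =>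
  Finset.sum_le_sum_of_subset_of_nonneg (by simpa using h) fun i _ _ => hq i

/-- The vanishing of `s` up to `L` is essential: summation by parts over `[L, n)` costs only `q L`
rather than `q 0`, and `L q_L ≤ Q_L ≤ Q_n`. -/
theorem admissibleCoefficients_of_antitone {q : ℕ → ℝ} (hq0 : ∀ k, 0 ≤ q k) (hpos : 0 < q 0)
    (hq : Antitone q) : AdmissibleCoefficients q 1 := by
  refine ⟨hq0, hpos, le_rfl, fun n L s E hL hLn hs hE => ?_⟩
  have hL0 : (0 : ℝ) < L := by exact_mod_cast hL
  obtain ⟨r, rfl⟩ := Nat.exists_eq_add_of_le hLn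
  have hz : ∀ g : ℕ → ℂ, ∑ k ∈ Finset.range L, g k * s k = 0 := fun g =>
    Finset.sum_eq_zero fun k hk => by rw [hs k (Finset.mem_range.mp hk).le, mul_zero]
  rw [Finset.sum_range_add, hz, zero_add, one_mul]
  refine (norm_sum_mul_le_of_antitone (q := fun k => q (L + k)) (fun k => hq0 _)
    (fun a b h => hq (Nat.add_le_add_left h L)) (s := fun k => s (L + k)) (E := E) (fun k => ?_)
    r).trans ?_
  · have h1 := hE (L + k)
    have h2 := hz 1
    simp only [Pi.one_apply, one_mul] at h2
    rwa [Finset.sum_range_add, h2, zero_add] at h1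
  · refine mul_le_mul_of_nonneg_right ?_ ((norm_nonneg _).trans (hE 0))
    rw [le_div_iff₀ hL0]
    refine le_trans ?_ (Q_mono hq0 hLn)
    have := Finset.card_nsmul_le_sum (Finset.range L) q (q L) fun k hk =>
      hq (Finset.mem_range.mp hk).le
    simpa [mul_comm, Q] using this

/-- Summation by parts costs at most `2 q (n - 1)`, which the growth condition bounds by a multiple
of `Q_n / n ≤ Q_n / L`. -/
theorem admissibleCoefficients_of_monotone {q : ℕ → ℝ} (hq0 : ∀ k, 0 ≤ q k) (hpos : 0 < q 0)
    (hq : Monotone q)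
    (hO : (fun n : ℕ => q (n - 1) / Q q n) =O[atTop] fun n : ℕ => 1 / (n : ℝ)) :
    ∃ D, AdmissibleCoefficients q D := by
  obtain ⟨c, hc, hcn⟩ := bound_of_isBigO_nat_atTop hO
  refine ⟨1 + 2 * c, hq0, hpos, by linarith, fun n L s E hL hLn hs hE => ?_⟩
  have hL0 : (0 : ℝ) < L := by exact_mod_cast hL
  have hn : 1 ≤ n := hL.trans hLn
  have hn0 : (0 : ℝ) < n := by exact_mod_cast hn
  have hQ := Q_pos hq0 hpos hn
  have h1 := hcn (show 1 / (n : ℝ) ≠ 0 by positivity)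
  rw [Real.norm_of_nonneg (div_nonneg (hq0 _) hQ.le), Real.norm_of_nonneg (by positivity),
    div_le_iff₀ hQ] at h1
  refine (norm_sum_mul_le_of_monotone hq0 hq hE n).trans
    (mul_le_mul_of_nonneg_right ?_ ((norm_nonneg _).trans (hE 0)))
  calc 2 * q (n - 1) ≤ 2 * (c * (1 / n) * Q q n) := by gcongr
    _ = 2 * c * (Q q n / n) := by ring
    _ ≤ (1 + 2 * c) * (Q q n / L) := by
        have : (L : ℝ) ≤ n := by exact_mod_cast hLn
        gcongr
        linarith

/-! ### Admissibility of the weights. -/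

theorem weight_of_lt {p : ℝ} (hp : p < 1 / 2) (n : ℕ) :
    weight p n = ((n : ℝ) + 1) ^ (1 / p - 2) := by
  have : ⌊1 / 2 + p⌋₊ = 0 := Nat.floor_eq_zero.mpr (by linarith)
  rw [weight, this, mul_zero, pow_zero, mul_one]

theorem weight_half (n : ℕ) : weight (1 / 2) n = Real.log ((n : ℝ) + 1) ^ 2 := by
  rw [weight, show (1 : ℝ) / 2 + 1 / 2 = 1 by norm_num]
  simp

theorem log_two_mul_log_le {n : ℕ} (hn : 1 ≤ n) :
    Real.log 2 * Nat.log 2 n ≤ Real.log ((n : ℝ) + 1) := by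
  rw [mul_comm, ← Real.log_pow]
  refine Real.log_le_log (by positivity) ?_
  have := Nat.pow_log_le_self 2 (x := n) (by omega)
  exact_mod_cast this.trans (Nat.le_succ n)

theorem AdmissibleWeight.of_le {p C C' : ℝ} {w : ℕ → ℝ} (hm : ∀ k, 2 ≤ m k)
    (hw : ∀ n, 1 ≤ n → 0 < w n)
    (h1 : ∀ n, 1 ≤ n → 1 + (Nat.log 2 n : ℝ) ≤ C * w n)
    (h2 : ∀ a b, 1 ≤ a → a ≤ b → w a ≤ w b)
    (h3 : ∀ N, ∑ l ∈ Finset.range N, (M m (l + 1) : ℝ) ^ (2 * p - 1) ≤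
      C' * ((M m N : ℝ) ^ 2 * w (M m N)) ^ p / M m N) :
    AdmissibleWeight m p w (max 1 (max C C')) := by
  refine ⟨le_max_left _ _, fun n hn => (h1 n hn).trans ?_, h2, fun N => (h3 N).trans ?_⟩
  · have := hw n hn
    gcongr
    exact (le_max_left C C').trans (le_max_right _ _)
  · have := hw _ (M_pos hm N)
    gcongr
    exact (le_max_right C C').trans (le_max_right _ _)

/-- The exponent `2p - 1` is zero, so the sum equals `N`, while `(M_N² log²(M_N + 1))^{1/2} / M_N =
log(M_N + 1) ≥ N log 2`. For `log_le`, both `1` and `log₂ n` are at most `(log(n + 1) / log 2)²`,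
whence the `2`. -/
theorem exists_admissibleWeight_half (hm : ∀ k, 2 ≤ m k) :
    ∃ C, AdmissibleWeight m (1 / 2) (weight (1 / 2)) C := by
  have hl2 : 0 < Real.log 2 := Real.log_pos one_lt_two
  have hlog : ∀ n : ℕ, 1 ≤ n → Real.log 2 ≤ Real.log ((n : ℝ) + 1) := fun n hn =>
    Real.log_le_log two_pos (by have : (1 : ℝ) ≤ n := by exact_mod_cast hn
                                linarith)
  refine ⟨_, AdmissibleWeight.of_le (C := 2 / Real.log 2 ^ 2) (C' := 1 / Real.log 2) hm
    (fun n hn => ?_) (fun n hn => ?_) (fun a b ha hab => ?_) (fun N => ?_)⟩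
  · rw [weight_half]
    have := hl2.trans_le (hlog n hn)
    positivity
  · rw [weight_half, div_mul_eq_mul_div, le_div_iff₀ (by positivity)]
    have h1 := hlog n hn
    have h2 := log_two_mul_log_le hn
    have h4 : Real.log 2 * Real.log 2 ≤ Real.log ((n : ℝ) + 1) ^ 2 := by
      rw [sq]; exact mul_le_mul h1 h1 hl2.le (hl2.le.trans h1)
    have h5 : Real.log 2 * (Real.log 2 * Nat.log 2 n) ≤ Real.log ((n : ℝ) + 1) ^ 2 := by
      rw [sq]; exact mul_le_mul h1 h2 (by positivity) (hl2.le.trans h1)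
    nlinarith
  · rw [weight_half, weight_half]
    have h1 := hlog a ha
    have h2 : (0 : ℝ) < (a : ℝ) + 1 := by positivity
    have h3 : 0 ≤ Real.log ((a : ℝ) + 1) := hl2.le.trans h1
    gcongr
  · have hM : (0 : ℝ) < M m N := by exact_mod_cast M_pos hm N
    have h1 := hl2.le.trans (hlog _ (M_pos hm N))
    rw [weight_half, ← mul_pow, ← Real.sqrt_eq_rpow, Real.sqrt_sq (by positivity)]
    have h2 : (N : ℝ) * Real.log 2 ≤ Real.log ((M m N : ℝ) + 1) := by
      rw [← Real.log_pow]
      refine Real.log_le_log (by positivity) ?_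
      exact_mod_cast (two_pow_le_M hm N).trans (Nat.le_succ _)
    norm_num
    rw [mul_left_comm, mul_div_cancel_left₀ _ hM.ne', inv_mul_eq_div, le_div_iff₀ hl2]
    exact h2

/-- Now `2p - 1 < 0`, so the sum is dominated by a convergent geometric series, and the weight only
has to make the remaining quotient at least `1`. -/
theorem exists_admissibleWeight_of_lt (hm : ∀ k, 2 ≤ m k) {p : ℝ} (hp0 : 0 < p) (hp : p < 1 / 2) :
    ∃ C, AdmissibleWeight m p (weight p) C := by
  have hl2 : 0 < Real.log 2 := Real.log_pos one_lt_two
  set α := 1 / p - 2 with hα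
  have hα0 : 0 < α := by
    rw [hα, sub_pos, lt_div_iff₀ hp0]; linarith
  have hw := weight_of_lt hp
  have h1p : 0 < 1 - 2 * p := by linarith
  have hge : ∀ n : ℕ, 1 ≤ ((n : ℝ) + 1) ^ α := fun n =>
    Real.one_le_rpow (by have : (0 : ℝ) ≤ n := by positivity
                         linarith) hα0.le
  refine ⟨_, AdmissibleWeight.of_le (C := 1 + 1 / (α * Real.log 2))
    (C' := (1 - (2 : ℝ) ^ (-(1 - 2 * p)))⁻¹) hm
    (fun n hn => ?_) (fun n hn => ?_) (fun a b ha hab => ?_) (fun N => ?_)⟩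
  · rw [hw]; positivity
  · rw [hw, add_mul, one_mul]
    refine add_le_add (hge n) ?_
    rw [div_mul_eq_mul_div, one_mul, le_div_iff₀ (by positivity)]
    calc (Nat.log 2 n : ℝ) * (α * Real.log 2) = α * (Real.log 2 * Nat.log 2 n) := by ring
      _ ≤ α * Real.log ((n : ℝ) + 1) := by gcongr; exact log_two_mul_log_le hn
      _ = Real.log (((n : ℝ) + 1) ^ α) := (Real.log_rpow (by positivity) _).symm
      _ ≤ _ := (Real.log_le_sub_one_of_pos (by positivity)).trans (by linarith)
  · rw [hw, hw]
    gcongr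
  · have hM : ∀ k, (0 : ℝ) < M m k := fun k => by exact_mod_cast M_pos hm k
    have h2 : (2 : ℝ) ^ (-(1 - 2 * p)) < 1 :=
      Real.rpow_lt_one_of_one_lt_of_neg one_lt_two (by linarith)
    have h20 : 0 < (2 : ℝ) ^ (-(1 - 2 * p)) := by positivity
    calc _ ≤ ∑ l ∈ Finset.range N, ((2 : ℝ) ^ (-(1 - 2 * p))) ^ l := by
          refine Finset.sum_le_sum fun l _ => ?_
          rw [← Real.rpow_natCast, ← Real.rpow_mul zero_le_two, mul_comm _ (l : ℝ),
            Real.rpow_mul zero_le_two, Real.rpow_natCast, show 2 * p - 1 = -(1 - 2 * p) by ring]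
          refine Real.rpow_le_rpow_of_nonpos (by positivity) ?_ (by linarith)
          exact_mod_cast (two_pow_le_M hm l).trans (M_mono hm (Nat.le_succ l))
      _ ≤ (1 - (2 : ℝ) ^ (-(1 - 2 * p)))⁻¹ * 1 := by
          rw [mul_one, ← tsum_geometric_of_lt_one h20.le h2]
          exact (summable_geometric_of_lt_one h20.le h2).sum_le_tsum _ fun _ _ => by positivity
      _ ≤ _ := by
          rw [mul_div_assoc]
          refine mul_le_mul_of_nonneg_left ?_ (inv_nonneg.mpr (by linarith))
          rw [le_div_iff₀ (hM N), one_mul, hw]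
          -- The exponent `1/p - 2` is determined by `(2 + (1/p - 2)) p = 1`.
          have h3 : (M m N : ℝ) = ((M m N : ℝ) ^ 2 * (M m N : ℝ) ^ α) ^ p := by
            rw [← Real.rpow_natCast, ← Real.rpow_add (hM N), ← Real.rpow_mul (hM N).le, hα]
            have : (((2 : ℕ) : ℝ) + (1 / p - 2)) * p = 1 := by
              push_cast; field_simp; ring
            rw [this, Real.rpow_one]
          conv_lhs => rw [h3]
          have := hM N
          gcongr
          linarith

theorem exists_admissibleWeight (hm : ∀ k, 2 ≤ m k) {p : ℝ} (hp0 : 0 < p) (hp : p ≤ 1 / 2) :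
    ∃ C, AdmissibleWeight m p (weight p) C := by
  rcases hp.lt_or_eq with h | rfl
  · exact exists_admissibleWeight_of_lt hm hp0 h
  · exact exists_admissibleWeight_half hm

/-! ### Test martingales. -/

/-- The Rademacher function `r_N` restricted to the interval `I_N(0)`. -/
noncomputable def localRademacher (m : ℕ → ℕ) (N : ℕ) : Group m → ℂ :=
  (interval m N 0).indicator (rademacher m N)

/-- The martingale generated by `localRademacher`. -/
noncomputable def testMartingale (m : ℕ → ℕ) (N k : ℕ) : Group m → ℂ :=
  if k ≤ N then 0 else localRademacher m N

theorem localRademacher_congr {N k : ℕ} (hk : N < k) {x y : Group m} (h : y ∈ interval m k x) :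
    localRademacher m N y = localRademacher m N x := by
  have h1 : y ∈ interval m N 0 ↔ x ∈ interval m N 0 := by
    rw [mem_interval_comm, interval_eq (interval_anti hk.le x h), mem_interval_comm]
  have h2 : rademacher m N y = rademacher m N x := by simp only [rademacher, h N hk]
  by_cases hx : x ∈ interval m N 0
  · rw [localRademacher, Set.indicator_of_mem (h1.mpr hx), Set.indicator_of_mem hx, h2]
  · rw [localRademacher, Set.indicator_of_notMem (fun h => hx (h1.mp h)),
      Set.indicator_of_notMem hx]

theorem norm_localRademacher (hm : ∀ k, 2 ≤ m k) (N : ℕ) (x : Group m) :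
    ‖localRademacher m N x‖ = (interval m N 0).indicator 1 x := by
  by_cases hx : x ∈ interval m N 0
  · rw [localRademacher, Set.indicator_of_mem hx, Set.indicator_of_mem hx, norm_rademacher hm]
    rfl
  · rw [localRademacher, Set.indicator_of_notMem hx, Set.indicator_of_notMem hx, norm_zero]

theorem integrable_localRademacher (hm : ∀ k, 2 ≤ m k) (N : ℕ) :
    Integrable (localRademacher m N) (haar m) :=
  integrable_of_interval hm (n := N + 1) (fun _ _ h => localRademacher_congr (Nat.lt_succ_self N) h)
    (A := 1) fun x => by
      rw [norm_localRademacher hm]; exact Set.indicator_apply_le' (fun _ => le_rfl) fun _ => zero_le_one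

/-- On the `m N` children of `I_N(0)`, of equal measure, the function takes the values of a
nontrivial additive character, which sum to zero. -/
theorem integral_localRademacher (hm : ∀ k, 2 ≤ m k) (N : ℕ) :
    ∫ x, localRademacher m N x ∂haar m = 0 := by
  have hP := isProbabilityMeasure_haar m hm
  have hne : NeZero (m N) := ⟨by have := hm N; omega⟩
  have hfact : Fact (1 < m N) := ⟨hm N⟩
  have h1 : localRademacher m N = fun x => ∑ d : ZMod (m N),
      (interval m (N + 1) (Pi.single N d)).indicator (fun _ => ZMod.stdAddChar d) x := by
    funext x
    by_cases hx : x ∈ interval m N 0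
    · rw [localRademacher, Set.indicator_of_mem hx, Finset.sum_eq_single (x N)]
      · rw [Set.indicator_of_mem, ZMod.stdAddChar_apply, rademacher_eq hm]
        intro i hi
        rcases (Nat.lt_succ_iff.mp hi).lt_or_eq with h | rfl
        · rw [hx i h, Pi.single_eq_of_ne h.ne]; rfl
        · simp
      · intro d _ hd
        refine Set.indicator_of_notMem (fun h => hd ?_) _
        have := h N (Nat.lt_succ_self N)
        rwa [Pi.single_eq_same, eq_comm] at this
      · simp
    · rw [localRademacher, Set.indicator_of_notMem hx, Finset.sum_eq_zero]
      intro d _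
      refine Set.indicator_of_notMem (fun h => hx fun i hi => ?_) _
      rw [h i (hi.trans (Nat.lt_succ_self N)), Pi.single_eq_of_ne hi.ne]; rfl
  rw [h1, integral_finsetSum _ fun d _ =>
    (integrable_const _).indicator (measurableSet_interval _ _)]
  simp only [integral_indicator_const _ (measurableSet_interval _ _), haar_real_interval hm,
    ← Finset.smul_sum]
  rw [AddChar.sum_eq_zero_of_ne_one, smul_zero]
  intro h
  refine one_ne_zero (α := ZMod (m N)) (ZMod.injective_stdAddChar ?_)
  rw [h]; rfl

theorem integral_localRademacher_interval (hm : ∀ k, 2 ≤ m k) (N : ℕ) (z : Group m) :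
    ∫ x in interval m N z, localRademacher m N x ∂haar m = 0 := by
  by_cases hz : z ∈ interval m N 0
  · rw [interval_eq hz, ← integral_localRademacher hm N]
    exact setIntegral_eq_integral_of_forall_compl_eq_zero fun x hx =>
      Set.indicator_of_notMem hx _
  · refine setIntegral_eq_zero_of_forall_eq_zero fun x hx =>
      Set.indicator_of_notMem (fun h => hz ?_) _
    rw [mem_interval_comm, ← interval_eq hx, mem_interval_comm]
    exact h

/-- Only the step from `N` to `N + 1` is nontrivial; there the mean of the new increment over every
interval of level `N` is zero. -/
theorem martingale_testMartingale (hm : ∀ k, 2 ≤ m k) (N : ℕ) :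
    Martingale (testMartingale m N) (filtration m) (haar m) := by
  have hP := isProbabilityMeasure_haar m hm
  have hint : ∀ k, Integrable (testMartingale m N k) (haar m) := fun k => by
    unfold testMartingale
    split_ifs
    · exact integrable_zero _ _ _
    · exact integrable_localRademacher hm N
  refine martingale_of_setIntegral_eq_succ (fun k => ?_) hint fun k S hS => ?_
  · unfold testMartingale
    split_ifs with h
    · exact stronglyMeasurable_zero
    · exact stronglyMeasurable_of_interval hm fun x y hy => localRademacher_congr (not_le.mp h) hy
  · by_cases hk : k = N
    · subst hk
      have hS' : MeasurableSet S := (filtration m).le k _ hS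
      obtain ⟨t, -, rfl⟩ := hS
      have h : ∫ x, localRademacher m k x * (trunc m k ⁻¹' t).indicator 1 x ∂haar m = 0 := by
        refine (integral_mul_eq hm (n := k) (integrable_localRademacher hm k)
          (integrable_zero (Group m) ℂ (haar m)) (fun x y hy => ?_) fun z => ?_).trans (by simp)
        · have : trunc m k y = trunc m k x := funext fun i => hy i i.2
          by_cases hx : trunc m k x ∈ t
          · rw [Set.indicator_of_mem (show x ∈ trunc m k ⁻¹' t from hx), Set.indicator_of_mem
              (show y ∈ trunc m k ⁻¹' t from (congrArg (· ∈ t) this).mpr hx)]; rfl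
          · rw [Set.indicator_of_notMem (show x ∉ trunc m k ⁻¹' t from hx),
              Set.indicator_of_notMem
                (show y ∉ trunc m k ⁻¹' t from fun h => hx ((congrArg (· ∈ t) this).mp h))]
        · rw [integral_localRademacher_interval hm]; simp
      rw [testMartingale, if_pos le_rfl, testMartingale, if_neg (by omega),
        ← integral_indicator hS' (f := localRademacher m k)]
      refine (integral_zero _ _).trans (h.symm.trans ?_)
      refine integral_congr_ae (Eventually.of_forall fun x => ?_)
      by_cases hx : x ∈ trunc m k ⁻¹' t <;> simp [hx]
    · have : testMartingale m N (k + 1) = testMartingale m N k := by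
        unfold testMartingale
        split_ifs <;> first | rfl | omega
      rw [this]

theorem maximalFunction_testMartingale (hm : ∀ k, 2 ≤ m k) (N : ℕ) (x : Group m) :
    maximalFunction m (testMartingale m N) x = (interval m N 0).indicator 1 x := by
  have h1 : ‖localRademacher m N x‖ₑ = (interval m N 0).indicator (1 : Group m → ℝ≥0∞) x := by
    rw [← ofReal_norm, norm_localRademacher hm]
    by_cases hx : x ∈ interval m N 0 <;> simp [hx]
  refine le_antisymm (iSup_le fun k => ?_) ?_
  · unfold testMartingale
    split_ifs
    · simp
    · exact h1.le
  · refine le_iSup_of_le (N + 1) ?_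
    rw [testMartingale, if_neg (by omega), h1]

theorem hardyNorm_testMartingale (hm : ∀ k, 2 ≤ m k) {p : ℝ} (hp : 0 < p) (N : ℕ) :
    hardyNorm m p (testMartingale m N) = ENNReal.ofReal ((M m N : ℝ)⁻¹ ^ (1 / p)) := by
  have hM : (0 : ℝ) < M m N := by exact_mod_cast M_pos hm N
  rw [hardyNorm, eLpNorm_eq_lintegral hp]
  have : ∀ x, maximalFunction m (testMartingale m N) x ^ p = (interval m N 0).indicator 1 x := by
    intro x
    rw [maximalFunction_testMartingale hm]
    by_cases hx : x ∈ interval m N 0 <;> simp [hx, hp]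
  simp only [this]
  rw [lintegral_indicator_one (measurableSet_interval N 0), haar_interval hm,
    ← ENNReal.ofReal_rpow_of_nonneg (by positivity) (by positivity), ENNReal.ofReal_inv_of_pos hM,
    ENNReal.ofReal_natCast]

theorem memHardy_testMartingale (hm : ∀ k, 2 ≤ m k) {p : ℝ} (hp : 0 < p) (N : ℕ) :
    MemHardy m p (testMartingale m N) :=
  ⟨martingale_testMartingale hm N, by
    rw [hardyNorm_testMartingale hm hp]; exact ENNReal.ofReal_lt_top⟩

theorem hardyNorm_testMartingale_ne_zero (hm : ∀ k, 2 ≤ m k) {p : ℝ} (hp : 0 < p) (N : ℕ) :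
    hardyNorm m p (testMartingale m N) ≠ 0 := by
  have hM : (0 : ℝ) < M m N := by exact_mod_cast M_pos hm N
  rw [hardyNorm_testMartingale hm hp]
  exact (ENNReal.ofReal_pos.mpr (by positivity)).ne'

theorem partialSum_testMartingale_of_le (hm : ∀ k, 2 ≤ m k) {N j : ℕ} (hj : j ≤ M m N)
    (x : Group m) : partialSum m j (testMartingale m N) x = 0 := by
  rw [partialSum_eq_partialOp hm (martingale_testMartingale hm N) hj, testMartingale,
    if_pos le_rfl]
  simp [partialOp]

/-- For `t` in `I_N(0)` the kernel at `x - t` is `D_{M_N}(x) + ψ_{M_N}(x) conj(r_N(t)) D_b(x)`. The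
first term integrates to zero against `r_N`; in the second `r_N conj(r_N) = 1`, leaving the measure
`1 / M_N`. -/
theorem partialSum_testMartingale (hm : ∀ k, 2 ≤ m k) {N b : ℕ} (hb : b ≤ M m N)
    (x : Group m) : partialSum m (M m N + b) (testMartingale m N) x =
      (M m N : ℂ)⁻¹ * (psi m (M m N) x * dirichlet m b x) := by
  have hP := isProbabilityMeasure_haar m hm
  have hj : M m N + b ≤ M m (N + 1) := by have := two_mul_M_le hm N; omega
  have hpsi : ∀ t, psi m (M m N) t = rademacher m N t := fun t => by
    have := psi_mul_M hm (k := N) (r := 1) (hm N) t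
    rwa [one_mul, pow_one] at this
  rw [partialSum_eq_partialOp hm (martingale_testMartingale hm N) hj, testMartingale,
    if_neg (by omega), partialOp]
  have key : ∀ t, localRademacher m N t * dirichlet m (M m N + b) (x - t) =
      localRademacher m N t * dirichlet m (M m N) x +
      (interval m N 0).indicator (fun _ => psi m (M m N) x * dirichlet m b x) t := by
    intro t
    by_cases ht : t ∈ interval m N 0
    · have hD : ∀ j ≤ M m N, dirichlet m j (x - t) = dirichlet m j x := fun j hj =>
        Finset.sum_congr rfl fun i hi => psi_congr hm ((Finset.mem_range.mp hi).trans_le hj)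
          fun k hk => by rw [Pi.sub_apply, ht k hk]; simp
      have h1 := dirichlet_mul_add hm 1 hb (x - t)
      rw [one_mul, hD _ le_rfl, hD _ hb, psi_sub hm] at h1
      have h2 : psi m (M m N) t * (starRingEnd ℂ) (psi m (M m N) t) = 1 := by
        rw [Complex.mul_conj, Complex.normSq_eq_norm_sq, norm_psi hm]; simp
      rw [h1, localRademacher, Set.indicator_of_mem ht, Set.indicator_of_mem ht, mul_add, ← hpsi]
      linear_combination (psi m (M m N) x * dirichlet m b x) * h2
    · rw [localRademacher, Set.indicator_of_notMem ht, Set.indicator_of_notMem ht]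
      simp
  simp only [key]
  rw [integral_add ((integrable_localRademacher hm N).mul_const _)
    ((integrable_const _).indicator (measurableSet_interval N 0)), integral_mul_const,
    integral_localRademacher hm, zero_mul, zero_add,
    integral_indicator_const _ (measurableSet_interval N 0), haar_real_interval hm]
  simp

theorem fejerMean_testMartingale (hm : ∀ k, 2 ≤ m k) {N b : ℕ} (hb : b ≤ M m N)
    (x : Group m) : fejerMean m (M m N + b) (testMartingale m N) x =
      ((M m N + b : ℕ) : ℂ)⁻¹ * ((M m N : ℂ)⁻¹ * (psi m (M m N) x * fejer m b x)) := by
  rw [fejerMean_eq, Finset.sum_range_add, Finset.sum_eq_zero fun j hj =>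
    partialSum_testMartingale_of_le hm (Finset.mem_range.mp hj).le x, zero_add,
    Finset.sum_congr rfl fun j hj =>
      partialSum_testMartingale hm ((Finset.mem_range.mp hj).le.trans hb) x, fejer]
  simp only [Finset.mul_sum]

theorem norm_fejerMean_testMartingale (hm : ∀ k, 2 ≤ m k) {N b : ℕ} (hb : b ≤ M m N)
    {c : ℝ} (hc : 0 < c) (x : Group m) :
    ‖fejerMean m (M m N + b) (testMartingale m N) x / (c : ℂ)‖ =
      ‖fejer m b x‖ / (((M m N + b : ℕ) : ℝ) * M m N * c) := by
  rw [fejerMean_testMartingale hm hb, norm_div, norm_mul, norm_mul, norm_mul, norm_inv, norm_inv,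
    norm_psi hm, Complex.norm_natCast, Complex.norm_natCast, Complex.norm_of_nonneg hc.le, one_mul]
  have hM : (0 : ℝ) < M m N := by exact_mod_cast M_pos hm N
  have : (0 : ℝ) < (M m N + b : ℕ) := by push_cast; positivity
  field_simp

/-! ### Lower bounds for the Fejér kernel. -/

/-- The number with digits `1` exactly at the even positions below `2K`. -/
def evenDigits (m : ℕ → ℕ) (K : ℕ) : ℕ := ∑ i ∈ Finset.range K, M m (2 * i)

theorem evenDigits_le (hm : ∀ k, 2 ≤ m k) (K : ℕ) : evenDigits m K ≤ M m (2 * K) := by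
  induction K with
  | zero => simp [evenDigits]
  | succ K ih =>
    rw [evenDigits, Finset.sum_range_succ, ← evenDigits]
    have h1 := two_mul_M_le hm (2 * K)
    have h2 := M_mono hm (show 2 * K + 1 ≤ 2 * (K + 1) by omega)
    omega

theorem exists_evenDigits_add (t k : ℕ) :
    ∃ c, evenDigits m (t + k) = c * M m (2 * t) + evenDigits m t := by
  induction k with
  | zero => exact ⟨0, by simp⟩
  | succ k ih =>
    obtain ⟨c, hc⟩ := ih
    obtain ⟨d, hd⟩ := M_dvd (m := m) (show 2 * t ≤ 2 * (t + k) by omega)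
    refine ⟨c + d, ?_⟩
    rw [← add_assoc, evenDigits, Finset.sum_range_succ, ← evenDigits, hc, hd]
    ring

/-- The kernel equals `∑_{j<M_s} j + b M_s + ψ ∑_{j<b} j` with `|ψ| = 1`. The last term is at most
`b M_s` in modulus, so the first survives; `s ≥ 1` gives `M_s ≥ 2`, hence `M_s (M_s - 1) / 2 ≥ M_s²
/ 4`. -/
theorem le_norm_fejer_add (hm : ∀ k, 2 ≤ m k) {s b : ℕ} (hs : 1 ≤ s) (hb : b ≤ M m s)
    {u : Group m} (hu : ∀ i < s, u i = 0) :
    (M m s : ℝ) ^ 2 / 4 ≤ ‖fejer m (M m s + b) u‖ := by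
  have hD : ∀ j ≤ M m s, dirichlet m j u = j := fun j hj => dirichlet_eq_natCast hm hj hu
  have h1 : fejer m (M m s + b) u = ((∑ j ∈ Finset.range (M m s), j : ℕ) : ℂ) +
      (b : ℂ) * M m s + psi m (M m s) u * ((∑ j ∈ Finset.range b, j : ℕ) : ℂ) := by
    rw [fejer, Finset.sum_range_add, Finset.sum_congr rfl fun j hj =>
      hD j (Finset.mem_range.mp hj).le, ← Nat.cast_sum, add_assoc]
    congr 1
    have h2 : ∀ j ∈ Finset.range b,
        dirichlet m (M m s + j) u = M m s + psi m (M m s) u * j := fun j hj => by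
      have hjb := (Finset.mem_range.mp hj).le.trans hb
      have := dirichlet_mul_add hm 1 hjb u
      rwa [one_mul, hD _ le_rfl, hD _ hjb] at this
    rw [Finset.sum_congr rfl h2, Finset.sum_add_distrib, ← Finset.mul_sum]
    simp
  have hX : (M m s : ℝ) ^ 2 / 4 ≤ ((∑ j ∈ Finset.range (M m s), j : ℕ) : ℝ) := by
    have h2 := Finset.sum_range_id_mul_two (M m s)
    have h3 : 2 ≤ M m s := by
      have := two_pow_le_M hm s
      have := Nat.pow_le_pow_right (n := 2) (by norm_num) hs
      omega
    have h4 : ((∑ j ∈ Finset.range (M m s), j : ℕ) : ℝ) * 2 = M m s * ((M m s : ℝ) - 1) := by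
      rw [← Nat.cast_pred (by omega)]
      exact_mod_cast h2
    have h5 : (2 : ℝ) ≤ M m s := by exact_mod_cast h3
    nlinarith
  have hY : ((∑ j ∈ Finset.range b, j : ℕ) : ℝ) ≤ b * M m s := by
    have : ∑ j ∈ Finset.range b, j ≤ b * M m s := by
      simpa using Finset.sum_le_card_nsmul (Finset.range b) (fun j => j) (M m s) fun j hj =>
        (Finset.mem_range.mp hj).le.trans hb
    exact_mod_cast this
  set X := ∑ j ∈ Finset.range (M m s), j
  set Y := ∑ j ∈ Finset.range b, j
  have h3 := norm_sub_norm_le ((X : ℂ) + b * M m s) (-(psi m (M m s) u * Y))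
  rw [sub_neg_eq_add, ← h1, norm_neg, norm_mul, norm_psi hm, one_mul, Complex.norm_natCast] at h3
  have h4 : ‖(X : ℂ) + b * M m s‖ = X + b * M m s := by
    rw [← Nat.cast_mul, ← Nat.cast_add, Complex.norm_natCast]; push_cast; rfl
  rw [h4] at h3
  linarith

/-- The nonzero coordinates `2t` and `2t + 1` remove all digits from position `2t + 2` on. The digit
at `2t + 1` is zero, so the remaining order is `M_{2t}` plus a number at most `M_{2t}`. Taking every
second position makes one number work for all `t`. -/
theorem le_norm_fejer_evenDigits (hm : ∀ k, 2 ≤ m k) {t K : ℕ} (ht : 1 ≤ t) (htK : t < K)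
    {u : Group m} (hu : ∀ i < 2 * t, u i = 0) (h0 : u (2 * t) ≠ 0) (h1 : u (2 * t + 1) ≠ 0) :
    (M m (2 * t) : ℝ) ^ 2 / 4 ≤ ‖fejer m (evenDigits m K) u‖ := by
  obtain ⟨k, rfl⟩ := Nat.exists_eq_add_of_le (show t + 1 ≤ K from htK)
  obtain ⟨c, hc⟩ := exists_evenDigits_add (m := m) (t + 1) k
  rw [hc, show 2 * (t + 1) = 2 * t + 1 + 1 by ring,
    fejer_reduce hm (Nat.lt_succ_self (2 * t)) h0 h1 c (evenDigits_le hm (t + 1)), norm_mul,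
    norm_psi hm, one_mul, evenDigits, Finset.sum_range_succ, ← evenDigits, add_comm]
  exact le_norm_fejer_add hm (by omega) (evenDigits_le hm t) hu

/-- On disjoint sets of measure at least `1 / (4 M_s)`, with `s` even and positive, the integrand is
at least `M_s / 2`; each gives `1/8`. Level `0` is excluded by the requirement `M_s ≥ 2`, hence the
shift to `K + 1`. -/
theorem le_lintegral_fejer_evenDigits (hm : ∀ k, 2 ≤ m k) (K : ℕ) :
    ENNReal.ofReal (K / 8) ≤
      ∫⁻ u, ‖fejer m (evenDigits m (K + 1)) u‖ₑ ^ (1 / 2 : ℝ) ∂haar m := by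
  let U : ℕ → Set (Group m) := fun s => {u | (∀ i < s, u i = 0) ∧ u s ≠ 0 ∧ u (s + 1) ≠ 0}
  have hUm : ∀ s, MeasurableSet (U s) := fun s =>
    measurableSet_of_interval_subset hm (n := s + 2) fun x hx y hy =>
      ⟨fun i hi => (hy i (by omega)).trans (hx.1 i hi), by rw [hy s (by omega)]; exact hx.2.1,
        by rw [hy (s + 1) (by omega)]; exact hx.2.2⟩
  have hdisj : ∀ u s s', u ∈ U s → u ∈ U s' → s = s' := by
    intro u s s' h h'
    rcases lt_trichotomy s s' with hlt | hlt | hlt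
    · exact absurd (h'.1 s hlt) h.2.1
    · exact hlt
    · exact absurd (h.1 s' hlt) h'.2.1
  have hM : ∀ s, (0 : ℝ) < M m s := fun s => by exact_mod_cast M_pos hm s
  calc ENNReal.ofReal (K / 8) = ∑ t ∈ Finset.range K, ENNReal.ofReal (1 / 8) := by
        rw [Finset.sum_const, Finset.card_range, nsmul_eq_mul, ← ENNReal.ofReal_natCast,
          ← ENNReal.ofReal_mul (by positivity)]
        congr 1; ring
    _ ≤ ∑ t ∈ Finset.range K,
        ENNReal.ofReal (M m (2 * (t + 1)) / 2) * haar m (U (2 * (t + 1))) := by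
        refine Finset.sum_le_sum fun t _ => ?_
        refine le_trans (le_of_eq ?_) (mul_le_mul_right (le_haar_two_ne_zero hm _) _)
        rw [show (4 * M m (2 * (t + 1)) : ℝ≥0∞) = ENNReal.ofReal (4 * M m (2 * (t + 1))) by
          rw [ENNReal.ofReal_mul (by norm_num)]; simp, ← ENNReal.ofReal_inv_of_pos
          (mul_pos (by norm_num) (hM _)), ← ENNReal.ofReal_mul (by positivity)]
        congr 1
        have := hM (2 * (t + 1))
        field_simp
        norm_num
    _ = ∫⁻ u, ∑ t ∈ Finset.range K, (U (2 * (t + 1))).indicator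
          (fun _ => ENNReal.ofReal (M m (2 * (t + 1)) / 2)) u ∂haar m := by
        rw [lintegral_finsetSum _ fun t _ => measurable_const.indicator (hUm _)]
        exact Finset.sum_congr rfl fun t _ => (lintegral_indicator_const (hUm _) _).symm
    _ ≤ _ := by
        refine lintegral_mono fun u => ?_
        by_cases h : ∃ t < K, u ∈ U (2 * (t + 1))
        · obtain ⟨t, ht, hu⟩ := h
          rw [Finset.sum_eq_single_of_mem t (Finset.mem_range.mpr ht), Set.indicator_of_mem hu]
          · rw [← ofReal_norm, ENNReal.ofReal_rpow_of_nonneg (norm_nonneg _) (by norm_num)]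
            refine ENNReal.ofReal_le_ofReal ?_
            have h1 := le_norm_fejer_evenDigits hm (t := t + 1) (K := K + 1) (by omega) (by omega)
              hu.1 hu.2.1 hu.2.2
            rw [← Real.sqrt_eq_rpow]
            refine Real.le_sqrt_of_sq_le ?_
            rw [div_pow]
            norm_num
            exact h1
          · intro s _ hs
            refine Set.indicator_of_notMem (fun h => hs ?_) _
            have := hdisj u _ _ h hu
            omega
        · rw [Finset.sum_eq_zero]
          · positivity
          · intro s hs
            exact Set.indicator_of_notMem (fun hu => h ⟨s, Finset.mem_range.mp hs, hu⟩) _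

theorem fejer_two (u : Group m) : fejer m 2 u = 1 := by
  simp [fejer, dirichlet, Finset.sum_range_succ, psi_zero]

/-! ### Sharpness of the weights. -/

theorem exists_weight_gt {w Φ : ℕ → ℝ} (hΦ : ∀ n, 0 < Φ n)
    (h : limsup (fun n : ℕ => ((w n / Φ n : ℝ) : EReal)) atTop = ⊤) (C : ℝ) (L : ℕ) :
    ∃ n, L ≤ n ∧ C * Φ n < w n := by
  have h1 : ((C : ℝ) : EReal) < limsup (fun n : ℕ => ((w n / Φ n : ℝ) : EReal)) atTop := by
    rw [h]; exact EReal.coe_lt_top C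
  obtain ⟨n, hn, hlt⟩ := (frequently_atTop.mp (frequently_lt_of_lt_limsup (by isBoundedDefault) h1)) L
  exact ⟨n, hn, (lt_div_iff₀ (hΦ n)).mp (EReal.coe_lt_coe_iff.mp hlt)⟩

/-- The factor `2` ensures `M_N + b ≤ 2 M_N ≤ n` for `b ≤ M_N`, so monotonicity of `Φ` applies,
while `n` stays comparable to `M_N`. -/
theorem exists_level (hm : ∀ k, 2 ≤ m k) {n L : ℕ} (hn : 2 * M m L ≤ n) :
    ∃ N, L ≤ N ∧ 2 * M m N ≤ n ∧ n < 2 * M m (N + 1) := by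
  classical
  have hex : ∃ K, n < 2 * M m K := ⟨n, by have := lt_M m hm n; omega⟩
  have hspec := Nat.find_spec hex
  have hL : L < Nat.find hex := by
    by_contra hcon
    have := M_mono hm (not_lt.mp hcon)
    omega
  obtain ⟨N, hN⟩ := Nat.exists_eq_succ_of_ne_zero (n := Nat.find hex) (by omega)
  rw [hN] at hspec
  refine ⟨N, by omega, ?_, hspec⟩
  exact not_lt.mp (Nat.find_min hex (by omega))

theorem weakNorm_le_eLpNorm {p : ℝ} (hp : 0 < p) {g : Group m → ℂ} (hg : Measurable g) :
    weakNorm m p g ≤ eLpNorm g (ENNReal.ofReal p) (haar m) := by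
  refine iSup_le fun t => ?_
  have h := mul_meas_ge_le_pow_eLpNorm' (p := ENNReal.ofReal p) (haar m) (by simpa using hp)
    ENNReal.ofReal_ne_top hg.aestronglyMeasurable (t : ℝ≥0∞)
  rw [ENNReal.toReal_ofReal hp.le] at h
  have h1 := ENNReal.rpow_le_rpow h (show 0 ≤ 1 / p by positivity)
  rw [ENNReal.mul_rpow_of_nonneg _ _ (by positivity), ← ENNReal.rpow_mul, ← ENNReal.rpow_mul,
    mul_one_div_cancel hp.ne', ENNReal.rpow_one, ENNReal.rpow_one] at h1
  refine le_trans (mul_le_mul_right (ENNReal.rpow_le_rpow (measure_mono fun x hx => ?_)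
    (by positivity)) _) h1
  exact le_of_lt (show (t : ℝ≥0∞) < ‖g x‖ₑ from hx)

theorem measurable_fejerMean (n : ℕ) (f : ℕ → Group m → ℂ) : Measurable (fejerMean m n f) := by
  refine Measurable.const_mul ?_ _
  refine Finset.measurable_fun_sum _ fun k _ => Measurable.const_mul ?_ _
  exact Finset.measurable_fun_sum _ fun i _ => (measurable_psi m i).const_mul _

theorem eLpNorm_fejerMean_le {Φ : ℕ → ℝ} (hΦ : ∀ n, 0 < Φ n) (p : ℝ) {n : ℕ} (hn : 1 ≤ n)
    (f : ℕ → Group m → ℂ) :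
    eLpNorm (fun x => fejerMean m n f x / (Φ n : ℂ)) (ENNReal.ofReal p) (haar m) ≤
      eLpNorm (weightedMaximal m (fun _ => 1) Φ f) (ENNReal.ofReal p) (haar m) := by
  refine eLpNorm_mono_enorm fun x => ?_
  change _ ≤ weightedMaximal m (fun _ => 1) Φ f x
  refine le_iSup₂_of_le (f := fun n (_ : 1 ≤ n) =>
    ‖tMean m (fun _ => 1) n f x‖ₑ / ENNReal.ofReal (Φ n)) n hn (le_of_eq ?_)
  rw [← ofReal_norm, ← ofReal_norm, norm_div, Complex.norm_of_nonneg (hΦ n).le,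
    ENNReal.ofReal_div_of_pos (hΦ n)]
  rfl

theorem le_weakNorm_of_norm_eq (hm : ∀ k, 2 ≤ m k) {p : ℝ} {g : Group m → ℂ} {c : ℝ}
    (hg : ∀ x, ‖g x‖ = c) {t : ℝ} (ht0 : 0 ≤ t) (ht : t < c) :
    ENNReal.ofReal t ≤ weakNorm m p g := by
  have hP := isProbabilityMeasure_haar m hm
  refine le_iSup_of_le t.toNNReal ?_
  change ENNReal.ofReal t ≤ ENNReal.ofReal t * haar m {x | ENNReal.ofReal t < ‖g x‖ₑ} ^ (1 / p)
  have : {x | ENNReal.ofReal t < ‖g x‖ₑ} = Set.univ := by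
    refine Set.eq_univ_of_forall fun x => ?_
    rw [Set.mem_ofPred_eq, ← ofReal_norm, hg]
    exact (ENNReal.ofReal_lt_ofReal_iff_of_nonneg ht0).mpr ht
  rw [this, measure_univ, ENNReal.one_rpow, mul_one]

section

variable {Φ : ℕ → ℝ}

/-- The order is `M_N + 2`, where the mean has constant modulus, so the weak quasi-norm loses
nothing. The ratio to the Hardy norm is at least `M_N^{1/p-2} / (2 Φ)`. -/
theorem exists_weakNorm_gt (hm : ∀ k, 2 ≤ m k) {B : ℕ} (hB : ∀ k, m k ≤ B) {p : ℝ} (hp0 : 0 < p)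
    (hp : p < 1 / 2) (hmono : Monotone Φ) (hΦ : ∀ n, 0 < Φ n)
    (h : limsup (fun n : ℕ => ((weight p n / Φ n : ℝ) : EReal)) atTop = ⊤) (C : ℝ≥0) :
    ∃ f : ℕ → Group m → ℂ, ∃ n : ℕ, 1 ≤ n ∧ MemHardy m p f ∧ hardyNorm m p f ≠ 0 ∧
      C * hardyNorm m p f < weakNorm m p (fun x => fejerMean m n f x / (Φ n : ℂ)) := by
  have hα0 : 0 < 1 / p - 2 := by
    rw [sub_pos, lt_div_iff₀ hp0]; linarith
  have hB1 : 2 ≤ B := (hm 0).trans (hB 0)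
  -- The constant collects `n₀ + 1 ≤ 2 B M_N`, `M_N + 2 ≤ 2 M_N`, and `C + 1` in place of `C` for
  -- strictness. Starting at `2 M_1` forces `N ≥ 1`, hence `2 ≤ M_N`.
  obtain ⟨n₀, hn₀, hlt⟩ := exists_weight_gt hΦ h
    (2 * (C + 1) * (2 * (B : ℝ)) ^ (1 / p - 2)) (2 * M m 1)
  obtain ⟨N, hN, hle, hlt'⟩ := exists_level hm hn₀
  have hMpos : (0 : ℝ) < M m N := by exact_mod_cast M_pos hm N
  have hM2 : 2 ≤ M m N := by
    have := (two_pow_le_M hm 1).trans (M_mono hm hN)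
    simpa using this
  have hnn : M m N + 2 ≤ 2 * M m N := by omega
  set c := 1 / (((M m N + 2 : ℕ) : ℝ) * M m N * Φ (M m N + 2)) with hc
  have hΦn := hΦ (M m N + 2)
  have hnorm : ∀ x, ‖fejerMean m (M m N + 2) (testMartingale m N) x / (Φ (M m N + 2) : ℂ)‖ = c :=
    fun x => by rw [norm_fejerMean_testMartingale hm hM2 hΦn, fejer_two, norm_one]
  refine ⟨testMartingale m N, M m N + 2, by omega, memHardy_testMartingale hm hp0 N,
    hardyNorm_testMartingale_ne_zero hm hp0 N, ?_⟩
  have h1 : ((C : ℝ) + 1) * (2 * Φ (M m N + 2)) < (M m N : ℝ) ^ (1 / p - 2) := by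
    have hw : weight p n₀ ≤ (2 * (B : ℝ)) ^ (1 / p - 2) * (M m N : ℝ) ^ (1 / p - 2) := by
      rw [weight_of_lt hp, ← Real.mul_rpow (by positivity) (by positivity)]
      gcongr
      have h2 : n₀ + 1 ≤ 2 * B * M m N := by
        have := M_succ_le hB N
        calc n₀ + 1 ≤ 2 * M m (N + 1) := hlt'
          _ ≤ 2 * (B * M m N) := by gcongr
          _ = _ := by ring
      exact_mod_cast h2
    have h2 : Φ (M m N + 2) ≤ Φ n₀ := hmono (hnn.trans hle)
    have h3 : 0 < (2 * (B : ℝ)) ^ (1 / p - 2) := by positivity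
    have h4 := hlt.trans_le hw
    have h5 : (2 * (B : ℝ)) ^ (1 / p - 2) * (((C : ℝ) + 1) * (2 * Φ (M m N + 2))) ≤
        2 * (C + 1) * (2 * (B : ℝ)) ^ (1 / p - 2) * Φ n₀ := by
      calc _ = 2 * (C + 1) * (2 * (B : ℝ)) ^ (1 / p - 2) * Φ (M m N + 2) := by ring
        _ ≤ _ := by gcongr
    exact lt_of_mul_lt_mul_left (h5.trans_lt h4) h3.le
  have h2 : (M m N : ℝ) ^ (1 / p - 2) = (M m N : ℝ) ^ (1 / p) / (M m N : ℝ) ^ 2 := by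
    rw [Real.rpow_sub hMpos]; norm_num
  have h3 : ((C : ℝ) + 1) * (M m N : ℝ)⁻¹ ^ (1 / p) < c := by
    have hpw : 0 < (M m N : ℝ) ^ (1 / p) := by positivity
    have hn : ((M m N + 2 : ℕ) : ℝ) ≤ 2 * M m N := by exact_mod_cast hnn
    rw [h2, lt_div_iff₀ (by positivity)] at h1
    rw [Real.inv_rpow hMpos.le, ← div_eq_mul_inv, hc, div_lt_div_iff₀ hpw (by positivity), one_mul]
    refine lt_of_le_of_lt ?_ h1
    calc ((C : ℝ) + 1) * (((M m N + 2 : ℕ) : ℝ) * M m N * Φ (M m N + 2)) ≤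
        ((C : ℝ) + 1) * ((2 * M m N) * M m N * Φ (M m N + 2)) := by gcongr
      _ = _ := by ring
  have h4 := le_weakNorm_of_norm_eq (p := p) hm hnorm
    (t := ((C : ℝ) + 1) * (M m N : ℝ)⁻¹ ^ (1 / p)) (by positivity) h3
  refine lt_of_lt_of_le ?_ h4
  rw [hardyNorm_testMartingale hm hp0, ← ENNReal.ofReal_coe_nnreal, ← ENNReal.ofReal_mul C.coe_nonneg]
  have h5 : 0 < (M m N : ℝ)⁻¹ ^ (1 / p) := by positivity
  refine (ENNReal.ofReal_lt_ofReal_iff (by positivity)).mpr ?_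
  linarith

theorem exists_eLpNorm_gt (hm : ∀ k, 2 ≤ m k) {B : ℕ} (hB : ∀ k, m k ≤ B)
    (hmono : Monotone Φ) (hΦ : ∀ n, 0 < Φ n)
    (h : limsup (fun n : ℕ => ((weight (1 / 2) n / Φ n : ℝ) : EReal)) atTop = ⊤) (C : ℝ≥0) :
    ∃ f : ℕ → Group m → ℂ, ∃ n : ℕ, 1 ≤ n ∧ MemHardy m (1 / 2) f ∧ hardyNorm m (1 / 2) f ≠ 0 ∧
      C * hardyNorm m (1 / 2) f <
        eLpNorm (fun x => fejerMean m n f x / (Φ n : ℂ)) (ENNReal.ofReal (1 / 2)) (haar m) := by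
  have hhalf : (0 : ℝ) < 1 / 2 := by norm_num
  have hB1 : 2 ≤ B := (hm 0).trans (hB 0)
  have hBr : (2 : ℝ) ≤ B := by exact_mod_cast hB1
  have hlB : 0 < Real.log B := Real.log_pos (by linarith)
  -- With `log(n₀ + 1) ≤ (N + 2) log B ≤ 4 K log B = (32 log B) (K / 8)`, the constant leaves
  -- exactly the lower bound `(K / 8)²` of the kernel estimate.
  obtain ⟨n₀, hn₀, hlt⟩ := exists_weight_gt hΦ h
    (2 * (C + 1) * (32 * Real.log B) ^ 2) (2 * M m 8)
  obtain ⟨N, hN, hle, hlt'⟩ := exists_level hm hn₀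
  have hMpos : (0 : ℝ) < M m N := by exact_mod_cast M_pos hm N
  -- This gives `2 (K + 1) ≤ N`, so `b ≤ M_N`; moreover `N + 2 ≤ 4 K` for all `N ≥ 8`, which is why
  -- the level is at least `8`.
  set K := (N - 2) / 2 with hK
  set b := evenDigits m (K + 1) with hb
  have hbM : b ≤ M m N := (evenDigits_le hm _).trans (M_mono hm (by omega))
  have hKN : (N + 2 : ℝ) ≤ 4 * K := by
    have : N + 2 ≤ 4 * K := by omega
    exact_mod_cast this
  set c := ((M m N + b : ℕ) : ℝ) * M m N * Φ (M m N + b) with hc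
  have hMb := M_pos hm N
  have hΦn := hΦ (M m N + b)
  have hnpos : (0 : ℝ) < (M m N + b : ℕ) := by exact_mod_cast (by omega : 0 < M m N + b)
  have hc0 : 0 < c := by positivity
  refine ⟨testMartingale m N, M m N + b, by omega, memHardy_testMartingale hm hhalf N,
    hardyNorm_testMartingale_ne_zero hm hhalf N, ?_⟩
  have hlow : ENNReal.ofReal ((K / 8 : ℝ) ^ 2 / c) ≤
      eLpNorm (fun x => fejerMean m (M m N + b) (testMartingale m N) x / (Φ (M m N + b) : ℂ))
        (ENNReal.ofReal (1 / 2)) (haar m) := by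
    rw [eLpNorm_eq_lintegral_rpow_enorm_toReal (by simp) ENNReal.ofReal_ne_top,
      ENNReal.toReal_ofReal hhalf.le]
    have h1 : ∀ x, ‖fejerMean m (M m N + b) (testMartingale m N) x / (Φ (M m N + b) : ℂ)‖ₑ ^
        (1 / 2 : ℝ) = ENNReal.ofReal (c⁻¹ ^ (1 / 2 : ℝ)) * ‖fejer m b x‖ₑ ^ (1 / 2 : ℝ) := by
      intro x
      rw [← ofReal_norm, norm_fejerMean_testMartingale hm hbM hΦn, ← hc, div_eq_inv_mul,
        ENNReal.ofReal_mul (by positivity), ENNReal.mul_rpow_of_nonneg _ _ hhalf.le,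
        ENNReal.ofReal_rpow_of_nonneg (by positivity) hhalf.le, ofReal_norm]
    simp only [h1]
    rw [lintegral_const_mul _ ((measurable_fejer b).enorm.pow_const _)]
    refine le_trans (le_of_eq ?_) (ENNReal.rpow_le_rpow (mul_le_mul_right
      (le_lintegral_fejer_evenDigits hm K) _) (by norm_num))
    rw [← ENNReal.ofReal_mul (by positivity), ENNReal.ofReal_rpow_of_nonneg (by positivity)
      (by norm_num), Real.mul_rpow (by positivity) (by positivity), ← Real.rpow_mul (by positivity)]
    norm_num
    ring_nf
  refine lt_of_lt_of_le ?_ hlow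
  rw [hardyNorm_testMartingale hm hhalf, ← ENNReal.ofReal_coe_nnreal, ← ENNReal.ofReal_mul C.coe_nonneg]
  have hlog : Real.log ((n₀ : ℝ) + 1) ≤ 4 * K * Real.log B := by
    have h1 : n₀ + 1 ≤ B ^ (N + 2) := by
      calc n₀ + 1 ≤ 2 * M m (N + 1) := hlt'
        _ ≤ B * B ^ (N + 1) := Nat.mul_le_mul hB1 (M_le_pow hB _)
        _ = _ := by ring
    have h2 : ((n₀ : ℝ) + 1) ≤ (B : ℝ) ^ (N + 2) := by exact_mod_cast h1
    refine (Real.log_le_log (by positivity) h2).trans ?_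
    rw [Real.log_pow]
    push_cast
    gcongr
  have hlog0 : 0 ≤ Real.log ((n₀ : ℝ) + 1) := Real.log_nonneg (by
    have : (0 : ℝ) ≤ n₀ := by positivity
    linarith)
  have hw : weight (1 / 2) n₀ ≤ (4 * K * Real.log B) ^ 2 := by
    rw [weight_half]; gcongr
  have hmn : Φ (M m N + b) ≤ Φ n₀ := hmono ((by omega : M m N + b ≤ 2 * M m N).trans hle)
  have h1 : 2 * (C + 1) * Φ (M m N + b) < (K / 8 : ℝ) ^ 2 := by
    have h2 : (32 * Real.log B) ^ 2 * (2 * (C + 1) * Φ (M m N + b)) ≤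
        2 * (C + 1) * (32 * Real.log B) ^ 2 * Φ n₀ := by
      calc _ = 2 * (C + 1) * (32 * Real.log B) ^ 2 * Φ (M m N + b) := by ring
        _ ≤ _ := by gcongr
    have h3 : (4 * K * Real.log B) ^ 2 = (32 * Real.log B) ^ 2 * (K / 8 : ℝ) ^ 2 := by ring
    exact lt_of_mul_lt_mul_left ((h2.trans_lt hlt).trans_le (hw.trans h3.le)) (by positivity)
  have hc2 : c ≤ 2 * (M m N : ℝ) ^ 2 * Φ (M m N + b) := by
    have : ((M m N + b : ℕ) : ℝ) ≤ 2 * M m N := by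
      exact_mod_cast (by omega : M m N + b ≤ 2 * M m N)
    calc c ≤ (2 * M m N) * M m N * Φ (M m N + b) := by rw [hc]; gcongr
      _ = _ := by ring
  have h5 : (M m N : ℝ)⁻¹ ^ (1 / (1 / 2) : ℝ) = ((M m N : ℝ) ^ 2)⁻¹ := by
    norm_num
  have hC0 : (0 : ℝ) ≤ C := C.coe_nonneg
  rw [h5]
  refine (ENNReal.ofReal_lt_ofReal_iff_of_nonneg (by positivity)).mpr ?_
  rw [← div_eq_mul_inv, div_lt_div_iff₀ (by positivity) hc0]
  calc (C : ℝ) * c ≤ C * (2 * (M m N : ℝ) ^ 2 * Φ (M m N + b)) := by gcongr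
    _ ≤ (2 * (C + 1) * Φ (M m N + b)) * (M m N : ℝ) ^ 2 := by
        have : 0 ≤ (M m N : ℝ) ^ 2 * Φ (M m N + b) := by positivity
        nlinarith
    _ < _ := by gcongr

end

end Vilenkin

theorem mainTheorem5 (m : ℕ → ℕ) (hm : ∀ k, 2 ≤ m k) (hbdd : ∃ B : ℕ, ∀ k, m k ≤ B)
    (p : ℝ) (hp0 : 0 < p) (hp : p ≤ 1 / 2) :
    -- non-increasing coefficients
    (∀ q : ℕ → ℝ, (∀ k, 0 ≤ q k) → 0 < q 0 → Antitone q →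
      Vilenkin.BoundedHardyLp m p (Vilenkin.weightedMaximal m q (Vilenkin.weight p))) ∧
    -- non-decreasing coefficients
    (∀ q : ℕ → ℝ, (∀ k, 0 ≤ q k) → 0 < q 0 → Monotone q →
      ((fun n : ℕ => q (n - 1) / Vilenkin.Q q n) =O[atTop] fun n : ℕ => 1 / (n : ℝ)) →
      Vilenkin.BoundedHardyLp m p (Vilenkin.weightedMaximal m q (Vilenkin.weight p))) ∧
    -- sharpness of the weights, attained by the Fejér means
    (∀ Φ : ℕ → ℝ, Monotone Φ → (∀ n, 0 < Φ n) →
      limsup (fun n : ℕ => ((Vilenkin.weight p n / Φ n : ℝ) : EReal)) atTop = ⊤ →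
      ¬ Vilenkin.BoundedHardyLp m p (Vilenkin.weightedMaximal m (fun _ => 1) Φ) ∧
      (p < 1 / 2 → ∀ C : ℝ≥0, ∃ f : ℕ → Vilenkin.Group m → ℂ, ∃ n : ℕ, 1 ≤ n ∧
        Vilenkin.MemHardy m p f ∧ Vilenkin.hardyNorm m p f ≠ 0 ∧
        C * Vilenkin.hardyNorm m p f <
          Vilenkin.weakNorm m p (fun x => Vilenkin.fejerMean m n f x / (Φ n : ℂ))) ∧
      (p = 1 / 2 → ∀ C : ℝ≥0, ∃ f : ℕ → Vilenkin.Group m → ℂ, ∃ n : ℕ, 1 ≤ n ∧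
        Vilenkin.MemHardy m p f ∧ Vilenkin.hardyNorm m p f ≠ 0 ∧
        C * Vilenkin.hardyNorm m p f <
          eLpNorm (fun x => Vilenkin.fejerMean m n f x / (Φ n : ℂ)) (ENNReal.ofReal p)
            (Vilenkin.haar m))) := by
  obtain ⟨B, hB⟩ := hbdd
  obtain ⟨C, hw⟩ := Vilenkin.exists_admissibleWeight hm hp0 hp
  have hp1 : p ≤ 1 := by linarith
  refine ⟨fun q hq0 hpos hq => Vilenkin.boundedHardyLp_of_admissible hm hB hp0 hp1 hw
    (Vilenkin.admissibleCoefficients_of_antitone hq0 hpos hq), fun q hq0 hpos hq hO => ?_,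
    fun Φ hmono hΦ hlim => ?_⟩
  · obtain ⟨D, hD⟩ := Vilenkin.admissibleCoefficients_of_monotone hq0 hpos hq hO
    exact Vilenkin.boundedHardyLp_of_admissible hm hB hp0 hp1 hw hD
  have hweak := fun h : p < 1 / 2 => Vilenkin.exists_weakNorm_gt hm hB hp0 h hmono hΦ hlim
  have hstrong : p = 1 / 2 → ∀ C : ℝ≥0, ∃ f : ℕ → Vilenkin.Group m → ℂ, ∃ n : ℕ, 1 ≤ n ∧
      Vilenkin.MemHardy m p f ∧ Vilenkin.hardyNorm m p f ≠ 0 ∧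
      C * Vilenkin.hardyNorm m p f <
        eLpNorm (fun x => Vilenkin.fejerMean m n f x / (Φ n : ℂ)) (ENNReal.ofReal p)
          (Vilenkin.haar m) := by
    rintro rfl
    exact Vilenkin.exists_eLpNorm_gt hm hB hmono hΦ hlim
  refine ⟨?_, hweak, hstrong⟩
  rintro ⟨C, hC⟩
  rcases hp.lt_or_eq with h | h
  · obtain ⟨f, n, hn, hf, -, hlt⟩ := hweak h C
    exact absurd ((Vilenkin.weakNorm_le_eLpNorm hp0
      ((Vilenkin.measurable_fejerMean n f).div_const _)).trans
      ((Vilenkin.eLpNorm_fejerMean_le hΦ p hn f).trans (hC f hf))) (not_le.mpr hlt)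
  · obtain ⟨f, n, hn, hf, -, hlt⟩ := hstrong h C
    exact absurd ((Vilenkin.eLpNorm_fejerMean_le hΦ p hn f).trans (hC f hf)) (not_le.mpr hlt)
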